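/- **Setting (trigonometric $q$-Racah ensembles).** Let $0<g_q<\pi$, $g_\alpha,g_\beta,g_\delta\in\mathbb R$, $q=e^{ig_q}$ and $q^t:=e^{ig_qt}$ for $t\in\mathbb R$; put $\alpha=q^{g_\alpha}$, $\beta=q^{g_\beta}$, $\delta=q^{g_\delta}$. For each $n$ let $M=M_n\in\mathbb N$, and set $\mathbf q=q^{1/n}$, $g_{\gamma_n}=-\frac{M_n+1}{n}$, $\gamma_n=q^{g_{\gamma_n}}$. Assume $g_{\gamma_n}\to g_\gamma\in\left(-\frac{\pi}{g_q},0\right)$ and put $\gamma=q^{g_\gamma}$. Assume that there are integers $j,k,l,m,k_2$ with $|l-m|$ odd such that for all sufficiently large $n$ one has $n\le M_n$ and $$-\tfrac{\pi}{g_q}\le g_{\gamma_n}\le -1,\qquad \tfrac{2\pi j}{g_q}\le g_\alpha,\,g_\beta\le g_{\gamma_n}+\tfrac{2\pi(j+1)}{g_q},\qquad \tfrac{2\pi k}{g_q}\le g_\alpha+g_\beta\le 2g_{\gamma_n}+\tfrac{2\pi(k+1)}{g_q},$$ $$\tfrac{2\pi l}{g_q}\le g_\beta+g_\delta\le \tfrac{2\pi(l+1)}{g_q}+g_{\gamma_n},\qquad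 \tfrac{2\pi m}{g_q}\le g_\alpha-g_\delta\le \tfrac{2\pi(m+1)}{g_q}+g_{\gamma_n},\qquad \tfrac{2\pi k_2}{g_q}\le g_{\gamma_n}+g_\delta\le\tfrac{2\pi(k_2+1)}{g_q}+2g_{\gamma_n},$$ and that there is an integer $k_1$ with $$\tfrac{2\pi k_1}{g_q}<g_\alpha+g_\beta<\tfrac{2\pi(k_1+1)}{g_q}+2g_\gamma .$$ The $q$-Racah ensemble of size $n$ is the probability distribution of $(y_1,\dots,y_n)\in\{0,\dots,M_n\}^n$ proportional to $\prod_{i<j}(\nu_n(y_i)-\nu_n(y_j))^2\prod_jw_n(y_j)$, where $\nu_n(y)=\mathbf q^{-y}+\delta\gamma_n\mathbf q^{y+1}$ and $$w_n(y)=\frac{(\alpha\mathbf q,\beta\delta\mathbf q,\gamma_n\mathbf q,\gamma_n\delta\mathbf q;\mathbf q)_y\,(1-\gamma_n\delta\mathbf q^{2y+1})}{(\mathbf q,\alpha^{-1}\gamma_n\delta\mathbf q,\beta^{-1}\gamma_n\mathbf q,\delta\mathbf q;\mathbf q)_y\,(\alpha\beta\mathbf q)^y\,(1-\gamma_n\delta\mathbf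 q)},$$ with $(x;\mathbf q)_k=\prod_{i<k}(1-x\mathbf q^i)$ and $(x_1,\dots,x_r;\mathbf q)_k=\prod_s(x_s;\mathbf q)_k$. (The common complex phase cancels in the normalization.) Its recurrence coefficients are built from $$A_j=\tfrac{(1-\gamma_n\mathbf q^{j+1})(1-\alpha\mathbf q^{j+1})(1-\alpha\beta\mathbf q^{j+1})(1-\delta\beta\mathbf q^{j+1})}{(1-\alpha\beta\mathbf q^{2j+1})(1-\alpha\beta\mathbf q^{2j+2})},\qquad C_j=\tfrac{\mathbf q(1-\mathbf q^j)(1-\beta\mathbf q^j)(\delta-\alpha\mathbf q^j)(\gamma_n-\alpha\beta\mathbf q^j)}{(1-\alpha\beta\mathbf q^{2j})(1-\alpha\beta\mathbf q^{2j+1})}.$$ Let $$A(\xi)=\tfrac{(1-\gamma q^\xi)(1-\alpha q^\xi)(1-\alpha\beta q^\xi)(1-\delta\beta q^\xi)}{(1-\alpha\beta q^{2\xi})^2},\qquad C(\xi)=\tfrac{(1-q^\xi)(1-\beta q^\xi)(\delta-\alpha q^\xi)(\gamma-\alpha\beta q^\xi)}{(1-\alpha\beta q^{2\xi})^2},$$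 $a(\xi)^2=A(\xi)C(\xi)$, $b(\xi)=1+\gamma\delta-A(\xi)-C(\xi)$, $\mu(x)=q^{-x}+\gamma\delta q^x$, and $\tilde y(\xi)=2\cos\left(g_q\left(\frac{g_\alpha+g_\beta}{2}+\xi\right)\right)$. **Theorem.** 1. For $\xi\in[0,-g_\gamma]$, as $j/n\to\xi$ one has $A_jC_{j+1}\to a(\xi)^2$ and $1+\delta\gamma_n\mathbf q-A_j-C_j\to b(\xi)$. 2. If $x\in[0,-g_\gamma]$ and $\mu'(x)\ne0$, the equation $4a(\xi)^2-(\mu(x)-b(\xi))^2=0$ has in $[0,-g_\gamma]$ exactly the solutions $\xi_-(x)\le\xi_+(x)$ (possibly coinciding). For $0<x<-g_\gamma$ one always has $\mu'(x)\neq0$ and $\xi_-(x)<\xi_+(x)$. 3. The rescaled ensembles have on $(0,-g_\gamma)$ the limiting density $$\rho(x)=\begin{cases}1&\xi_-(x)<\xi_+(x)\le1,\\[2pt] \dfrac1\pi\arccos\left((-1)^{k_1}\,\dfrac{2\tilde y(1)-\tilde y(\xi_-(x))-\tilde y(\xi_+(x))}{|\tilde y(\xi_-(x))-\tilde y(\xi_+(x))|}\right)&\xi_-(x)<1<\xi_+(x),\\[2pt]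 0&1\le\xi_-(x)<\xi_+(x).\end{cases}$$ That is: for $0<x<-g_\gamma$, $$\rho(x)=\frac{|\mu'(x)|}{\pi}\int_{\{\xi\in(0,1):\,D(x,\xi)\ge0\}}\frac{d\xi}{\sqrt{D(x,\xi)}},\qquad D(x,\xi)=\frac{4a(\xi)^2-(\mu(x)-b(\xi))^2}{\gamma\delta}\in\mathbb R,$$ and if the random vectors $(y_1,\dots,y_n)$, $n\ge1$, are defined on one probability space and, for all sufficiently large $n$, the $n$-th one has the law of the $q$-Racah ensemble of size $n$ (with arbitrary dependence between different $n$), then for every $f:\mathbb R\to\mathbb R$ that is bounded on bounded subsets of $[0,\infty)$ and continuous at almost every point of $[0,-g_\gamma]$, almost surely $$\lim_{n\to\infty}\frac1n\sum_{j=1}^nf\left(\frac{y_j}{n}\right)=\int_0^{-g_\gamma}f(x)\rho(x)\,dx .$$ -/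

import Mathlib

open MeasureTheory Filter Topology Set

noncomputable section

namespace QRacah

/-! ### The q-Racah ensemble with general complex parameters -/

/-- The q-Pochhammer symbol `(x; q)_k = (1 - x)(1 - xq) ⋯ (1 - xq^(k-1))`. -/
def qPoch (x q : ℂ) (k : ℕ) : ℂ := ∏ i ∈ Finset.range k, (1 - x * q ^ i)

/-- `ν(y) = q^(-y) + δ γ q^(y+1)`. -/
def nu (q γ δ : ℂ) (y : ℕ) : ℂ := (q ^ y)⁻¹ + δ * γ * q ^ (y + 1)

/-- The q-Racah weight. -/
def weight (q α β γ δ : ℂ) (y : ℕ) : ℂ :=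
  (qPoch (α * q) q y * qPoch (β * δ * q) q y * qPoch (γ * q) q y * qPoch (γ * δ * q) q y
      * (1 - γ * δ * q ^ (2 * y + 1)))
    / (qPoch q q y * qPoch (α⁻¹ * γ * δ * q) q y * qPoch (β⁻¹ * γ * q) q y * qPoch (δ * q) q y
      * (α * β * q) ^ y * (1 - γ * δ * q))

/-- The unnormalized joint density `∏_{i<j} (ν(y_i) - ν(y_j))² ∏_j w(y_j)` of `n` points in
`{0, …, M}`. -/
def jointWeight (q α β γ δ : ℂ) (n M : ℕ) (y : Fin n → Fin (M + 1)) : ℂ :=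
  (∏ i : Fin n, ∏ j ∈ Finset.Ioi i, (nu q γ δ (y i) - nu q γ δ (y j)) ^ 2)
    * ∏ i : Fin n, weight q α β γ δ (y i)

/-- `Y = (y_1, …, y_n)` is distributed as the q-Racah ensemble of size `n` on `{0, …, M}`: its
probability mass function is `jointWeight`, normalized to total mass one.  (A common complex
phase of the weights cancels in the normalization.) -/
def IsEnsemble {Ω : Type*} [MeasurableSpace Ω] (P : Measure Ω) (q α β γ δ : ℂ) (n M : ℕ)
    (Y : Ω → Fin n → Fin (M + 1)) : Prop :=
  Measurable Y ∧ ∀ y : Fin n → Fin (M + 1),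
    ((P.real (Y ⁻¹' {y}) : ℝ) : ℂ)
      = jointWeight q α β γ δ n M y / ∑ z : Fin n → Fin (M + 1), jointWeight q α β γ δ n M z

/-- The coefficient `A_j` of the q-Racah recurrence relation. -/
def recA (q α β γ δ : ℂ) (j : ℕ) : ℂ :=
  ((1 - γ * q ^ (j + 1)) * (1 - α * q ^ (j + 1)) * (1 - α * β * q ^ (j + 1))
      * (1 - δ * β * q ^ (j + 1)))
    / ((1 - α * β * q ^ (2 * j + 1)) * (1 - α * β * q ^ (2 * j + 2)))

/-- The coefficient `C_j` of the q-Racah recurrence relation. -/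
def recC (q α β γ δ : ℂ) (j : ℕ) : ℂ :=
  (q * (1 - q ^ j) * (1 - β * q ^ j) * (δ - α * q ^ j) * (γ - α * β * q ^ j))
    / ((1 - α * β * q ^ (2 * j)) * (1 - α * β * q ^ (2 * j + 1)))

/-! ### The trigonometric case and its scaling limit -/

/-- The (real) parameters of the scaled trigonometric ensembles: `q = e^(i gq)`, `α = q^gα`,
`β = q^gβ`, `δ = q^gδ`, and `gγ` is the limit of the exponents `g_{γ_n} = -(M_n + 1)/n`. -/
structure Params where
  gq : ℝ
  gα : ℝ
  gβ : ℝ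
  gδ : ℝ
  gγ : ℝ

namespace Params

variable (p : Params)

/-- `q^t = e^(i gq t)` for real `t`. -/
def qpow (t : ℝ) : ℂ := Complex.exp (Complex.I * ((p.gq * t : ℝ) : ℂ))

def α : ℂ := p.qpow p.gα
def β : ℂ := p.qpow p.gβ
def δ : ℂ := p.qpow p.gδ
def γ : ℂ := p.qpow p.gγ

/-- The base `q^(1/n)` of the ensemble of size `n`. -/
def base (n : ℕ) : ℂ := p.qpow (1 / n)

end Params

/-- The exponent `g_{γ_n}`, determined by `-n g_{γ_n} = M + 1`. -/
def gGamma (n M : ℕ) : ℝ := -((M + 1 : ℝ) / n)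

/-- `γ_n = q^(g_{γ_n})`. -/
def Params.gammaN (p : Params) (n M : ℕ) : ℂ := p.qpow (gGamma n M)

/-- The angle restrictions on the parameters of the ensemble of size `n` on `{0, …, M}`, with
`g = g_{γ_n}` and fixed integers `j, k, l, m, k₂`. -/
structure Restrictions (p : Params) (j k l m k₂ : ℤ) (g : ℝ) : Prop where
  lower : -(Real.pi / p.gq) ≤ g
  upper : g ≤ -1
  alpha_left : 2 * Real.pi * j / p.gq ≤ p.gα
  alpha_right : p.gα ≤ g + 2 * Real.pi * (j + 1) / p.gq
  beta_left : 2 * Real.pi * j / p.gq ≤ p.gβ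
  beta_right : p.gβ ≤ g + 2 * Real.pi * (j + 1) / p.gq
  alpha_beta_left : 2 * Real.pi * k / p.gq ≤ p.gα + p.gβ
  alpha_beta_right : p.gα + p.gβ ≤ 2 * g + 2 * Real.pi * (k + 1) / p.gq
  beta_delta_left : 2 * Real.pi * l / p.gq ≤ p.gβ + p.gδ
  beta_delta_right : p.gβ + p.gδ ≤ 2 * Real.pi * (l + 1) / p.gq + g
  alpha_delta_left : 2 * Real.pi * m / p.gq ≤ p.gα - p.gδ
  alpha_delta_right : p.gα - p.gδ ≤ 2 * Real.pi * (m + 1) / p.gq + g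
  gamma_delta_left : 2 * Real.pi * k₂ / p.gq ≤ g + p.gδ
  gamma_delta_right : g + p.gδ ≤ 2 * Real.pi * (k₂ + 1) / p.gq + 2 * g

namespace Params

variable (p : Params)

/-- `μ(x) = q^(-x) + γ δ q^x`. -/
def mu (x : ℝ) : ℂ := p.qpow (-x) + p.γ * p.δ * p.qpow x

/-- The limit of `A_j` as `j/n → ξ`. -/
def limA (ξ : ℝ) : ℂ :=
  ((1 - p.γ * p.qpow ξ) * (1 - p.α * p.qpow ξ) * (1 - p.α * p.β * p.qpow ξ)
      * (1 - p.δ * p.β * p.qpow ξ))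
    / (1 - p.α * p.β * p.qpow (2 * ξ)) ^ 2

/-- The limit of `C_j` as `j/n → ξ`. -/
def limC (ξ : ℝ) : ℂ :=
  ((1 - p.qpow ξ) * (1 - p.β * p.qpow ξ) * (p.δ - p.α * p.qpow ξ)
      * (p.γ - p.α * p.β * p.qpow ξ))
    / (1 - p.α * p.β * p.qpow (2 * ξ)) ^ 2

/-- The square `a(ξ)²` of the limiting off-diagonal recurrence coefficient. -/
def aSq (ξ : ℝ) : ℂ := p.limA ξ * p.limC ξ

/-- The limiting diagonal recurrence coefficient `b(ξ)`. -/
def b (ξ : ℝ) : ℂ := 1 + p.δ * p.γ - p.limA ξ - p.limC ξ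

/-- `4 a(ξ)² - (μ(x) - b(ξ))²`. -/
def D (x ξ : ℝ) : ℂ := 4 * p.aSq ξ - (p.mu x - p.b ξ) ^ 2

/-- `4 ã(ξ)² - (μ̃(x) - b̃(ξ))²`, where `ã, μ̃, b̃` arise from `a, μ, b` on division by
`(γδ)^(1/2)`, which makes them real. -/
def Dreal (x ξ : ℝ) : ℝ := (p.D x ξ / (p.γ * p.δ)).re

/-- `ỹ(ξ) = 2 cos(gq ((gα + gβ)/2 + ξ))`. -/
def yTilde (ξ : ℝ) : ℝ := 2 * Real.cos (p.gq * ((p.gα + p.gβ) / 2 + ξ))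

/-- The density in terms of the solutions `ξ₋ < ξ₊`; `k₁` is the integer for which
`gq ((gα + gβ)/2 + ξ)` lies in `(π k₁, π (k₁ + 1))` for all `ξ ∈ [0, -gγ]`. -/
def rho (k₁ : ℤ) (ξm ξp : ℝ) : ℝ :=
  if ξp ≤ 1 then 1
  else if ξm < 1 then
    1 / Real.pi * Real.arccos
      ((-1 : ℝ) ^ k₁ * (2 * p.yTilde 1 - p.yTilde ξm - p.yTilde ξp)
        / |p.yTilde ξm - p.yTilde ξp|)
  else 0

end Params

end QRacah

end

noncomputable section

namespace QRacah

/-! ### q-Pochhammer symbols -/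

/-! The weights are those for which the q-Racah polynomials are orthogonal, so the points form an
orthogonal polynomial ensemble. After removal of the common phase `(γ_n δ q^(1/n))^(1/2)`, the nodes
and recurrence coefficients become real trigonometric expressions, and the angle restrictions fix
the signs of all sines so that the weights are positive. Hence the law is `det(f_i(y_j))² / n!` with
real orthonormal `f_i` whose Jacobi matrix is the q-Racah one (`AngleBounds.exists_jacobiSystem`).
Orthogonality itself is proved from the hypergeometric sum: the three-term operator lowers the
Pochhammer basis, which gives the recurrence; the sum is symmetric under exchange of degree and node
together with `(a, b) ↔ (c, d)`, so the same computation gives a difference equation in the node,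
symmetric for the weight.

Concentration. By Andréief's identity the Laplace transform of a linear statistic is the determinant
of a Gram matrix, at most `exp(trace - n)`. This yields exponential tail bounds around the mean, and
Borel–Cantelli gives almost sure convergence under any coupling of the different `n`
(`ae_tendsto_of_hasDetLaw`). It remains to find the limit of the means.

Means. The mean of `∑ x(y_i)^m` is the trace of the `m`-th power of multiplication by the node,
compressed to the first `n` functions. Near level `ξ n` the Jacobi matrix is almost Toeplitz, with
symbol `b + 2a cos t` taken at `ξ`, so the normalized trace tends to the integral over `ξ ∈ (0, 1)`
of arcsine moments (`ScaledJacobi.tendsto_trace`). Pulling each arcsine law back by the monotone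
function `μ` and applying Fubini produces the density `|μ'(x)|/π ∫ dξ / √D`
(`LimitBounds.integral_density`). Weierstrass approximation, inversion of the nodes and Lipschitz
envelopes pass from moments to Riemann integrable functions of `y/n`.

Explicit density. The discriminant inherits the duality: up to squared sines, `D(x, ξ)` equals the
discriminant with `x, ξ` and `(α, β), (γ, δ)` exchanged (`Params.duality`). For fixed `x` it is
therefore a quadratic polynomial in `ỹ(ξ)`, and `ỹ` is strictly monotone on `[0, -gγ]`. This gives
at most two roots and an arccosine as antiderivative of the integrand.

Both uses need the band `[b - 2a, b + 2a]`, and its dual, to lie in the range of `μ`, respectively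
`ỹ`. The product `A C` can be split as `A' C'` with factors of the opposite sign so that `b + A + C`
and `b + A' + C'` are the two endpoint values; the inequality of arithmetic and geometric means then
bounds the band on either side (`band_mem`). The signs required come from the relation `l = k₂ + k -
j`, forced by the restrictions and the parity of `l - m`. -/

lemma qPoch_zero (x q : ℂ) : qPoch x q 0 = 1 := by simp [qPoch]

lemma qPoch_succ (x q : ℂ) (k : ℕ) : qPoch x q (k + 1) = qPoch x q k * (1 - x * q ^ k) := by
  simp [qPoch, Finset.prod_range_succ]

lemma one_sub_mul_qPoch (x q : ℂ) (k : ℕ) :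
    (1 - x) * qPoch (x * q) q k = qPoch x q (k + 1) := by
  rw [qPoch, qPoch, Finset.prod_range_succ']
  simp only [pow_succ', mul_assoc, pow_zero, mul_one]
  ring

lemma qPoch_div_succ {q : ℂ} (hq : q ≠ 0) (x : ℂ) (k : ℕ) :
    qPoch (x / q) q (k + 1) = (1 - x / q) * qPoch x q k := by
  rw [← one_sub_mul_qPoch, div_mul_cancel₀ x hq]

lemma qPoch_ne_zero {x q : ℂ} {k : ℕ} (h : ∀ i < k, x * q ^ i ≠ 1) : qPoch x q k ≠ 0 := by
  rw [qPoch, Finset.prod_ne_zero_iff]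
  intro i hi
  exact sub_ne_zero.2 (h i (Finset.mem_range.1 hi)).symm

lemma qPoch_eq_zero {x q : ℂ} {k i : ℕ} (hi : i < k) (h : x * q ^ i = 1) : qPoch x q k = 0 := by
  rw [qPoch]
  exact Finset.prod_eq_zero (Finset.mem_range.2 hi) (by rw [h, sub_self])

/-! ### The q-Racah polynomials -/

/-- The numerator `(u, v; q)_k` of the terms of the q-Racah sum. -/
def pochPair (q u v : ℂ) (k : ℕ) : ℂ := qPoch u q k * qPoch v q k

/-- The denominator of the terms of the q-Racah sum. -/
def racahDen (q a b c d : ℂ) (k : ℕ) : ℂ :=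
  qPoch (a * q) q k * qPoch (b * d * q) q k * qPoch (c * q) q k * qPoch q q k

/-- The terminating basic hypergeometric sum `₄φ₃(u, v, s, t; aq, bdq, cq; q, q)`. -/
def racahSum (q a b c d : ℂ) (M : ℕ) (u v s t : ℂ) : ℂ :=
  ∑ k ∈ Finset.range (M + 1), pochPair q u v k * pochPair q s t k * (q ^ k / racahDen q a b c d k)

lemma racahDen_swap (q a b c d : ℂ) (k : ℕ) : racahDen q a b c d k = racahDen q c d a b k := by
  simp only [racahDen]; rw [mul_comm b d]; ring

lemma racahSum_swap (q a b c d : ℂ) (M : ℕ) (u v s t : ℂ) :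
    racahSum q a b c d M u v s t = racahSum q c d a b M s t u v := by
  simp only [racahSum, racahDen_swap q a b c d]
  exact Finset.sum_congr rfl fun k _ => by ring

/-- Multiplication by `s + t - 1 - s t` on `pochPair q s t`. -/
lemma mul_pochPair {q : ℂ} (hq : q ≠ 0) (s t : ℂ) (k : ℕ) :
    (s + t - 1 - s * t) * pochPair q s t k
      = ((q ^ k)⁻¹ - 1) * (1 - s * t * q ^ k) * pochPair q s t k
        - (q ^ k)⁻¹ * pochPair q s t (k + 1) := by
  have hK : q ^ k ≠ 0 := pow_ne_zero _ hq
  simp only [pochPair, qPoch_succ]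
  field_simp
  ring

/-- The operator of the three-term recurrence, in the variable `z = q^j`. -/
def threeTerm (A C : ℂ) (f : ℂ → ℂ) (q z : ℂ) : ℂ :=
  A * (f (z * q) - f z) + C * (f (z / q) - f z)

/-- If the three-term operator lowers the basis, the sum satisfies the recurrence. -/
lemma racahSum_recurrence_of_lowering {q a b c d : ℂ} {M : ℕ} (hq : q ≠ 0) {s t z A C : ℂ}
    (hst : s * t = c * d * q) (hden : racahDen q a b c d M ≠ 0)
    (hG : pochPair q s t (M + 1) = 0)
    (hlow : ∀ k, threeTerm A C (fun z => pochPair q z⁻¹ (a * b * q * z) (k + 1)) q z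
      = ((q ^ (k + 1))⁻¹ - 1) * (1 - c * d * q * q ^ (k + 1))
          * pochPair q z⁻¹ (a * b * q * z) (k + 1)
        - (q ^ k * q)⁻¹ * ((1 - a * q * q ^ k) * (1 - b * d * q * q ^ k) * (1 - c * q * q ^ k)
            * (1 - q * q ^ k)) * pochPair q z⁻¹ (a * b * q * z) k) :
    threeTerm A C (fun z => racahSum q a b c d M z⁻¹ (a * b * q * z) s t) q z
      = (s + t - 1 - c * d * q) * racahSum q a b c d M z⁻¹ (a * b * q * z) s t := by
  set F : ℂ → ℕ → ℂ := fun z k => pochPair q z⁻¹ (a * b * q * z) k with hF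
  set G : ℕ → ℂ := fun k => pochPair q s t k with hGd
  have hdenk : ∀ k ≤ M, racahDen q a b c d k ≠ 0 := by
    intro k hk
    have h0 : ∀ (x : ℂ), qPoch x q M ≠ 0 → qPoch x q k ≠ 0 := by
      intro x hx
      rw [qPoch, Finset.prod_ne_zero_iff] at hx ⊢
      intro i hi
      exact hx i (Finset.mem_range.2 ((Finset.mem_range.1 hi).trans_le hk))
    simp only [racahDen, mul_ne_zero_iff] at hden ⊢
    exact ⟨⟨⟨h0 _ hden.1.1.1, h0 _ hden.1.1.2⟩, h0 _ hden.1.2⟩, h0 _ hden.2⟩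
  have hL : threeTerm A C (fun z => racahSum q a b c d M z⁻¹ (a * b * q * z) s t) q z
      = ∑ k ∈ Finset.range (M + 1),
          threeTerm A C (fun z => F z k) q z * G k * (q ^ k / racahDen q a b c d k) := by
    simp only [threeTerm, racahSum, mul_sub, Finset.mul_sum, ← Finset.sum_sub_distrib,
      ← Finset.sum_add_distrib, hF, hGd]
    exact Finset.sum_congr rfl fun k _ => by ring
  have hR : (s + t - 1 - c * d * q) * racahSum q a b c d M z⁻¹ (a * b * q * z) s t
      = ∑ k ∈ Finset.range (M + 1),
          (((q ^ k)⁻¹ - 1) * (1 - c * d * q * q ^ k) * G k * F z k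
            * (q ^ k / racahDen q a b c d k)
          - F z k * G (k + 1) / racahDen q a b c d k) := by
    rw [racahSum, Finset.mul_sum]
    refine Finset.sum_congr rfl fun k _ => ?_
    have h := mul_pochPair hq s t k
    have hK : q ^ k ≠ 0 := pow_ne_zero _ hq
    rw [hst] at h
    calc _ = F z k * ((s + t - 1 - c * d * q) * G k) * (q ^ k / racahDen q a b c d k) := by
            simp only [hF, hGd]; ring
      _ = _ := by
            rw [hGd]; simp only; rw [h]
            field_simp
  -- Summation by parts: the `k = 0` term on the left vanishes because the basis function is
  -- constant, the top shifted term on the right vanishes by `hG`, and the rest match after an index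
  -- shift.
  rw [hL, hR, Finset.sum_sub_distrib, Finset.sum_range_succ' _ M, Finset.sum_range_succ' _ M,
    Finset.sum_range_succ (fun k => F z k * G (k + 1) / racahDen q a b c d k)]
  have h0 : threeTerm A C (fun z => F z 0) q z = 0 := by
    simp [threeTerm, hF, pochPair, qPoch_zero]
  have hGM : G (M + 1) = 0 := hG
  rw [h0, hGM]
  simp only [pow_zero, inv_one, sub_self, zero_mul, add_zero, mul_zero, zero_div]
  rw [← Finset.sum_sub_distrib]
  refine Finset.sum_congr rfl fun k hk => ?_
  have hk' := Finset.mem_range.1 hk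
  rw [show threeTerm A C (fun z => F z (k + 1)) q z = _ from hlow k]
  have hd0 := hdenk k hk'.le
  have hd1 := hdenk (k + 1) hk'
  have hds : racahDen q a b c d (k + 1) = racahDen q a b c d k * ((1 - a * q * q ^ k)
      * (1 - b * d * q * q ^ k) * (1 - c * q * q ^ k) * (1 - q * q ^ k)) := by
    simp only [racahDen, qPoch_succ]; ring
  have hK : q ^ k ≠ 0 := pow_ne_zero _ hq
  rw [hds] at hd1 ⊢
  have hx := right_ne_zero_of_mul hd1
  set x := (1 - a * q * q ^ k)
      * (1 - b * d * q * q ^ k) * (1 - c * q * q ^ k) * (1 - q * q ^ k)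
  rw [pow_succ]
  simp only [hF]
  field_simp

/-- The recurrence coefficient `A_j` with `z = q^j`, without the factor `1 - abqz`. -/
lemma threeTerm_pochPair {q z : ℂ} (hq : q ≠ 0) (hz : z ≠ 0) (v A C A' C' : ℂ) (k : ℕ)
    (hA : A = A' * (1 - v * z)) (hC : C = C' * (1 - z⁻¹)) :
    threeTerm A C (fun z => pochPair q z⁻¹ (v * z) (k + 1)) q z
      = pochPair q z⁻¹ (v * z) k * (A' * ((1 - z⁻¹ / q) * (1 - v * z * q ^ k)
          * (1 - v * z * q ^ k * q) - (1 - v * z) * (1 - z⁻¹ * q ^ k) * (1 - v * z * q ^ k))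
        + C' * ((1 - z⁻¹ * q ^ k) * (1 - z⁻¹ * q ^ k * q) * (1 - v * z / q)
          - (1 - z⁻¹) * (1 - z⁻¹ * q ^ k) * (1 - v * z * q ^ k))) := by
  have e1 : (z * q)⁻¹ = z⁻¹ / q := by field_simp
  have e2 : (z / q)⁻¹ = z⁻¹ * q := by field_simp
  have e3 : v * (z * q) = v * z * q := by ring
  have e4 : v * (z / q) = v * z / q := by ring
  have p1 : (1 - v * z) * qPoch (v * z * q) q (k + 1)
      = qPoch (v * z) q k * (1 - v * z * q ^ k) * (1 - v * z * q ^ k * q) := by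
    rw [one_sub_mul_qPoch, qPoch_succ, qPoch_succ, pow_succ]; ring
  have p2 : (1 - z⁻¹) * qPoch (z⁻¹ * q) q (k + 1)
      = qPoch z⁻¹ q k * (1 - z⁻¹ * q ^ k) * (1 - z⁻¹ * q ^ k * q) := by
    rw [one_sub_mul_qPoch, qPoch_succ, qPoch_succ, pow_succ]; ring
  simp only [threeTerm, pochPair, e1, e2, e3, e4, hA, hC, qPoch_div_succ hq]
  simp only [qPoch_succ _ q k] at p1 p2 ⊢
  linear_combination A' * (1 - z⁻¹ / q) * qPoch z⁻¹ q k * p1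
    + C' * (1 - v * z / q) * qPoch (v * z) q k * p2

/-- The lowering relation, given the rational identity it amounts to. -/
lemma lowering_of_identity {q z : ℂ} (hq : q ≠ 0) (hz : z ≠ 0) (a b c d A C A' C' : ℂ) (k : ℕ)
    (hA : A = A' * (1 - a * b * q * z)) (hC : C = C' * (1 - z⁻¹))
    (hid : k = 0 ∨ z ≠ 1 → A' * ((1 - z⁻¹ / q) * (1 - a * b * q * z * q ^ k)
          * (1 - a * b * q * z * q ^ k * q)
          - (1 - a * b * q * z) * (1 - z⁻¹ * q ^ k) * (1 - a * b * q * z * q ^ k))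
        + C' * ((1 - z⁻¹ * q ^ k) * (1 - z⁻¹ * q ^ k * q) * (1 - a * b * q * z / q)
          - (1 - z⁻¹) * (1 - z⁻¹ * q ^ k) * (1 - a * b * q * z * q ^ k))
        = ((q ^ k * q)⁻¹ - 1) * (1 - c * d * q * (q ^ k * q))
            * ((1 - z⁻¹ * q ^ k) * (1 - a * b * q * z * q ^ k))
          - (q ^ k * q)⁻¹ * ((1 - a * q * q ^ k) * (1 - b * d * q * q ^ k) * (1 - c * q * q ^ k)
            * (1 - q * q ^ k))) :
    threeTerm A C (fun z => pochPair q z⁻¹ (a * b * q * z) (k + 1)) q z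
      = ((q ^ (k + 1))⁻¹ - 1) * (1 - c * d * q * q ^ (k + 1))
          * pochPair q z⁻¹ (a * b * q * z) (k + 1)
        - (q ^ k * q)⁻¹ * ((1 - a * q * q ^ k) * (1 - b * d * q * q ^ k) * (1 - c * q * q ^ k)
            * (1 - q * q ^ k)) * pochPair q z⁻¹ (a * b * q * z) k := by
  rw [threeTerm_pochPair hq hz (a * b * q) A C A' C' k hA hC]
  have e : pochPair q z⁻¹ (a * b * q * z) (k + 1) = pochPair q z⁻¹ (a * b * q * z) k
      * ((1 - z⁻¹ * q ^ k) * (1 - a * b * q * z * q ^ k)) := by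
    simp only [pochPair, qPoch_succ]; ring
  rw [e, pow_succ]
  by_cases h : k = 0 ∨ z ≠ 1
  · linear_combination pochPair q z⁻¹ (a * b * q * z) k * hid h
  · push Not at h
    have : pochPair q z⁻¹ (a * b * q * z) k = 0 := by
      rw [pochPair, qPoch_eq_zero (i := 0) (Nat.pos_of_ne_zero h.1) (by simp [h.2]), zero_mul]
    rw [this]; ring

/-- Dividing out `pochPair` at `k` leaves an identity between rational functions of `q`, `z` and `K
= q^k`; `k` enters only through `K`. -/
lemma lowering_generic {q z : ℂ} (hq : q ≠ 0) (hz : z ≠ 0) (a b c d : ℂ) (k : ℕ)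
    (h0 : 1 - a * b * z ^ 2 ≠ 0) (h1 : 1 - a * b * q * z ^ 2 ≠ 0)
    (h2 : 1 - a * b * q ^ 2 * z ^ 2 ≠ 0) :
    threeTerm (((1 - c * (q * z)) * (1 - a * (q * z)) * (1 - a * b * (q * z))
          * (1 - d * b * (q * z))) / ((1 - a * b * q * z ^ 2) * (1 - a * b * q ^ 2 * z ^ 2)))
        ((q * (1 - z) * (1 - b * z) * (d - a * z) * (c - a * b * z))
          / ((1 - a * b * z ^ 2) * (1 - a * b * q * z ^ 2)))
        (fun z => pochPair q z⁻¹ (a * b * q * z) (k + 1)) q z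
      = ((q ^ (k + 1))⁻¹ - 1) * (1 - c * d * q * q ^ (k + 1))
          * pochPair q z⁻¹ (a * b * q * z) (k + 1)
        - (q ^ k * q)⁻¹ * ((1 - a * q * q ^ k) * (1 - b * d * q * q ^ k) * (1 - c * q * q ^ k)
            * (1 - q * q ^ k)) * pochPair q z⁻¹ (a * b * q * z) k := by
  -- The second witness uses `1 - z = -z (1 - z⁻¹)` to split off the factor `1 - z⁻¹`.
  refine lowering_of_identity hq hz a b c d _ _
    (((1 - c * (q * z)) * (1 - a * (q * z)) * (1 - d * b * (q * z)))
      / ((1 - a * b * q * z ^ 2) * (1 - a * b * q ^ 2 * z ^ 2)))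
    (-(q * z * (1 - b * z) * (d - a * z) * (c - a * b * z))
          / ((1 - a * b * z ^ 2) * (1 - a * b * q * z ^ 2))) k ?_ ?_ fun _ => ?_
  · ring
  · field_simp; ring
  · have hK : q ^ k ≠ 0 := pow_ne_zero _ hq
    generalize q ^ k = K at hK ⊢
    -- The denominators stay opaque while they are cleared, and are expanded only for the final
    -- polynomial identity.
    obtain ⟨D0, e0⟩ : ∃ D, D = 1 - a * b * z ^ 2 := ⟨_, rfl⟩
    obtain ⟨D1, e1⟩ : ∃ D, D = 1 - a * b * q * z ^ 2 := ⟨_, rfl⟩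
    obtain ⟨D2, e2⟩ : ∃ D, D = 1 - a * b * q ^ 2 * z ^ 2 := ⟨_, rfl⟩
    rw [← e0] at h0 ⊢
    rw [← e1] at h1 ⊢
    rw [← e2] at h2 ⊢
    field_simp
    subst e0 e1 e2
    ring

/-- At `z = 1` the coefficient `C` is zero through `1 - z`, but its denominator contains `1 - ab`,
about which nothing is known. So `C` is replaced by `0`; the rational identity is then needed only
for `k = 0`, since the basis functions of higher index vanish at `z = 1`. -/
lemma lowering_first {q : ℂ} (hq : q ≠ 0) (a b c d : ℂ) (k : ℕ)
    (h1 : 1 - a * b * q ≠ 0) (h2 : 1 - a * b * q ^ 2 ≠ 0) :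
    threeTerm (((1 - c * q) * (1 - a * q) * (1 - a * b * q)
          * (1 - d * b * q)) / ((1 - a * b * q) * (1 - a * b * q ^ 2))) 0
        (fun z => pochPair q z⁻¹ (a * b * q * z) (k + 1)) q 1
      = ((q ^ (k + 1))⁻¹ - 1) * (1 - c * d * q * q ^ (k + 1))
          * pochPair q 1⁻¹ (a * b * q * 1) (k + 1)
        - (q ^ k * q)⁻¹ * ((1 - a * q * q ^ k) * (1 - b * d * q * q ^ k) * (1 - c * q * q ^ k)
            * (1 - q * q ^ k)) * pochPair q 1⁻¹ (a * b * q * 1) k := by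
  refine lowering_of_identity hq one_ne_zero a b c d _ _
    (((1 - c * q) * (1 - a * q) * (1 - d * b * q))
      / ((1 - a * b * q) * (1 - a * b * q ^ 2))) 0 k ?_ (by simp) fun h => ?_
  · ring
  · obtain rfl : k = 0 := by simpa using h
    simp only [pow_zero]
    obtain ⟨D1, e1⟩ : ∃ D, D = 1 - a * b * q := ⟨_, rfl⟩
    obtain ⟨D2, e2⟩ : ∃ D, D = 1 - a * b * q ^ 2 := ⟨_, rfl⟩
    rw [← e1] at h1 ⊢
    rw [← e2] at h2 ⊢
    field_simp
    subst e1 e2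
    ring

/-- At the top of the range `A` vanishes through `1 - aqz`, while its denominator factor `1 -
abq²z²` is not known to be nonzero; hence the separate case with `A = 0`. -/
lemma lowering_last {q z : ℂ} (hq : q ≠ 0) (hz : z ≠ 0) (b c d : ℂ) (k : ℕ)
    (a : ℂ) (ha : a * (q * z) = 1)
    (h0 : 1 - a * b * z ^ 2 ≠ 0) (h1 : 1 - a * b * q * z ^ 2 ≠ 0) :
    threeTerm 0 ((q * (1 - z) * (1 - b * z) * (d - a * z) * (c - a * b * z))
          / ((1 - a * b * z ^ 2) * (1 - a * b * q * z ^ 2)))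
        (fun z => pochPair q z⁻¹ (a * b * q * z) (k + 1)) q z
      = ((q ^ (k + 1))⁻¹ - 1) * (1 - c * d * q * q ^ (k + 1))
          * pochPair q z⁻¹ (a * b * q * z) (k + 1)
        - (q ^ k * q)⁻¹ * ((1 - a * q * q ^ k) * (1 - b * d * q * q ^ k) * (1 - c * q * q ^ k)
            * (1 - q * q ^ k)) * pochPair q z⁻¹ (a * b * q * z) k := by
  obtain rfl : a = (q * z)⁻¹ := eq_inv_of_mul_eq_one_left ha
  refine lowering_of_identity hq hz _ b c d _ _ 0
    (-(q * z * (1 - b * z) * (d - (q * z)⁻¹ * z) * (c - (q * z)⁻¹ * b * z))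
          / ((1 - (q * z)⁻¹ * b * z ^ 2) * (1 - (q * z)⁻¹ * b * q * z ^ 2))) k (by simp) ?_
    fun _ => ?_
  · field_simp; ring
  · have hK : q ^ k ≠ 0 := pow_ne_zero _ hq
    have e0 : 1 - (q * z)⁻¹ * b * z ^ 2 = (q - b * z) / q := by field_simp
    have e1 : 1 - (q * z)⁻¹ * b * q * z ^ 2 = 1 - b * z := by field_simp
    rw [e0] at h0 ⊢
    rw [e1] at h1 ⊢
    have h0' : q - b * z ≠ 0 := fun h => h0 (by rw [h, zero_div])
    generalize q ^ k = K at hK ⊢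
    clear e0 e1 h0
    obtain ⟨D0, e0⟩ : ∃ D, D = q - b * z := ⟨_, rfl⟩
    obtain ⟨D1, e1⟩ : ∃ D, D = 1 - b * z := ⟨_, rfl⟩
    rw [← e0] at h0' ⊢
    rw [← e1] at h1 ⊢
    field_simp
    subst e0 e1
    ring

/-! ### Recurrence, difference equation and orthogonality of the q-Racah polynomials -/

/-- The parameters are such that no factor of the weights and of the relevant recurrence
coefficients on `{0, …, M}` vanishes, except that `c q^(M+1) = 1`. -/
structure Nondegenerate (q a b c d : ℂ) (M : ℕ) : Prop where
  q_ne : q ≠ 0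
  a_ne : a ≠ 0
  b_ne : b ≠ 0
  q_pow : ∀ i, 1 ≤ i → i ≤ M → q ^ i ≠ 1
  a_pow : ∀ i, 1 ≤ i → i ≤ M → a * q ^ i ≠ 1
  bd_pow : ∀ i, 1 ≤ i → i ≤ M → b * d * q ^ i ≠ 1
  c_pow : ∀ i, 1 ≤ i → i ≤ M → c * q ^ i ≠ 1
  c_last : c * q ^ (M + 1) = 1
  d_pow : ∀ i, 1 ≤ i → i ≤ M → d * q ^ i ≠ 1
  ab_pow : ∀ i, 1 ≤ i → i ≤ 2 * M + 1 → a * b * q ^ i ≠ 1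
  cd_pow : ∀ i, 1 ≤ i → i ≤ 2 * M + 1 → c * d * q ^ i ≠ 1
  acd_pow : ∀ i, 1 ≤ i → i ≤ M → c * d * q ^ i ≠ a
  bc_pow : ∀ i, 1 ≤ i → i ≤ M → c * q ^ i ≠ b

/-- The q-Racah polynomial of degree `j` at the `y`-th node. -/
def racah (q a b c d : ℂ) (M j y : ℕ) : ℂ :=
  racahSum q a b c d M (q ^ j)⁻¹ (a * b * q * q ^ j) (q ^ y)⁻¹ (c * d * q * q ^ y)

/-- Degree and node play the same role in the sum. This makes the difference equation in `y` a
recurrence in disguise. -/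
lemma racah_swap (q a b c d : ℂ) (M j y : ℕ) : racah q a b c d M j y = racah q c d a b M y j := by
  rw [racah, racahSum_swap, racah]

lemma racah_zero_left (q a b c d : ℂ) (M y : ℕ) : racah q a b c d M 0 y = 1 := by
  rw [racah, racahSum, Finset.sum_eq_single 0]
  · simp [pochPair, qPoch_zero, racahDen]
  · intro k _ hk
    rw [pochPair, qPoch_eq_zero (i := 0) (Nat.pos_of_ne_zero hk) (by simp), zero_mul, zero_mul,
      zero_mul]
  · simp

lemma recA_eq (q a b c d : ℂ) (j : ℕ) : recA q a b c d j
    = ((1 - c * (q * q ^ j)) * (1 - a * (q * q ^ j)) * (1 - a * b * (q * q ^ j))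
          * (1 - d * b * (q * q ^ j)))
        / ((1 - a * b * q * (q ^ j) ^ 2) * (1 - a * b * q ^ 2 * (q ^ j) ^ 2)) := by
  have e1 : q ^ (j + 1) = q * q ^ j := pow_succ' _ _
  have e2 : q ^ (2 * j + 1) = q * (q ^ j) ^ 2 := by ring
  have e3 : q ^ (2 * j + 2) = q ^ 2 * (q ^ j) ^ 2 := by ring
  rw [recA, e1, e2, e3]
  simp only [mul_assoc]

lemma recC_eq (q a b c d : ℂ) (j : ℕ) : recC q a b c d j
    = ((q * (1 - q ^ j) * (1 - b * q ^ j) * (d - a * q ^ j) * (c - a * b * q ^ j))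
          / ((1 - a * b * (q ^ j) ^ 2) * (1 - a * b * q * (q ^ j) ^ 2))) := by
  have e1 : q ^ (2 * j) = (q ^ j) ^ 2 := by ring
  have e2 : q ^ (2 * j + 1) = q * (q ^ j) ^ 2 := by ring
  rw [recC, e1, e2]
  simp only [mul_assoc]

lemma recC_zero (q a b c d : ℂ) : recC q a b c d 0 = 0 := by simp [recC]

/-- The alternative in `hlast` covers both the interior and the last index, where a vanishing `A_j`
makes up for an uncontrolled denominator. At `j = 0` the truncated `j - 1` is harmless because `C_0
= 0`. -/
lemma racahSum_threeTerm {q a b c d : ℂ} {M : ℕ} (hq : q ≠ 0) (hden : racahDen q a b c d M ≠ 0)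
    {j y : ℕ} (hy : y ≤ M)
    (hab : ∀ i, 1 ≤ i → i ≤ 2 * j + 1 → a * b * q ^ i ≠ 1)
    (hlast : a * b * q ^ (2 * j + 2) ≠ 1 ∨ j ≠ 0 ∧ a * q ^ (j + 1) = 1) :
    recA q a b c d j * (racah q a b c d M (j + 1) y - racah q a b c d M j y)
      + recC q a b c d j * (racah q a b c d M (j - 1) y - racah q a b c d M j y)
      = ((q ^ y)⁻¹ + c * d * q * q ^ y - 1 - c * d * q) * racah q a b c d M j y := by
  have hz : q ^ j ≠ 0 := pow_ne_zero _ hq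
  have hqy : q ^ y ≠ 0 := pow_ne_zero _ hq
  have hG : pochPair q (q ^ y)⁻¹ (c * d * q * q ^ y) (M + 1) = 0 := by
    rw [pochPair, qPoch_eq_zero (i := y) (Nat.lt_succ_of_le hy) (inv_mul_cancel₀ hqy), zero_mul]
  have hst : (q ^ y)⁻¹ * (c * d * q * q ^ y) = c * d * q := by field_simp
  have hlow : ∀ k, threeTerm (recA q a b c d j) (recC q a b c d j)
      (fun z => pochPair q z⁻¹ (a * b * q * z) (k + 1)) q (q ^ j)
      = ((q ^ (k + 1))⁻¹ - 1) * (1 - c * d * q * q ^ (k + 1))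
          * pochPair q (q ^ j)⁻¹ (a * b * q * q ^ j) (k + 1)
        - (q ^ k * q)⁻¹ * ((1 - a * q * q ^ k) * (1 - b * d * q * q ^ k) * (1 - c * q * q ^ k)
            * (1 - q * q ^ k)) * pochPair q (q ^ j)⁻¹ (a * b * q * q ^ j) k := by
    intro k
    have h1 : 1 - a * b * q * (q ^ j) ^ 2 ≠ 0 := by
      have := hab (2 * j + 1) (by omega) le_rfl
      rw [sub_ne_zero]
      intro h; apply this; rw [h]; ring
    rcases Nat.eq_zero_or_pos j with rfl | hj
    · have h2 : 1 - a * b * q ^ 2 ≠ 0 := by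
        rcases hlast with h | h
        · rw [sub_ne_zero]; exact fun h' => h (by rw [h'])
        · exact absurd rfl h.1
      rw [recC_zero, recA_eq]
      have := lowering_first hq a b c d k (by simpa using h1) h2
      simpa using this
    · have h0 : 1 - a * b * (q ^ j) ^ 2 ≠ 0 := by
        have := hab (2 * j) (by omega) (by omega)
        rw [sub_ne_zero]
        intro h; apply this; rw [h]; ring
      rcases hlast with h | h
      · have h2 : 1 - a * b * q ^ 2 * (q ^ j) ^ 2 ≠ 0 := by
          rw [sub_ne_zero]
          intro h'; apply h; rw [h']; ring
        rw [recC_eq, recA_eq]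
        exact lowering_generic hq hz a b c d k h0 h1 h2
      · have ha : a * (q * q ^ j) = 1 := by rw [← h.2, pow_succ']
        rw [recC_eq, recA_eq, ha]
        simp only [sub_self, mul_zero, zero_mul, zero_div]
        exact lowering_last hq hz b c d k a ha h0 h1
  have key := racahSum_recurrence_of_lowering hq hst hden hG hlow
  have e1 : q ^ j * q = q ^ (j + 1) := (pow_succ _ _).symm
  simp only [threeTerm, e1] at key
  rcases Nat.eq_zero_or_pos j with rfl | hj
  · simpa [recC_zero, racah] using key
  · obtain ⟨i, rfl⟩ : ∃ i, j = i + 1 := ⟨j - 1, by omega⟩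
    have e2 : q ^ (i + 1) / q = q ^ i := by rw [pow_succ]; field_simp
    simp only [e2] at key
    simpa [racah] using key

namespace Nondegenerate

variable {q a b c d : ℂ} {M : ℕ}

lemma den_ne (h : Nondegenerate q a b c d M) : racahDen q a b c d M ≠ 0 := by
  have e : ∀ (x : ℂ) (i : ℕ), x * q * q ^ i = x * q ^ (i + 1) := fun x i => by ring
  refine mul_ne_zero (mul_ne_zero (mul_ne_zero ?_ ?_) ?_) ?_ <;>
    refine qPoch_ne_zero fun i hi => ?_
  · rw [e]; exact h.a_pow _ (by omega) (by omega)
  · rw [e]; exact h.bd_pow _ (by omega) (by omega)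
  · rw [e]; exact h.c_pow _ (by omega) (by omega)
  · rw [← pow_succ']; exact h.q_pow _ (by omega) (by omega)

lemma recurrence (h : Nondegenerate q a b c d M) {j y : ℕ} (hj : j < M) (hy : y ≤ M) :
    recA q a b c d j * (racah q a b c d M (j + 1) y - racah q a b c d M j y)
      + recC q a b c d j * (racah q a b c d M (j - 1) y - racah q a b c d M j y)
      = ((q ^ y)⁻¹ + c * d * q * q ^ y - 1 - c * d * q) * racah q a b c d M j y :=
  racahSum_threeTerm h.q_ne h.den_ne hy (fun i h1 h2 => h.ab_pow i h1 (by omega))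
    (Or.inl (h.ab_pow _ (by omega) (by omega)))

/-- This is the recurrence with `(a, b)` and `(c, d)` exchanged. Up to `y = M` it needs `c q^(M+1) =
1`; for `M = 0` the first and last indices would coincide, leaving `1 - cd` uncontrolled. -/
lemma difference (h : Nondegenerate q a b c d M) (hM : M ≠ 0) {j y : ℕ} (hj : j ≤ M)
    (hy : y ≤ M) :
    recA q c d a b y * (racah q a b c d M j (y + 1) - racah q a b c d M j y)
      + recC q c d a b y * (racah q a b c d M j (y - 1) - racah q a b c d M j y)
      = ((q ^ j)⁻¹ + a * b * q * q ^ j - 1 - a * b * q) * racah q a b c d M j y := by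
  simp only [racah_swap q a b c d M]
  refine racahSum_threeTerm h.q_ne (by rw [racahDen_swap]; exact h.den_ne) hj
    (fun i h1 h2 => h.cd_pow i h1 (by omega)) ?_
  rcases hy.lt_or_eq with hy | rfl
  · exact Or.inl (h.cd_pow _ (by omega) (by omega))
  · exact Or.inr ⟨hM, h.c_last⟩

lemma weight_succ (h : Nondegenerate q a b c d M) {y : ℕ} (hy : y < M) :
    weight q a b c d (y + 1) = weight q a b c d y *
      (((1 - a * q ^ (y + 1)) * (1 - b * d * q ^ (y + 1)) * (1 - c * q ^ (y + 1))
          * (1 - c * d * q ^ (y + 1)) * (1 - c * d * q ^ (2 * y + 3)))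
        / ((1 - q ^ (y + 1)) * (1 - a⁻¹ * c * d * q ^ (y + 1)) * (1 - b⁻¹ * c * q ^ (y + 1))
          * (1 - d * q ^ (y + 1)) * (a * b * q) * (1 - c * d * q ^ (2 * y + 1)))) := by
  have e : ∀ (x : ℂ) (i : ℕ), x * q * q ^ i = x * q ^ (i + 1) := fun x i => by ring
  have h1 : 1 - c * d * q ^ (2 * y + 1) ≠ 0 :=
    sub_ne_zero.2 (h.cd_pow _ (by omega) (by omega)).symm
  simp only [weight, qPoch_succ, e, show 2 * (y + 1) + 1 = 2 * y + 3 by ring, pow_succ (a * b * q)]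
  rw [show q * q ^ y = q ^ (y + 1) from (pow_succ' _ _).symm, ← mul_div_mul_right _ _ h1]
  rw [div_mul_div_comm]
  congr 1 <;> ring

lemma weight_zero (h : Nondegenerate q a b c d M) : weight q a b c d 0 = 1 := by
  have h1 : 1 - c * d * q ≠ 0 := by
    have := h.cd_pow 1 le_rfl (by omega)
    rw [pow_one] at this
    exact sub_ne_zero.2 this.symm
  simp [weight, qPoch_zero, h1]

/-- Detailed balance, which makes the dual difference operator symmetric for the weight. -/
lemma weight_mul_recA (h : Nondegenerate q a b c d M) {y : ℕ} (hy : y < M) :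
    weight q a b c d y * recA q c d a b y = weight q a b c d (y + 1) * recC q c d a b (y + 1) := by
  rw [h.weight_succ hy, mul_assoc]
  congr 1
  have hq := h.q_ne
  have ha := h.a_ne
  have hb := h.b_ne
  have n1 := sub_ne_zero.2 (h.cd_pow (2 * y + 1) (by omega) (by omega)).symm
  have n2 := sub_ne_zero.2 (h.cd_pow (2 * y + 2) (by omega) (by omega)).symm
  have n3 := sub_ne_zero.2 (h.cd_pow (2 * y + 3) (by omega) (by omega)).symm
  have m1 := sub_ne_zero.2 (h.q_pow (y + 1) (by omega) (by omega)).symm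
  have m2 := sub_ne_zero.2 (h.acd_pow (y + 1) (by omega) (by omega)).symm
  have m3 := sub_ne_zero.2 (h.bc_pow (y + 1) (by omega) (by omega)).symm
  have m4 := sub_ne_zero.2 (h.d_pow (y + 1) (by omega) (by omega)).symm
  have e1 : 1 - a⁻¹ * c * d * q ^ (y + 1) = (a - c * d * q ^ (y + 1)) / a := by field_simp
  have e2 : 1 - b⁻¹ * c * q ^ (y + 1) = (b - c * q ^ (y + 1)) / b := by field_simp
  rw [recA, recC, e1, e2, show 2 * (y + 1) = 2 * y + 2 by ring,
    show 2 * y + 2 + 1 = 2 * y + 3 by ring]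
  generalize q ^ (y + 1) = u at *
  generalize 1 - c * d * q ^ (2 * y + 1) = n at *
  generalize 1 - c * d * q ^ (2 * y + 2) = n' at *
  generalize 1 - c * d * q ^ (2 * y + 3) = n'' at *
  generalize 1 - u = m at *
  generalize a - c * d * u = m' at *
  generalize b - c * u = m'' at *
  generalize 1 - d * u = m''' at *
  field_simp

end Nondegenerate

/-- Eigenfunctions, to distinct eigenvalues, of a difference operator that is symmetric with
respect to the weight `w` are orthogonal. -/
lemma sum_mul_eq_zero_of_eigen {M : ℕ} {w B C f g : ℕ → ℂ} {lam mu : ℂ}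
    (hw : ∀ y < M, w y * B y = w (y + 1) * C (y + 1)) (hB : B M = 0) (hC : C 0 = 0)
    (hf : ∀ y ≤ M, B y * (f (y + 1) - f y) + C y * (f (y - 1) - f y) = lam * f y)
    (hg : ∀ y ≤ M, B y * (g (y + 1) - g y) + C y * (g (y - 1) - g y) = mu * g y)
    (hne : lam ≠ mu) : ∑ y ∈ Finset.range (M + 1), w y * (f y * g y) = 0 := by
  -- A discrete Green formula: the partial sums telescope to a Casoratian at the upper end, and `C 0
  -- = 0` removes the lower end.
  have key : ∀ N ≤ M, (lam - mu) * ∑ y ∈ Finset.range (N + 1), w y * (f y * g y)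
      = w N * B N * (f (N + 1) * g N - f N * g (N + 1)) := by
    intro N
    induction N with
    | zero =>
      intro h
      have h1 := hf 0 h
      have h2 := hg 0 h
      rw [hC] at h1 h2
      simp only [zero_add, Finset.range_one, Finset.sum_singleton]
      rw [zero_add] at h1 h2
      linear_combination -(w 0 * g 0) * h1 + w 0 * f 0 * h2
    | succ N ih =>
      intro h
      have h1 := hf (N + 1) h
      have h2 := hg (N + 1) h
      rw [Nat.add_sub_cancel] at h1 h2
      rw [Finset.sum_range_succ, mul_add, ih (by omega), hw N (by omega)]
      linear_combination -(w (N + 1) * g (N + 1)) * h1 + w (N + 1) * f (N + 1) * h2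
  have := key M le_rfl
  rw [hB, mul_zero, zero_mul] at this
  exact (mul_eq_zero.1 this).resolve_left (sub_ne_zero.2 hne)

namespace Nondegenerate

variable {q a b c d : ℂ} {M : ℕ}

lemma pow_ne_pow (h : Nondegenerate q a b c d M) {i j : ℕ} (hij : i < j)
    (hj : j ≤ M) : q ^ j ≠ q ^ i := by
  intro e
  have hi0 : q ^ i ≠ 0 := pow_ne_zero _ h.q_ne
  apply h.q_pow (j - i) (by omega) (by omega)
  rw [← Nat.add_sub_cancel' hij.le, pow_add] at e
  exact mul_left_cancel₀ hi0 (by rw [e, mul_one])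

/-- The function `j ↦ q^(-j) + e q^(j+1)` is injective on `{0, …, M}`. -/
lemma inv_add_ne (h : Nondegenerate q a b c d M) {e : ℂ}
    (he : ∀ i, 1 ≤ i → i ≤ 2 * M + 1 → e * q ^ i ≠ 1) {i j : ℕ} (hij : i < j) (hj : j ≤ M) :
    (q ^ i)⁻¹ + e * q * q ^ i ≠ (q ^ j)⁻¹ + e * q * q ^ j := by
  intro hE
  have hi0 : q ^ i ≠ 0 := pow_ne_zero _ h.q_ne
  have hj0 : q ^ j ≠ 0 := pow_ne_zero _ h.q_ne
  have h1 := sub_ne_zero.2 (h.pow_ne_pow hij hj)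
  have h2 := sub_ne_zero.2 (he (i + j + 1) (by omega) (by omega))
  apply mul_ne_zero h1 h2
  field_simp at hE
  rw [show q ^ (i + j + 1) = q ^ i * q ^ j * q by ring]
  linear_combination -hE

/-- As functions of the node, the polynomials are eigenfunctions of the symmetric dual operator. Its
boundary terms vanish by `C_0 = 0` and `c q^(M+1) = 1`, and the eigenvalues are distinct by
`inv_add_ne`. -/
lemma orthogonal (h : Nondegenerate q a b c d M) (hM : M ≠ 0) {i j : ℕ} (hi : i ≤ M) (hj : j ≤ M)
    (hij : i ≠ j) :
    ∑ y ∈ Finset.range (M + 1), weight q a b c d y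
      * (racah q a b c d M i y * racah q a b c d M j y) = 0 := by
  refine sum_mul_eq_zero_of_eigen (B := recA q c d a b) (C := recC q c d a b)
    (fun y hy => h.weight_mul_recA hy) ?_ (recC_zero _ _ _ _ _)
    (fun y hy => h.difference hM hi hy) (fun y hy => h.difference hM hj hy) ?_
  · simp [recA, h.c_last]
  · intro e
    have e' : (q ^ i)⁻¹ + a * b * q * q ^ i = (q ^ j)⁻¹ + a * b * q * q ^ j := by
      linear_combination e
    rcases lt_or_gt_of_ne hij with hl | hl
    · exact h.inv_add_ne h.ab_pow hl hj e'
    · exact h.inv_add_ne h.ab_pow hl hi e'.symm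

lemma nu_ne (h : Nondegenerate q a b c d M) {i j : ℕ} (hij : i < j) (hj : j ≤ M) :
    nu q c d i ≠ nu q c d j := by
  have := h.inv_add_ne h.cd_pow hij hj
  simp only [nu]
  rw [mul_comm d c, pow_succ', pow_succ', ← mul_assoc, ← mul_assoc]
  exact this

end Nondegenerate

/-! ### Determinantal ensembles on a finite set -/

/-- Andréief's identity for finite sums. -/
lemma sum_det_mul_det {X : Type*} [Fintype X] [DecidableEq X] (n : ℕ) (f g : Fin n → X → ℝ)
    (h : X → ℝ) :
    ∑ y : Fin n → X, (Matrix.of fun i j => f i (y j)).det * (Matrix.of fun i j => g i (y j)).det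
        * ∏ i, h (y i)
      = n.factorial * (Matrix.of fun i j => ∑ x, f i x * g j x * h x).det := by
  set G : Matrix (Fin n) (Fin n) ℝ := Matrix.of fun i j => ∑ x, f i x * g j x * h x with hG
  have h1 : ∀ σ τ : Equiv.Perm (Fin n), ∑ y : Fin n → X,
      (∏ i, f (σ i) (y i)) * (∏ i, g (τ i) (y i)) * ∏ i, h (y i) = ∏ i, G (σ i) (τ i) := by
    intro σ τ
    simp only [hG, Matrix.of_apply]
    rw [Finset.prod_univ_sum, Fintype.piFinset_univ]
    simp only [Finset.prod_mul_distrib]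
  -- For fixed `σ` the sum over `τ` is the determinant of a row permutation of `G`. The two signs of
  -- `σ` then multiply to one, leaving `n!` equal terms.
  have h2 : ∀ σ : Equiv.Perm (Fin n), ∑ τ : Equiv.Perm (Fin n),
      ((Equiv.Perm.sign τ : ℤ) : ℝ) * ∏ i, G (σ i) (τ i) = ((Equiv.Perm.sign σ : ℤ) : ℝ) * G.det := by
    intro σ
    rw [← Matrix.det_permute, ← Matrix.det_transpose, Matrix.det_apply']
    simp [Matrix.transpose_apply, Matrix.submatrix_apply]
  simp only [Matrix.det_apply' (Matrix.of fun i j => f i _),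
    Matrix.det_apply' (Matrix.of fun i j => g i _), Matrix.of_apply]
  calc _ = ∑ σ : Equiv.Perm (Fin n), ∑ τ : Equiv.Perm (Fin n),
        ((Equiv.Perm.sign σ : ℤ) : ℝ) * (((Equiv.Perm.sign τ : ℤ) : ℝ) * ∑ y : Fin n → X,
        (∏ i, f (σ i) (y i)) * (∏ i, g (τ i) (y i)) * ∏ i, h (y i)) := by
        simp only [Finset.sum_mul, Finset.mul_sum]
        conv_rhs => rw [Finset.sum_comm]
        rw [Finset.sum_comm]
        refine Finset.sum_congr rfl fun σ _ => ?_
        rw [Finset.sum_comm]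
        refine Finset.sum_congr rfl fun τ _ => Finset.sum_congr rfl fun y _ => by ring
    _ = ∑ σ : Equiv.Perm (Fin n), G.det := by
        refine Finset.sum_congr rfl fun σ _ => ?_
        simp only [h1, ← Finset.mul_sum]
        rw [h2, ← mul_assoc, ← Int.cast_mul, ← Units.val_mul, Int.units_mul_self]
        simp
    _ = _ := by
        rw [Finset.sum_const, Finset.card_univ, Fintype.card_perm, Fintype.card_fin, nsmul_eq_mul]

/-- Each eigenvalue satisfies `λ ≤ exp(λ - 1)`. The bound is sharp to first order at the identity,
which is where the Gram matrices are for small `t`. -/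
lemma det_le_exp_trace_sub {n : ℕ} {A : Matrix (Fin n) (Fin n) ℝ} (hA : A.PosSemidef) :
    A.det ≤ Real.exp (A.trace - n) := by
  have h1 := hA.1.det_eq_prod_eigenvalues
  have h2 := hA.1.trace_eq_sum_eigenvalues
  simp only [RCLike.ofReal_real_eq_id, id] at h1 h2
  rw [h1, h2]
  calc ∏ i, hA.1.eigenvalues i ≤ ∏ i, Real.exp (hA.1.eigenvalues i - 1) :=
        Finset.prod_le_prod (fun i _ => hA.eigenvalues_nonneg i) fun i _ => by
          have := Real.add_one_le_exp (hA.1.eigenvalues i - 1)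
          linarith
    _ = _ := by
        rw [← Real.exp_sum]; simp

lemma posSemidef_gram {X : Type*} [Fintype X] {n : ℕ} (f : Fin n → X → ℝ) {h : X → ℝ}
    (hh : ∀ x, 0 ≤ h x) :
    (Matrix.of fun i j => ∑ x, f i x * f j x * h x : Matrix (Fin n) (Fin n) ℝ).PosSemidef := by
  set B : Matrix X (Fin n) ℝ := Matrix.of fun x i => Real.sqrt (h x) * f i x with hB
  have : (Matrix.of fun i j => ∑ x, f i x * f j x * h x : Matrix (Fin n) (Fin n) ℝ)
      = B.conjTranspose * B := by
    ext i j
    simp only [Matrix.mul_apply, Matrix.conjTranspose_apply, hB, Matrix.of_apply, star_trivial]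
    refine Finset.sum_congr rfl fun x _ => ?_
    have := Real.mul_self_sqrt (hh x)
    linear_combination -(f i x * f j x) * this
  rw [this]
  exact Matrix.posSemidef_conjTranspose_mul_self B

lemma exp_le_one_add_add_sq {s : ℝ} (hs : |s| ≤ 1) : Real.exp s ≤ 1 + s + s ^ 2 := by
  have := Real.abs_exp_sub_one_sub_id_le hs
  have := (abs_le.1 this).2
  linarith

/-- Bound on the Laplace transform of a linear statistic of the ensemble with density
`det(f_i(y_j))² / n!`. -/
lemma sum_det_sq_mul_exp_le {X : Type*} [Fintype X] [DecidableEq X] {n : ℕ} {f : Fin n → X → ℝ}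
    (hf : ∀ i j, ∑ x, f i x * f j x = if i = j then 1 else 0) {g : X → ℝ} {c t : ℝ}
    (hg : ∀ x, |g x| ≤ c) (ht : 0 ≤ t) (htc : t * c ≤ 1) :
    ∑ y : Fin n → X, (Matrix.of fun i j => f i (y j)).det ^ 2 / n.factorial
        * Real.exp (t * ∑ i, g (y i))
      ≤ Real.exp (t * (∑ i, ∑ x, f i x * f i x * g x) + t ^ 2 * c ^ 2 * n) := by
  have hn : (n.factorial : ℝ) ≠ 0 := by exact_mod_cast n.factorial_ne_zero
  have h1 := sum_det_mul_det n f f (fun x => Real.exp (t * g x))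
  have h2 : ∑ y : Fin n → X, (Matrix.of fun i j => f i (y j)).det ^ 2 / n.factorial
        * Real.exp (t * ∑ i, g (y i))
      = (Matrix.of fun i j => ∑ x, f i x * f j x * Real.exp (t * g x) :
          Matrix (Fin n) (Fin n) ℝ).det := by
    rw [← mul_right_inj' hn, ← h1, Finset.mul_sum]
    refine Finset.sum_congr rfl fun y _ => ?_
    rw [Finset.mul_sum, Real.exp_sum]
    field_simp
  rw [h2]
  refine (det_le_exp_trace_sub (posSemidef_gram f fun x => (Real.exp_pos _).le)).trans ?_
  rw [Real.exp_le_exp]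
  simp only [Matrix.trace, Matrix.diag_apply, Matrix.of_apply]
  have h3 : ∀ i, ∑ x, f i x * f i x * Real.exp (t * g x)
      ≤ 1 + t * (∑ x, f i x * f i x * g x) + t ^ 2 * c ^ 2 := by
    intro i
    have h4 : ∑ x, f i x * f i x = 1 := by simpa using hf i i
    calc ∑ x, f i x * f i x * Real.exp (t * g x)
        ≤ ∑ x, f i x * f i x * (1 + t * g x + t ^ 2 * c ^ 2) := by
          refine Finset.sum_le_sum fun x _ => ?_
          refine mul_le_mul_of_nonneg_left ?_ (mul_self_nonneg _)
          have h5 : |t * g x| ≤ t * c := by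
            rw [abs_mul, abs_of_nonneg ht]
            exact mul_le_mul_of_nonneg_left (hg x) ht
          have h6 := exp_le_one_add_add_sq (h5.trans htc)
          have h7 : (t * g x) ^ 2 ≤ t ^ 2 * c ^ 2 := by
            rw [← mul_pow]; exact sq_le_sq' (by linarith [(abs_le.1 h5).1]) (abs_le.1 h5).2
          linarith
      _ = _ := by
          simp only [mul_add, Finset.sum_add_distrib, mul_one, h4, ← Finset.sum_mul, one_mul,
            Finset.mul_sum]
          congr 2
          exact Finset.sum_congr rfl fun x _ => by ring
  have h5 := Finset.sum_le_sum fun i (_ : i ∈ (Finset.univ : Finset (Fin n))) => h3 i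
  simp only [Finset.sum_add_distrib, Finset.sum_const, Finset.card_univ, Fintype.card_fin,
    nsmul_eq_mul, ← Finset.mul_sum] at h5
  linarith

/-- `Y` has the determinantal law with density `det(f_i(y_j))² / n!`. -/
def HasDetLaw {Ω : Type*} [MeasurableSpace Ω] (P : Measure Ω) {X : Type*} {n : ℕ}
    (f : Fin n → X → ℝ) (Y : Ω → Fin n → X) : Prop :=
  ∀ y : Fin n → X, P.real (Y ⁻¹' {y}) = (Matrix.of fun i j => f i (y j)).det ^ 2 / n.factorial

lemma measureReal_preimage_eq_sum {Ω : Type*} [MeasurableSpace Ω] {P : Measure Ω}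
    [IsProbabilityMeasure P] {Z : Type*} [Fintype Z] [DecidableEq Z] [MeasurableSpace Z]
    [MeasurableSingletonClass Z] {Y : Ω → Z} (hY : Measurable Y) (S : Finset Z) :
    P.real (Y ⁻¹' S) = ∑ z ∈ S, P.real (Y ⁻¹' {z}) := by
  have : Y ⁻¹' (S : Set Z) = ⋃ z ∈ S, Y ⁻¹' {z} := by
    ext ω; simp
  rw [this, measureReal_biUnion_finset]
  · intro a _ b _ hab
    exact Disjoint.preimage Y (by simpa using hab)
  · intro z _
    exact hY (measurableSet_singleton z)

/-- One-sided exponential concentration of linear statistics of determinantal ensembles. -/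
lemma HasDetLaw.measureReal_le {Ω : Type*} [MeasurableSpace Ω] {P : Measure Ω}
    [IsProbabilityMeasure P] {X : Type*} [Fintype X] [DecidableEq X] [MeasurableSpace X]
    [MeasurableSingletonClass X] {n : ℕ} {f : Fin n → X → ℝ} {Y : Ω → Fin n → X}
    (hlaw : HasDetLaw P f Y) (hY : Measurable Y)
    (hf : ∀ i j, ∑ x, f i x * f j x = if i = j then 1 else 0) {g : X → ℝ} {c t e : ℝ}
    (hg : ∀ x, |g x| ≤ c) (ht : 0 ≤ t) (htc : t * c ≤ 1) :
    P.real {ω | (∑ i, ∑ x, f i x * f i x * g x) + e * n ≤ ∑ i, g (Y ω i)}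
      ≤ Real.exp (-(t * (e - t * c ^ 2)) * n) := by
  classical
  set T := ∑ i, ∑ x, f i x * f i x * g x with hT
  set S : Finset (Fin n → X) := Finset.univ.filter fun y => T + e * n ≤ ∑ i, g (y i) with hS
  have h1 : {ω | T + e * n ≤ ∑ i, g (Y ω i)} = Y ⁻¹' (S : Set (Fin n → X)) := by
    ext ω; simp [hS]
  rw [h1, measureReal_preimage_eq_sum hY]
  have h2 := sum_det_sq_mul_exp_le hf hg ht htc (n := n)
  have h3 : (∑ y ∈ S, P.real (Y ⁻¹' {y})) * Real.exp (t * (T + e * n))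
      ≤ Real.exp (t * T + t ^ 2 * c ^ 2 * n) := by
    rw [Finset.sum_mul]
    refine le_trans ?_ h2
    refine le_trans ?_ (Finset.sum_le_sum_of_subset_of_nonneg (Finset.subset_univ S)
      fun y _ _ => by positivity)
    refine Finset.sum_le_sum fun y hy => ?_
    rw [hlaw y]
    refine mul_le_mul_of_nonneg_left ?_ (by positivity)
    rw [Real.exp_le_exp]
    exact mul_le_mul_of_nonneg_left (by simpa [hS] using hy) ht
  rw [← le_div_iff₀ (Real.exp_pos _), ← Real.exp_sub] at h3
  refine h3.trans (le_of_eq ?_)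
  congr 1; ring

/-- Almost sure concentration for a sequence of determinantal ensembles. -/
lemma ae_tendsto_of_hasDetLaw {Ω : Type*} [MeasurableSpace Ω] {P : Measure Ω}
    [IsProbabilityMeasure P] {X : ℕ → Type*} [∀ n, Fintype (X n)] [∀ n, DecidableEq (X n)]
    [∀ n, MeasurableSpace (X n)] [∀ n, MeasurableSingletonClass (X n)]
    {f : (n : ℕ) → Fin n → X n → ℝ} {Y : (n : ℕ) → Ω → Fin n → X n}
    {g : (n : ℕ) → X n → ℝ} {c : ℝ}
    (hlaw : ∀ᶠ n in atTop, HasDetLaw P (f n) (Y n) ∧ Measurable (Y n) ∧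
      (∀ i j, ∑ x, f n i x * f n j x = if i = j then 1 else 0) ∧ ∀ x, |g n x| ≤ c) {L : ℝ}
    (hL : Tendsto (fun n : ℕ => (1 / n : ℝ) * ∑ i, ∑ x, f n i x * f n i x * g n x) atTop (𝓝 L)) :
    ∀ᵐ ω ∂P, Tendsto (fun n : ℕ => (1 / n : ℝ) * ∑ i, g n (Y n ω i)) atTop (𝓝 L) := by
  classical
  set T : ℕ → ℝ := fun n => ∑ i, ∑ x, f n i x * f n i x * g n x with hT
  set S : ℕ → Ω → ℝ := fun n ω => ∑ i, g n (Y n ω i) with hS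
  have main : ∀ e : ℝ, 0 < e → ∀ᵐ ω ∂P, ∀ᶠ n : ℕ in atTop, |S n ω - T n| < e * n := by
    intro e he
    set C : ℝ := |c| + 1 with hC
    have hC1 : 1 ≤ C := by rw [hC]; linarith [abs_nonneg c]
    have hcC : c ≤ C := by rw [hC]; linarith [le_abs_self c]
    -- The first bound gives `t C ≤ 1`, as the quadratic bound on the exponential requires; the
    -- second keeps half of `e` in the exponent, since `t C² ≤ e / 2`.
    set t : ℝ := min (1 / C) (e / (2 * C ^ 2)) with ht
    have ht0 : 0 < t := lt_min (by positivity) (by positivity)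
    have htC : t * C ≤ 1 := by
      have := min_le_left (1 / C) (e / (2 * C ^ 2))
      rwa [← ht, le_div_iff₀ (by positivity)] at this
    have htC2 : t * C ^ 2 ≤ e / 2 := by
      have := min_le_right (1 / C) (e / (2 * C ^ 2))
      rw [← ht, le_div_iff₀ (by positivity)] at this
      linarith
    set r : ℝ := Real.exp (-(t * (e / 2))) with hr
    have hr0 : 0 ≤ r := (Real.exp_pos _).le
    have hr1 : r < 1 := by rw [hr, Real.exp_lt_one_iff]; nlinarith
    have hexp : ∀ n : ℕ, Real.exp (-(t * (e - t * C ^ 2)) * n) ≤ r ^ n := by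
      intro n
      rw [hr, ← Real.exp_nat_mul, Real.exp_le_exp]
      have : t * (e / 2) ≤ t * (e - t * C ^ 2) := mul_le_mul_of_nonneg_left (by linarith) ht0.le
      have hn : (0 : ℝ) ≤ n := n.cast_nonneg
      nlinarith
    obtain ⟨N, hN⟩ := eventually_atTop.1 hlaw
    set A : ℕ → Set Ω := fun n => if N ≤ n then {ω | e * n ≤ |S n ω - T n|} else ∅ with hA
    have hbound : ∀ n, P (A n) ≤ ENNReal.ofReal (2 * r ^ n) := by
      intro n
      by_cases hn : N ≤ n
      · obtain ⟨h1, h2, h3, h4⟩ := hN n hn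
        have hg : ∀ x, |g n x| ≤ C := fun x => (h4 x).trans hcC
        have hg' : ∀ x, |-g n x| ≤ C := fun x => by rw [abs_neg]; exact hg x
        have b1 := (h1.measureReal_le h2 h3 (e := e) hg ht0.le htC).trans (hexp n)
        have b2 := (h1.measureReal_le h2 h3 (e := e) (g := fun x => -g n x) hg' ht0.le htC).trans
          (hexp n)
        have hsub : A n ⊆ {ω | (∑ i, ∑ x, f n i x * f n i x * g n x) + e * n ≤ ∑ i, g n (Y n ω i)}
            ∪ {ω | (∑ i, ∑ x, f n i x * f n i x * -g n x) + e * n ≤ ∑ i, -g n (Y n ω i)} := by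
          intro ω hω
          simp only [hA, hn, if_true, mem_ofPred_eq] at hω
          simp only [mul_neg, Finset.sum_neg_distrib, mem_union, mem_ofPred_eq]
          rcases le_abs.1 hω with h | h
          · left; simp only [hS, hT] at h; linarith
          · right; simp only [hS, hT] at h; linarith
        rw [← ofReal_measureReal]
        refine ENNReal.ofReal_le_ofReal ?_
        have := (measureReal_mono hsub (measure_ne_top P _)).trans (measureReal_union_le _ _)
        linarith
      · simp [hA, hn]
    -- Only the convergent half of Borel–Cantelli is used, so the dependence between different `n`
    -- plays no role.
    have hsum : ∑' n, P (A n) ≠ ⊤ := by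
      refine ne_top_of_le_ne_top ?_ (ENNReal.tsum_le_tsum hbound)
      have : Summable fun n : ℕ => 2 * r ^ n := (summable_geometric_of_lt_one hr0 hr1).mul_left 2
      exact this.tsum_ofReal_ne_top
    filter_upwards [ae_eventually_notMem hsum] with ω hω
    filter_upwards [hω, eventually_ge_atTop N] with n hn hNn
    simpa [hA, hNn] using hn
  have hae : ∀ᵐ ω ∂P, ∀ m : ℕ, ∀ᶠ n : ℕ in atTop, |S n ω - T n| < (1 / ((m : ℝ) + 1)) * n :=
    ae_all_iff.2 fun m => main _ (by positivity)
  filter_upwards [hae] with ω hω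
  have h0 : Tendsto (fun n : ℕ => (1 / n : ℝ) * S n ω - (1 / n : ℝ) * T n) atTop (𝓝 0) := by
    rw [Metric.tendsto_nhds]
    intro e he
    obtain ⟨m, hm⟩ := exists_nat_one_div_lt he
    filter_upwards [hω m, eventually_gt_atTop 0] with n hn hn0
    have hn0' : (0 : ℝ) < n := by exact_mod_cast hn0
    rw [Real.dist_eq, sub_zero, ← mul_sub, abs_mul, abs_of_pos (by positivity : (0 : ℝ) < 1 / n)]
    calc (1 / n : ℝ) * |S n ω - T n| < (1 / n : ℝ) * ((1 / ((m : ℝ) + 1)) * n) := by gcongr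
      _ = 1 / ((m : ℝ) + 1) := by field_simp
      _ < e := hm
  have h1 := h0.add hL
  rw [zero_add] at h1
  refine h1.congr fun n => ?_
  simp only [hS, hT]
  ring

/-! ### Monic orthogonal polynomials and the law of the ensemble -/

/-- The monic polynomials generated by a three-term recurrence. -/
def monicSeq (b s : ℕ → ℝ) : ℕ → Polynomial ℝ
  | 0 => 1
  | 1 => Polynomial.X - Polynomial.C (b 0)
  | j + 2 => (Polynomial.X - Polynomial.C (b (j + 1))) * monicSeq b s (j + 1)
      - Polynomial.C (s j) * monicSeq b s j

lemma monicSeq_monic_natDegree (b s : ℕ → ℝ) (j : ℕ) :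
    (monicSeq b s j).Monic ∧ (monicSeq b s j).natDegree = j := by
  induction j using Nat.twoStepInduction with
  | zero => simp [monicSeq]
  | one => simp [monicSeq, Polynomial.monic_X_sub_C]
  | more j ih1 ih2 =>
    have h1 : ((Polynomial.X - Polynomial.C (b (j + 1))) * monicSeq b s (j + 1)).Monic :=
      (Polynomial.monic_X_sub_C _).mul ih2.1
    have h2 : ((Polynomial.X - Polynomial.C (b (j + 1))) * monicSeq b s (j + 1)).natDegree
        = j + 2 := by
      rw [(Polynomial.monic_X_sub_C _).natDegree_mul ih2.1, ih2.2, Polynomial.natDegree_X_sub_C]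
      omega
    have h3 : (Polynomial.C (s j) * monicSeq b s j).natDegree
        < ((Polynomial.X - Polynomial.C (b (j + 1))) * monicSeq b s (j + 1)).natDegree := by
      refine (Polynomial.natDegree_C_mul_le _ _).trans_lt ?_
      rw [ih1.2, h2]
      omega
    refine ⟨h1.sub_of_left (Polynomial.degree_lt_degree h3), ?_⟩
    rw [monicSeq, Polynomial.natDegree_sub_eq_left_of_natDegree_lt h3, h2]

/-- A real orthonormal system on the nodes `0, …, M`, satisfying a three-term recurrence. -/
structure JacobiSystem (M : ℕ) (x : ℕ → ℝ) (b s : ℕ → ℝ) (f : ℕ → Fin (M + 1) → ℝ) : Prop where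
  orthonormal : ∀ i j, i ≤ M → j ≤ M → ∑ y, f i y * f j y = if i = j then 1 else 0
  recurrence : ∀ j, j + 3 ≤ M → ∀ y : Fin (M + 1), x y * f (j + 1) y
    = Real.sqrt (s (j + 1)) * f (j + 2) y + b (j + 1) * f (j + 1) y + Real.sqrt (s j) * f j y

/-- The functions are `√w p_j / √h_j`, with `h_j` the squared norm of the monic polynomial `p_j`.
The relation `s_j h_j = h_(j+1)` both forces `s_j > 0` and identifies `√s_j` as the off-diagonal
entry. The squared Vandermonde determinant is that of the `p_j`, so the constant is `∏ h_i`. -/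
lemma exists_jacobiSystem {M : ℕ} {w x b s : ℕ → ℝ} (hw : ∀ y ≤ M, 0 < w y)
    (hx : ∀ i j, i < j → j ≤ M → x i ≠ x j)
    (horth : ∀ i j, i ≤ M → j ≤ M → i ≠ j → ∑ y ∈ Finset.range (M + 1),
      w y * ((monicSeq b s i).eval (x y) * (monicSeq b s j).eval (x y)) = 0) :
    ∃ f : ℕ → Fin (M + 1) → ℝ, JacobiSystem M x b s f ∧
      ∀ n, n ≤ M + 1 → ∃ c : ℝ, c ≠ 0 ∧ ∀ y : Fin n → Fin (M + 1),
        (∏ i : Fin n, ∏ j ∈ Finset.Ioi i, (x (y i) - x (y j)) ^ 2) * ∏ i, w (y i)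
          = c * (Matrix.of fun i j : Fin n => f i (y j)).det ^ 2 := by
  set p := monicSeq b s with hp
  set h : ℕ → ℝ := fun j => ∑ y ∈ Finset.range (M + 1), w y * (p j).eval (x y) ^ 2 with hh
  have hpos : ∀ j ≤ M, 0 < h j := by
    intro j hj
    -- A nonzero polynomial of degree `j ≤ M` cannot vanish at `M + 1` distinct nodes.
    have hne : ∃ y ∈ Finset.range (M + 1), (p j).eval (x y) ≠ 0 := by
      by_contra! hcon
      have hinj : Set.InjOn x (Finset.range (M + 1)) := by
        intro u hu v hv huv
        rw [Finset.coe_range, mem_Iio] at hu hv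
        rcases lt_trichotomy u v with hl | hl | hl
        · exact absurd huv (hx u v hl (by omega))
        · exact hl
        · exact absurd huv.symm (hx v u hl (by omega))
      have hcard : ((Finset.range (M + 1)).image x).card = M + 1 := by
        rw [Finset.card_image_of_injOn hinj, Finset.card_range]
      have hd := (monicSeq_monic_natDegree b s j)
      refine hd.1.ne_zero (Polynomial.eq_zero_of_natDegree_lt_card_of_eval_eq_zero' _
        ((Finset.range (M + 1)).image x) ?_ ?_)
      · intro z hz
        obtain ⟨y, hy, rfl⟩ := Finset.mem_image.1 hz
        exact hcon y hy
      · rw [hcard, hd.2]; omega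
    obtain ⟨y, hy, hne⟩ := hne
    refine Finset.sum_pos' (fun z hz => ?_) ⟨y, hy, ?_⟩
    · exact mul_nonneg (hw z (by rw [Finset.mem_range] at hz; omega)).le (sq_nonneg _)
    · exact mul_pos (hw y (by rw [Finset.mem_range] at hy; omega)) (by positivity)
  have hrec : ∀ j y, x y * (p (j + 1)).eval (x y)
      = (p (j + 2)).eval (x y) + b (j + 1) * (p (j + 1)).eval (x y) + s j * (p j).eval (x y) := by
    intro j y
    simp only [hp, monicSeq, Polynomial.eval_sub, Polynomial.eval_mul, Polynomial.eval_X,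
      Polynomial.eval_C]
    ring
  have hsq : ∀ j, ∑ y ∈ Finset.range (M + 1), w y * ((p j).eval (x y) * (p j).eval (x y))
      = h j := fun j => Finset.sum_congr rfl fun y _ => by ring
  have hs : ∀ j, j + 2 ≤ M → s j * h j = h (j + 1) := by
    intro j hj
    -- The pairing of `p_j` with `x p_(j+1)` is evaluated twice, first by expanding `x p_(j+1)` and
    -- then by expanding `x p_j`. The case `j = 0` is separate because `hrec` starts at degree one.
    have e1 : ∑ y ∈ Finset.range (M + 1), w y * ((p j).eval (x y) * (x y * (p (j + 1)).eval (x y)))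
        = s j * h j := by
      have : ∀ y, w y * ((p j).eval (x y) * (x y * (p (j + 1)).eval (x y)))
          = w y * ((p j).eval (x y) * (p (j + 2)).eval (x y))
            + b (j + 1) * (w y * ((p j).eval (x y) * (p (j + 1)).eval (x y)))
            + s j * (w y * ((p j).eval (x y) * (p j).eval (x y))) := by
        intro y; rw [hrec]; ring
      simp only [this, Finset.sum_add_distrib, ← Finset.mul_sum]
      rw [horth j (j + 2) (by omega) (by omega) (by omega),
        horth j (j + 1) (by omega) (by omega) (by omega), hsq]
      ring
    rw [← e1]
    rcases j with _ | j
    · have : ∀ y, w y * ((p 0).eval (x y) * (x y * (p 1).eval (x y)))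
          = w y * ((p 1).eval (x y) * (p 1).eval (x y))
            + b 0 * (w y * ((p 0).eval (x y) * (p 1).eval (x y))) := by
        intro y
        simp [hp, monicSeq]
        ring
      simp only [zero_add, this, Finset.sum_add_distrib, ← Finset.mul_sum]
      rw [horth 0 1 (by omega) (by omega) (by omega), hsq]
      ring
    · have : ∀ y, w y * ((p (j + 1)).eval (x y) * (x y * (p (j + 1 + 1)).eval (x y)))
          = w y * ((p (j + 2)).eval (x y) * (p (j + 2)).eval (x y))
            + b (j + 1) * (w y * ((p (j + 1)).eval (x y) * (p (j + 2)).eval (x y)))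
            + s j * (w y * ((p j).eval (x y) * (p (j + 2)).eval (x y))) := by
        intro y
        linear_combination w y * (p (j + 2)).eval (x y) * hrec j y
      simp only [this, Finset.sum_add_distrib, ← Finset.mul_sum]
      rw [horth (j + 1) (j + 2) (by omega) (by omega) (by omega),
        horth j (j + 2) (by omega) (by omega) (by omega), hsq]
      ring
  have hsqrt : ∀ j, j + 2 ≤ M → Real.sqrt (s j) = Real.sqrt (h (j + 1)) / Real.sqrt (h j) := by
    intro j hj
    rw [← Real.sqrt_div (hpos _ (by omega)).le, ← hs j hj,
      mul_div_cancel_right₀ _ (hpos j (by omega)).ne']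
  refine ⟨fun j y => Real.sqrt (w y) * (p j).eval (x y) / Real.sqrt (h j), ⟨?_, ?_⟩, ?_⟩
  · intro i j hi hj
    have e : ∑ y : Fin (M + 1), Real.sqrt (w y) * (p i).eval (x y) / Real.sqrt (h i)
          * (Real.sqrt (w y) * (p j).eval (x y) / Real.sqrt (h j))
        = (∑ y ∈ Finset.range (M + 1), w y * ((p i).eval (x y) * (p j).eval (x y)))
            / (Real.sqrt (h i) * Real.sqrt (h j)) := by
      rw [Finset.sum_range, Finset.sum_div]
      refine Finset.sum_congr rfl fun y _ => ?_
      have := Real.mul_self_sqrt (hw y (by omega)).le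
      rw [div_mul_div_comm]
      congr 1
      linear_combination ((p i).eval (x y) * (p j).eval (x y)) * this
    rw [e]
    split_ifs with hij
    · subst hij
      rw [hsq, Real.mul_self_sqrt (hpos i hi).le, div_self (hpos i hi).ne']
    · rw [horth i j hi hj hij, zero_div]
  · intro j hj y
    have q0 := (Real.sqrt_pos.2 (hpos j (by omega))).ne'
    have q1 := (Real.sqrt_pos.2 (hpos (j + 1) (by omega))).ne'
    have q2 := (Real.sqrt_pos.2 (hpos (j + 2) (by omega))).ne'
    have e0 : Real.sqrt (h (j + 1)) ^ 2 = h (j + 1) := Real.sq_sqrt (hpos _ (by omega)).le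
    have e1 : Real.sqrt (h j) ^ 2 = h j := Real.sq_sqrt (hpos _ (by omega)).le
    have e2 := hs j (by omega)
    rw [← e0, ← e1] at e2
    have e3 := hrec j y
    rw [hsqrt (j + 1) (by omega), hsqrt j (by omega)]
    have e4 : s j = Real.sqrt (h (j + 1)) ^ 2 / Real.sqrt (h j) ^ 2 := by
      field_simp; exact e2
    rw [e4] at e3
    have e5 : x y * (Real.sqrt (w y) * (p (j + 1)).eval (x y) / Real.sqrt (h (j + 1)))
        = Real.sqrt (w y) / Real.sqrt (h (j + 1)) * (x y * (p (j + 1)).eval (x y)) := by ring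
    rw [e5, e3]
    field_simp
  · intro n hn
    refine ⟨∏ i : Fin n, h i, Finset.prod_ne_zero_iff.2 fun i _ => (hpos i (by omega)).ne', fun y => ?_⟩
    have hvd := Matrix.det_eval_matrixOfPolynomials_eq_det_vandermonde (fun i : Fin n => x (y i))
      (fun j : Fin n => p j) (fun j => (monicSeq_monic_natDegree b s j).2)
      (fun j => (monicSeq_monic_natDegree b s j).1)
    have hdet : (Matrix.of fun i j : Fin n =>
        Real.sqrt (w (y j)) * (p i).eval (x (y j)) / Real.sqrt (h i)).det
        = (∏ i : Fin n, (Real.sqrt (h i))⁻¹) * ((∏ j, Real.sqrt (w (y j)))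
          * (Matrix.of fun i j : Fin n => (p j).eval (x (y i))).det) := by
      rw [← Matrix.det_transpose (Matrix.of fun i j : Fin n => (p j).eval (x (y i))),
        ← Matrix.det_mul_row, ← Matrix.det_mul_column]
      congr 1
      ext i j
      simp [Matrix.transpose_apply]
      ring
    have hV : ∏ i : Fin n, ∏ j ∈ Finset.Ioi i, (x (y i) - x (y j)) ^ 2
        = (Matrix.vandermonde fun i : Fin n => x (y i)).det ^ 2 := by
      rw [Matrix.det_vandermonde, ← Finset.prod_pow]
      refine Finset.prod_congr rfl fun i _ => ?_
      rw [← Finset.prod_pow]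
      exact Finset.prod_congr rfl fun j _ => by ring
    rw [hdet, hV, hvd, mul_pow, mul_pow, ← Finset.prod_pow, ← Finset.prod_pow, ← mul_assoc,
      ← Finset.prod_mul_distrib]
    have e1 : ∏ i : Fin n, h i * (Real.sqrt (h i))⁻¹ ^ 2 = 1 := by
      refine Finset.prod_eq_one fun i _ => ?_
      rw [inv_pow, Real.sq_sqrt (hpos i (by omega)).le, mul_inv_cancel₀ (hpos i (by omega)).ne']
    have e2 : ∏ j : Fin n, Real.sqrt (w (y j)) ^ 2 = ∏ j, w (y j) :=
      Finset.prod_congr rfl fun j _ => Real.sq_sqrt (hw _ (by omega)).le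
    rw [e1, e2]
    ring

/-- The phase `κ` and the constant `C` are common to all configurations, hence cancel in the
normalization. Andréief's identity for an orthonormal family evaluates the total of the squared
determinants as `n!`. -/
lemma hasDetLaw_of_isEnsemble {Ω : Type*} [MeasurableSpace Ω] {P : Measure Ω} {q a b c d κ : ℂ}
    {n M : ℕ} {Y : Ω → Fin n → Fin (M + 1)} (hE : IsEnsemble P q a b c d n M Y) (hκ : κ ≠ 0)
    {x w : ℕ → ℝ} (hnu : ∀ y ≤ M, nu q c d y = κ * x y) (hweight : ∀ y ≤ M, weight q a b c d y = w y)
    {f : Fin n → Fin (M + 1) → ℝ} (hf : ∀ i j, ∑ y, f i y * f j y = if i = j then 1 else 0)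
    {C : ℝ} (hC : C ≠ 0)
    (hdet : ∀ y : Fin n → Fin (M + 1),
        (∏ i : Fin n, ∏ j ∈ Finset.Ioi i, (x (y i) - x (y j)) ^ 2) * ∏ i, w (y i)
          = C * (Matrix.of fun i j : Fin n => f i (y j)).det ^ 2) :
    HasDetLaw P f Y := by
  intro y
  set K : ℂ := (∏ i : Fin n, ∏ _j ∈ Finset.Ioi i, κ ^ 2) * C with hK
  have hK0 : K ≠ 0 := by
    refine mul_ne_zero ?_ (by exact_mod_cast hC)
    exact Finset.prod_ne_zero_iff.2 fun i _ => Finset.prod_ne_zero_iff.2 fun j _ =>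
      pow_ne_zero _ hκ
  have hj : ∀ z, jointWeight q a b c d n M z
      = K * (((Matrix.of fun i j : Fin n => f i (z j)).det ^ 2 : ℝ) : ℂ) := by
    intro z
    rw [hK, mul_assoc, ← Complex.ofReal_mul, ← hdet z, jointWeight, Complex.ofReal_mul, ← mul_assoc]
    congr 1
    · push_cast
      rw [← Finset.prod_mul_distrib]
      refine Finset.prod_congr rfl fun i _ => ?_
      rw [← Finset.prod_mul_distrib]
      refine Finset.prod_congr rfl fun j _ => ?_
      rw [hnu _ (by omega), hnu _ (by omega)]
      ring
    · push_cast
      exact Finset.prod_congr rfl fun i _ => hweight _ (by omega)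
  have hsum : ∑ z : Fin n → Fin (M + 1), (Matrix.of fun i j : Fin n => f i (z j)).det ^ 2
      = n.factorial := by
    have h1 := sum_det_mul_det n f f (fun _ => 1)
    have h2 : (Matrix.of fun i j => ∑ x, f i x * f j x * 1 : Matrix (Fin n) (Fin n) ℝ) = 1 := by
      ext i j
      simp [hf, Matrix.one_apply]
    rw [h2, Matrix.det_one, mul_one] at h1
    rw [← h1]
    exact Finset.sum_congr rfl fun z _ => by simp [sq]
  have h := hE.2 y
  simp only [hj, ← Finset.mul_sum] at h
  rw [← Complex.ofReal_sum, hsum, mul_div_mul_left _ _ hK0, ← Complex.ofReal_div] at h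
  exact_mod_cast h

/-- Multiplication by `∏ A_i` makes the q-Racah polynomial monic in the node `κ x`, and rescaling to
`x` costs `κ^j`. Keeping the product on the right avoids dividing by the `A_i`. -/
lemma Nondegenerate.monicSeq_eval {q a b c d κ : ℂ} {M : ℕ} (h : Nondegenerate q a b c d M)
    {x B s : ℕ → ℝ} (hnu : ∀ y ≤ M, nu q c d y = κ * x y)
    (hB : ∀ j < M, 1 + d * c * q - recA q a b c d j - recC q a b c d j = κ * B j)
    (hs : ∀ j < M, recA q a b c d j * recC q a b c d (j + 1) = κ ^ 2 * s j) {j y : ℕ}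
    (hj : j ≤ M) (hy : y ≤ M) :
    κ ^ j * ((monicSeq B s j).eval (x y) : ℝ)
      = (∏ i ∈ Finset.range j, recA q a b c d i) * racah q a b c d M j y := by
  have hny : (q ^ y)⁻¹ + c * d * q * q ^ y = κ * x y := by
    rw [← hnu y hy, nu, pow_succ']; ring
  induction j using Nat.twoStepInduction with
  | zero => simp [monicSeq, racah_zero_left]
  | one =>
    have h1 := h.recurrence (j := 0) (y := y) (by omega) hy
    have h2 := hB 0 (by omega)
    rw [hny, recC_zero, racah_zero_left] at h1
    rw [recC_zero] at h2
    simp only [monicSeq, Polynomial.eval_sub, Polynomial.eval_X, Polynomial.eval_C,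
      Finset.prod_range_one]
    push_cast
    linear_combination -h1 + h2
  | more j ih1 ih2 =>
    have h1 := h.recurrence (j := j + 1) (y := y) (by omega) hy
    have h2 := hB (j + 1) (by omega)
    have h3 := hs j (by omega)
    rw [hny, Nat.add_sub_cancel] at h1
    have i1 := ih1 (by omega)
    have i2 := ih2 (by omega)
    simp only [monicSeq, Polynomial.eval_sub, Polynomial.eval_X, Polynomial.eval_C,
      Polynomial.eval_mul, Finset.prod_range_succ] at i1 i2 ⊢
    push_cast at i1 i2 ⊢
    linear_combination (κ * (x y - B (j + 1))) * i2 - κ ^ 2 * s j * i1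
      - (∏ i ∈ Finset.range j, recA q a b c d i) * recA q a b c d j * h1
      + (∏ i ∈ Finset.range j, recA q a b c d i) * recA q a b c d j
          * racah q a b c d M (j + 1) y * h2
      + (∏ i ∈ Finset.range j, recA q a b c d i) * racah q a b c d M j y * h3

/-- The orthonormal system behind the q-Racah ensemble with real (up to a phase) data. -/
lemma Nondegenerate.exists_jacobiSystem {q a b c d κ : ℂ} {M : ℕ} (h : Nondegenerate q a b c d M)
    (hM : M ≠ 0) (hκ : κ ≠ 0) {x B s w : ℕ → ℝ} (hnu : ∀ y ≤ M, nu q c d y = κ * x y)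
    (hB : ∀ j < M, 1 + d * c * q - recA q a b c d j - recC q a b c d j = κ * B j)
    (hs : ∀ j < M, recA q a b c d j * recC q a b c d (j + 1) = κ ^ 2 * s j)
    (hw : ∀ y ≤ M, 0 < w y) (hweight : ∀ y ≤ M, weight q a b c d y = w y) :
    ∃ f : ℕ → Fin (M + 1) → ℝ, JacobiSystem M x B s f ∧
      ∀ {Ω : Type*} [MeasurableSpace Ω] (P : Measure Ω) (n : ℕ), n ≤ M →
        ∀ Y : Ω → Fin n → Fin (M + 1), IsEnsemble P q a b c d n M Y →
          HasDetLaw P (fun i : Fin n => f i) Y := by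
  have hx : ∀ i j, i < j → j ≤ M → x i ≠ x j := by
    intro i j hij hj e
    apply h.nu_ne hij hj
    rw [hnu i (by omega), hnu j hj, e]
  obtain ⟨f, hf1, hf2⟩ := QRacah.exists_jacobiSystem (b := B) (s := s) hw hx (by
    intro i j hi hj hij
    have h1 := h.orthogonal hM hi hj hij
    have h2 : κ ^ i * κ ^ j * ((∑ y ∈ Finset.range (M + 1), w y *
        ((monicSeq B s i).eval (x y) * (monicSeq B s j).eval (x y)) : ℝ) : ℂ) = 0 := by
      have e : ∀ y ∈ Finset.range (M + 1), κ ^ i * κ ^ j * ((w y : ℂ) *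
          (((monicSeq B s i).eval (x y) : ℝ) * ((monicSeq B s j).eval (x y) : ℝ)))
          = (∏ k ∈ Finset.range i, recA q a b c d k) * (∏ k ∈ Finset.range j, recA q a b c d k)
            * (weight q a b c d y * (racah q a b c d M i y * racah q a b c d M j y)) := by
        intro y hy
        have hy' : y ≤ M := by rw [Finset.mem_range] at hy; omega
        have e1 := h.monicSeq_eval hnu hB hs hi hy'
        have e2 := h.monicSeq_eval hnu hB hs hj hy'
        rw [hweight y hy']
        linear_combination (w y : ℂ) * (κ ^ j * ((monicSeq B s j).eval (x y) : ℝ)) * e1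
          + (w y : ℂ) * (∏ k ∈ Finset.range i, recA q a b c d k) * racah q a b c d M i y * e2
      push_cast
      rw [Finset.mul_sum, Finset.sum_congr rfl e, ← Finset.mul_sum, h1, mul_zero]
    have h3 := (mul_eq_zero.1 h2).resolve_left
      (mul_ne_zero (pow_ne_zero _ hκ) (pow_ne_zero _ hκ))
    exact_mod_cast h3)
  refine ⟨f, hf1, fun P n hn Y hE => ?_⟩
  obtain ⟨C, hC, hdet⟩ := hf2 n (by omega)
  refine hasDetLaw_of_isEnsemble hE hκ hnu hweight (fun i j => ?_) hC hdet
  rw [hf1.orthonormal i j (by omega) (by omega)]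
  simp [Fin.ext_iff]

/-! ### Asymptotics of moments -/

/-- The Fourier coefficients of `(B + 2 A cos t)^m`. -/
def cosMoment (m : ℕ) (d : ℤ) (A B : ℝ) : ℝ :=
  1 / Real.pi * ∫ t in (0 : ℝ)..Real.pi, (B + 2 * A * Real.cos t) ^ m * Real.cos (d * t)

lemma cosMoment_zero (d : ℤ) (A B : ℝ) : cosMoment 0 d A B = if d = 0 then 1 else 0 := by
  simp only [cosMoment, pow_zero, one_mul]
  split_ifs with h
  · simp [h, Real.pi_ne_zero]
  · have hd : (d : ℝ) ≠ 0 := by exact_mod_cast h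
    rw [intervalIntegral.integral_comp_mul_left (fun t => Real.cos t) hd]
    simp [Real.sin_int_mul_pi]

/-- From `2 cos t cos(dt) = cos((d+1)t) + cos((d-1)t)`: the recursion for entries of powers of the
Toeplitz Jacobi matrix with diagonal `B` and off-diagonal `A`. -/
lemma cosMoment_succ (m : ℕ) (d : ℤ) (A B : ℝ) :
    cosMoment (m + 1) d A B
      = A * cosMoment m (d + 1) A B + B * cosMoment m d A B + A * cosMoment m (d - 1) A B := by
  have hi : ∀ e : ℤ, IntervalIntegrable
      (fun t => (B + 2 * A * Real.cos t) ^ m * Real.cos (e * t)) volume 0 Real.pi := fun e =>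
    Continuous.intervalIntegrable (by fun_prop) _ _
  have h : ∀ t : ℝ, (B + 2 * A * Real.cos t) ^ (m + 1) * Real.cos (d * t)
      = A * ((B + 2 * A * Real.cos t) ^ m * Real.cos ((d + 1 : ℤ) * t))
        + B * ((B + 2 * A * Real.cos t) ^ m * Real.cos (d * t))
        + A * ((B + 2 * A * Real.cos t) ^ m * Real.cos ((d - 1 : ℤ) * t)) := by
    intro t
    push_cast
    rw [add_mul, sub_mul, one_mul, Real.cos_add, Real.cos_sub]
    ring
  simp only [cosMoment, h]
  rw [intervalIntegral.integral_add (((hi _).const_mul _).add ((hi _).const_mul _))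
    ((hi _).const_mul _), intervalIntegral.integral_add ((hi _).const_mul _) ((hi _).const_mul _)]
  simp only [intervalIntegral.integral_const_mul]
  ring

lemma tendsto_div_of_eventually_eq_add {i k : ℕ → ℕ} {d : ℤ} {ξ : ℝ}
    (hik : ∀ᶠ n in atTop, (k n : ℤ) = i n + d)
    (hi : Tendsto (fun n : ℕ => (i n : ℝ) / n) atTop (𝓝 ξ)) :
    Tendsto (fun n : ℕ => (k n : ℝ) / n) atTop (𝓝 ξ) := by
  have h0 : Tendsto (fun n : ℕ => (d : ℝ) / n) atTop (𝓝 0) :=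
    tendsto_const_div_atTop_nhds_zero_nat _
  have h1 := hi.add h0
  rw [add_zero] at h1
  refine h1.congr' ?_
  filter_upwards [hik] with n hn
  rw [← add_div]
  congr 1
  exact_mod_cast hn.symm

lemma eventually_le_of_tendsto_div {i : ℕ → ℕ} {ξ : ℝ} (hξ : ξ < 1) (r : ℕ)
    (hi : Tendsto (fun n : ℕ => (i n : ℝ) / n) atTop (𝓝 ξ)) : ∀ᶠ n in atTop, i n + r ≤ n := by
  have h := tendsto_div_of_eventually_eq_add (d := r) (k := fun n => i n + r)
    (Eventually.of_forall fun n => by push_cast; rfl) hi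
  filter_upwards [h.eventually_lt_const hξ, eventually_gt_atTop 0] with n hn h0
  rw [div_lt_one (by exact_mod_cast h0)] at hn
  exact_mod_cast hn.le

lemma eventually_ge_of_tendsto_div {i : ℕ → ℕ} {ξ : ℝ} (hξ : 0 < ξ) (r : ℕ)
    (hi : Tendsto (fun n : ℕ => (i n : ℝ) / n) atTop (𝓝 ξ)) : ∀ᶠ n in atTop, r ≤ i n := by
  have h0 : Tendsto (fun n : ℕ => (r : ℝ) / n) atTop (𝓝 0) :=
    tendsto_const_div_atTop_nhds_zero_nat _
  filter_upwards [h0.eventually_lt hi hξ, eventually_gt_atTop 0] with n hn hn0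
  rw [div_lt_div_iff_of_pos_right (by exact_mod_cast hn0)] at hn
  exact_mod_cast hn.le

/-- A sequence of orthonormal systems whose recurrence coefficients have a scaling limit. -/
structure ScaledJacobi (M : ℕ → ℕ) (x b s : ℕ → ℕ → ℝ) (f : (n : ℕ) → ℕ → Fin (M n + 1) → ℝ)
    (A B : ℝ → ℝ) : Prop where
  system : ∀ᶠ n in atTop, JacobiSystem (M n) (x n) (b n) (s n) (f n)
  le_M : ∀ᶠ n : ℕ in atTop, n ≤ M n
  limA : ∀ ξ ∈ Ioo (0 : ℝ) 1, ∀ i : ℕ → ℕ, Tendsto (fun n : ℕ => (i n : ℝ) / n) atTop (𝓝 ξ) →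
    Tendsto (fun n => Real.sqrt (s n (i n))) atTop (𝓝 (A ξ))
  limB : ∀ ξ ∈ Ioo (0 : ℝ) 1, ∀ i : ℕ → ℕ, Tendsto (fun n : ℕ => (i n : ℝ) / n) atTop (𝓝 ξ) →
    Tendsto (fun n => b n (i n)) atTop (𝓝 (B ξ))

namespace ScaledJacobi

variable {M : ℕ → ℕ} {x b s : ℕ → ℕ → ℝ} {f : (n : ℕ) → ℕ → Fin (M n + 1) → ℝ} {A B : ℝ → ℝ}

/-- Multiplication by the node moves `k` by at most one and leaves the limit of `k/n` unchanged, so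
in the limit each step sees the constants `A ξ`, `B ξ`. Induction on `m`, for all offsets `d` at
once, reproduces the recursion of `cosMoment`. -/
lemma tendsto_entry (h : ScaledJacobi M x b s f A B) {ξ : ℝ} (hξ : ξ ∈ Ioo (0 : ℝ) 1) (m : ℕ) :
    ∀ (d : ℤ) (i k : ℕ → ℕ), (∀ᶠ n in atTop, (k n : ℤ) = i n + d) →
      Tendsto (fun n : ℕ => (i n : ℝ) / n) atTop (𝓝 ξ) →
      Tendsto (fun n => ∑ y, f n (i n) y * f n (k n) y * x n y ^ m) atTop
        (𝓝 (cosMoment m d (A ξ) (B ξ))) := by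
  induction m with
  | zero =>
    intro d i k hik hi
    have hk := tendsto_div_of_eventually_eq_add hik hi
    rw [cosMoment_zero]
    refine Tendsto.congr' ?_ tendsto_const_nhds
    filter_upwards [h.system, h.le_M, hik, eventually_le_of_tendsto_div hξ.2 0 hi,
      eventually_le_of_tendsto_div hξ.2 0 hk] with n h1 h2 h3 h4 h5
    simp only [pow_zero, mul_one]
    rw [h1.orthonormal _ _ (by omega) (by omega)]
    refine if_congr ?_ rfl rfl
    omega
  | succ m ih =>
    intro d i k hik hi
    have hk := tendsto_div_of_eventually_eq_add hik hi
    -- Because `ξ` is interior, eventually `1 ≤ k` and `k + 2 ≤ n ≤ M n`, the range in which the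
    -- recurrence of a `JacobiSystem` is available.
    have hk1 : ∀ᶠ n in atTop, 1 ≤ k n := eventually_ge_of_tendsto_div hξ.1 1 hk
    have hpred : Tendsto (fun n : ℕ => ((k n - 1 : ℕ) : ℝ) / n) atTop (𝓝 ξ) :=
      tendsto_div_of_eventually_eq_add (d := -1)
        (by filter_upwards [hk1] with n hn; omega) hk
    have e1 := ih (d + 1) i (fun n => k n + 1)
      (by filter_upwards [hik] with n hn; push_cast; omega) hi
    have e2 := ih d i k hik hi
    have e3 := ih (d - 1) i (fun n => k n - 1)
      (by filter_upwards [hik, hk1] with n hn hn1; omega) hi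
    have key := (((h.limA ξ hξ k hk).mul e1).add ((h.limB ξ hξ k hk).mul e2)).add
      ((h.limA ξ hξ _ hpred).mul e3)
    rw [cosMoment_succ]
    refine key.congr' ?_
    filter_upwards [h.system, h.le_M, hk1, eventually_le_of_tendsto_div hξ.2 2 hk]
      with n h1 h2 h3 h4
    obtain ⟨j, hj⟩ : ∃ j, k n = j + 1 := ⟨k n - 1, by omega⟩
    rw [hj, Nat.add_sub_cancel, Finset.mul_sum, Finset.mul_sum, Finset.mul_sum,
      ← Finset.sum_add_distrib, ← Finset.sum_add_distrib]
    refine Finset.sum_congr rfl fun y _ => ?_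
    have := h1.recurrence j (by omega) y
    rw [pow_succ]
    linear_combination -(f n (i n) y * x n y ^ m) * this

end ScaledJacobi

/-- Rewriting the average as the integral of a step function lets dominated convergence apply with
only pointwise limits along `j/n → ξ`. -/
lemma integral_comp_floor (n : ℕ) (hn : n ≠ 0) (g : ℕ → ℝ) :
    ∫ ξ in (0 : ℝ)..1, g ⌊n * ξ⌋₊ = (1 / n : ℝ) * ∑ j ∈ Finset.range n, g j := by
  have hn0 : (0 : ℝ) < n := by exact_mod_cast Nat.pos_of_ne_zero hn
  have hle : ∀ j : ℕ, (j : ℝ) / n ≤ ((j + 1 : ℕ) : ℝ) / n := fun j => by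
    gcongr; exact_mod_cast j.le_succ
  have hpiece : ∀ j : ℕ, ∀ ξ ∈ Ioo ((j : ℝ) / n) (((j + 1 : ℕ) : ℝ) / n), g ⌊n * ξ⌋₊ = g j := by
    intro j ξ hξ
    congr 1
    rw [Nat.floor_eq_iff (mul_nonneg hn0.le ((by positivity : (0 : ℝ) ≤ (j : ℝ) / n).trans hξ.1.le))]
    have h1 := (div_lt_iff₀ hn0).1 hξ.1
    have h2 := (lt_div_iff₀ hn0).1 hξ.2
    push_cast at h2
    constructor <;> linarith
  have hint : ∀ j < n, IntervalIntegrable (fun ξ : ℝ => g ⌊n * ξ⌋₊) volume ((j : ℝ) / n)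
      (((j + 1 : ℕ) : ℝ) / n) := by
    intro j _
    rw [intervalIntegrable_iff_integrableOn_Ioo_of_le (hle j)]
    exact (integrableOn_congr_fun (fun ξ hξ => hpiece j ξ hξ) measurableSet_Ioo).2
      (integrableOn_const (by simp))
  have h := intervalIntegral.sum_integral_adjacent_intervals hint
  have h0 : ((0 : ℕ) : ℝ) / n = 0 := by simp
  have h1 : ((n : ℕ) : ℝ) / n = 1 := div_self hn0.ne'
  rw [h0, h1] at h
  rw [← h, Finset.mul_sum]
  refine Finset.sum_congr rfl fun j _ => ?_
  rw [intervalIntegral.integral_of_le (hle j), integral_Ioc_eq_integral_Ioo,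
    setIntegral_congr_fun measurableSet_Ioo (fun ξ hξ => hpiece j ξ hξ)]
  simp only [integral_const, smul_eq_mul]
  rw [measureReal_restrict_apply MeasurableSet.univ, univ_inter, Real.volume_real_Ioo_of_le (hle j)]
  push_cast
  ring

lemma tendsto_floor_div (ξ : ℝ) (hξ : 0 ≤ ξ) :
    Tendsto (fun n : ℕ => ((⌊(n : ℝ) * ξ⌋₊ : ℕ) : ℝ) / n) atTop (𝓝 ξ) := by
  have := (tendsto_nat_floor_mul_div_atTop hξ).comp (tendsto_natCast_atTop_atTop (R := ℝ))
  refine this.congr fun n => ?_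
  simp [mul_comm]

/-- The limit of the normalized traces of powers of the truncated Jacobi matrices. -/
lemma ScaledJacobi.tendsto_trace {M : ℕ → ℕ} {x b s : ℕ → ℕ → ℝ}
    {f : (n : ℕ) → ℕ → Fin (M n + 1) → ℝ} {A B : ℝ → ℝ} (h : ScaledJacobi M x b s f A B)
    {r : ℝ} (hx : ∀ᶠ n in atTop, ∀ y ≤ M n, |x n y| ≤ r) (m : ℕ) :
    Tendsto (fun n : ℕ => (1 / n : ℝ) * ∑ i : Fin n, ∑ y, f n i y * f n i y * x n y ^ m) atTop
      (𝓝 (∫ ξ in (0 : ℝ)..1, cosMoment m 0 (A ξ) (B ξ))) := by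
  have h1 : Tendsto (fun n : ℕ => ∫ ξ in Ioo (0 : ℝ) 1,
      ∑ y, f n ⌊n * ξ⌋₊ y * f n ⌊n * ξ⌋₊ y * x n y ^ m) atTop
      (𝓝 (∫ ξ in Ioo (0 : ℝ) 1, cosMoment m 0 (A ξ) (B ξ))) := by
    refine tendsto_integral_filter_of_dominated_convergence (fun _ => r ^ m) ?_ ?_ ?_ ?_
    · refine Eventually.of_forall fun n => Measurable.aestronglyMeasurable ?_
      exact (measurable_from_nat (f := fun j => ∑ y, f n j y * f n j y * x n y ^ m)).comp
        (Nat.measurable_floor.comp (measurable_const.mul measurable_id))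
    · filter_upwards [h.system, h.le_M, hx, eventually_gt_atTop 0] with n hs hM hxn hn0
      filter_upwards [ae_restrict_mem measurableSet_Ioo] with ξ hξ
      have hn0' : (0 : ℝ) < n := by exact_mod_cast hn0
      have hfl : ⌊n * ξ⌋₊ ≤ M n := by
        refine le_trans ?_ hM
        refine Nat.floor_le_of_le ?_
        nlinarith [hξ.2]
      -- The squares of an orthonormal function are probability weights on the nodes, so the `m`-th
      -- moment is at most `r^m`.
      have ho := hs.orthonormal _ _ hfl hfl
      simp only [if_true] at ho
      rw [Real.norm_eq_abs]
      calc |∑ y, f n ⌊n * ξ⌋₊ y * f n ⌊n * ξ⌋₊ y * x n y ^ m|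
          ≤ ∑ y, |f n ⌊n * ξ⌋₊ y * f n ⌊n * ξ⌋₊ y * x n y ^ m| := Finset.abs_sum_le_sum_abs _ _
        _ ≤ ∑ y, f n ⌊n * ξ⌋₊ y * f n ⌊n * ξ⌋₊ y * r ^ m := by
            refine Finset.sum_le_sum fun y _ => ?_
            rw [abs_mul, abs_mul_self, abs_pow]
            exact mul_le_mul_of_nonneg_left
              (pow_le_pow_left₀ (abs_nonneg _) (hxn y (by omega)) _) (mul_self_nonneg _)
        _ = r ^ m := by rw [← Finset.sum_mul, ho, one_mul]
    · exact integrable_const _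
    · filter_upwards [ae_restrict_mem measurableSet_Ioo] with ξ hξ
      exact h.tendsto_entry hξ m 0 _ _ (Eventually.of_forall fun n => by simp)
        (tendsto_floor_div ξ hξ.1.le)
  rw [intervalIntegral.integral_of_le zero_le_one, integral_Ioc_eq_integral_Ioo]
  refine h1.congr' ?_
  filter_upwards [eventually_gt_atTop 0] with n hn0
  rw [← integral_Ioc_eq_integral_Ioo, ← intervalIntegral.integral_of_le zero_le_one,
    integral_comp_floor n hn0.ne' (fun j => ∑ y, f n j y * f n j y * x n y ^ m),
    Finset.sum_range]

/-! ### Trigonometric form of the parameters -/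

namespace Params

variable (p : Params)

/-- `e^(i gq t / 2)`. -/
def hpow (t : ℝ) : ℂ := Complex.exp (Complex.I * ((p.gq * t / 2 : ℝ) : ℂ))

/-- `sin (gq t / 2)`. -/
def sn (t : ℝ) : ℝ := Real.sin (p.gq * t / 2)

/-- `2 cos (gq t / 2)`. -/
def cs (t : ℝ) : ℝ := 2 * Real.cos (p.gq * t / 2)

lemma continuous_sn : Continuous p.sn := by unfold sn; fun_prop

lemma continuous_cs : Continuous p.cs := by unfold cs; fun_prop

lemma sn_neg (t : ℝ) : p.sn (-t) = -p.sn t := by simp [sn, neg_div]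

lemma cs_neg (t : ℝ) : p.cs (-t) = p.cs t := by simp [cs, neg_div]

lemma hpow_ne_zero (t : ℝ) : p.hpow t ≠ 0 := Complex.exp_ne_zero _

lemma qpow_ne_zero (t : ℝ) : p.qpow t ≠ 0 := Complex.exp_ne_zero _

lemma hpow_zero : p.hpow 0 = 1 := by simp [hpow]

lemma hpow_add (s t : ℝ) : p.hpow (s + t) = p.hpow s * p.hpow t := by
  rw [hpow, hpow, hpow, ← Complex.exp_add]; congr 1; push_cast; ring

lemma hpow_sub (s t : ℝ) : p.hpow (s - t) = p.hpow s / p.hpow t := by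
  rw [hpow, hpow, hpow, ← Complex.exp_sub]; congr 1; push_cast; ring

lemma hpow_two_mul (t : ℝ) : p.hpow (2 * t) = p.qpow t := by
  rw [hpow, qpow]; congr 2; push_cast; ring

lemma qpow_eq_hpow_sq (t : ℝ) : p.qpow t = p.hpow t ^ 2 := by
  rw [← hpow_two_mul, two_mul, hpow_add, sq]

lemma qpow_add (s t : ℝ) : p.qpow (s + t) = p.qpow s * p.qpow t := by
  rw [qpow, qpow, qpow, ← Complex.exp_add]; congr 1; push_cast; ring

lemma qpow_neg (t : ℝ) : p.qpow (-t) = (p.qpow t)⁻¹ := by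
  rw [qpow, qpow, ← Complex.exp_neg]; congr 1; push_cast; ring

lemma qpow_sub (s t : ℝ) : p.qpow (s - t) = p.qpow s / p.qpow t := by
  rw [sub_eq_add_neg, qpow_add, qpow_neg, div_eq_mul_inv]

lemma norm_hpow (t : ℝ) : ‖p.hpow t‖ = 1 := by
  rw [hpow, mul_comm]; exact Complex.norm_exp_ofReal_mul_I _

lemma hpow_eq (t : ℝ) : p.hpow t
    = (Real.cos (p.gq * t / 2) : ℂ) + (Real.sin (p.gq * t / 2) : ℂ) * Complex.I := by
  rw [hpow, mul_comm, Complex.exp_mul_I, ← Complex.ofReal_cos, ← Complex.ofReal_sin]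

lemma one_sub_qpow (t : ℝ) : 1 - p.qpow t = -2 * Complex.I * p.sn t * p.hpow t := by
  have h1 : p.hpow t * p.hpow (-t) = 1 := by rw [← hpow_add, add_neg_cancel, hpow_zero]
  have h2 : p.hpow (-t) - p.hpow t = -2 * Complex.I * p.sn t := by
    rw [hpow_eq, hpow_eq, sn, mul_neg, neg_div, Real.cos_neg, Real.sin_neg]
    push_cast; ring
  rw [qpow_eq_hpow_sq]
  linear_combination p.hpow t * h2 - h1

lemma qpow_add_qpow (s t : ℝ) : p.qpow s + p.qpow t = p.hpow (s + t) * p.cs (s - t) := by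
  have h2 : p.hpow (s - t) + p.hpow (-(s - t)) = p.cs (s - t) := by
    rw [hpow_eq, hpow_eq, cs, mul_neg, neg_div, Real.cos_neg, Real.sin_neg]
    push_cast; ring
  rw [← h2, mul_add, ← hpow_add, ← hpow_add, ← hpow_two_mul, ← hpow_two_mul]
  congr 2 <;> ring

lemma one_add_qpow (t : ℝ) : 1 + p.qpow t = p.hpow t * p.cs t := by
  have h := p.qpow_add_qpow 0 t
  rw [zero_add, zero_sub, cs_neg] at h
  rw [← h]; simp [qpow]

lemma qpow_ne_one {t : ℝ} (h : p.sn t ≠ 0) : p.qpow t ≠ 1 := by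
  intro e
  have h1 := p.one_sub_qpow t
  rw [e, sub_self] at h1
  have : -2 * Complex.I * p.sn t * p.hpow t ≠ 0 :=
    mul_ne_zero (mul_ne_zero (by simp) (by exact_mod_cast h)) (p.hpow_ne_zero t)
  exact this h1.symm

lemma qpow_nsmul (t : ℝ) (i : ℕ) : p.qpow t ^ i = p.qpow (i * t) := by
  rw [qpow, qpow, ← Complex.exp_nat_mul]; congr 1; push_cast; ring

lemma base_pow (n i : ℕ) : p.base n ^ i = p.qpow (i / n) := by
  rw [base, qpow_nsmul]; congr 1; ring

/-- Each `1 - q^t` is `-2i sin(gq t / 2)` times a half-angle phase. The powers of `i` leave a real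
quotient, and the phases add up independently of the sines. -/
lemma ratio_eq (t₁ t₂ t₃ t₄ d₁ d₂ : ℝ) :
    ((1 - p.qpow t₁) * (1 - p.qpow t₂) * (1 - p.qpow t₃) * (1 - p.qpow t₄))
        / ((1 - p.qpow d₁) * (1 - p.qpow d₂))
      = p.hpow (t₁ + t₂ + t₃ + t₄ - d₁ - d₂)
        * ((-4 * (p.sn t₁ * p.sn t₂ * p.sn t₃ * p.sn t₄) / (p.sn d₁ * p.sn d₂) : ℝ) : ℂ) := by
  simp only [one_sub_qpow, hpow_add, hpow_sub]
  have e1 : (-2 * Complex.I * p.sn d₁ * p.hpow d₁ * (-2 * Complex.I * p.sn d₂ * p.hpow d₂))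
      = -4 * (p.hpow d₁ * p.hpow d₂) * (p.sn d₁ * p.sn d₂) := by
    linear_combination (4 * (p.hpow d₁ * p.hpow d₂) * (p.sn d₁ * p.sn d₂)) * Complex.I_sq
  have e2 : -2 * Complex.I * p.sn t₁ * p.hpow t₁ * (-2 * Complex.I * p.sn t₂ * p.hpow t₂)
      * (-2 * Complex.I * p.sn t₃ * p.hpow t₃) * (-2 * Complex.I * p.sn t₄ * p.hpow t₄)
      = 16 * (p.hpow t₁ * p.hpow t₂ * p.hpow t₃ * p.hpow t₄)
        * (p.sn t₁ * p.sn t₂ * p.sn t₃ * p.sn t₄) := by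
    linear_combination (16 * (p.hpow t₁ * p.hpow t₂ * p.hpow t₃ * p.hpow t₄)
        * (p.sn t₁ * p.sn t₂ * p.sn t₃ * p.sn t₄)) * Complex.I_pow_four
  rw [e1, e2]
  have h1 := p.hpow_ne_zero d₁
  have h2 := p.hpow_ne_zero d₂
  push_cast
  have e3 : 16 * (p.hpow t₁ * p.hpow t₂ * p.hpow t₃ * p.hpow t₄)
      / (-4 * (p.hpow d₁ * p.hpow d₂))
      = -4 * (p.hpow t₁ * p.hpow t₂ * p.hpow t₃ * p.hpow t₄ / p.hpow d₁ / p.hpow d₂) := by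
    field_simp
    ring
  rw [mul_div_mul_comm, e3]
  ring

/-- The real form of the recurrence coefficient `A`, at `j/n = ξ`, `1/n = e`, `γ = q^g`. -/
def rA (g e ξ : ℝ) : ℝ :=
  -4 * (p.sn (g + (ξ + e)) * p.sn (p.gα + (ξ + e)) * p.sn (p.gα + p.gβ + (ξ + e))
    * p.sn (p.gδ + p.gβ + (ξ + e)))
    / (p.sn (p.gα + p.gβ + (2 * ξ + e)) * p.sn (p.gα + p.gβ + (2 * ξ + 2 * e)))

/-- The real form of the recurrence coefficient `C`. -/
def rC (g e ξ : ℝ) : ℝ :=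
  -4 * (p.sn ξ * p.sn (p.gβ + ξ) * p.sn (p.gα - p.gδ + ξ) * p.sn (p.gα + p.gβ - g + ξ))
    / (p.sn (p.gα + p.gβ + 2 * ξ) * p.sn (p.gα + p.gβ + (2 * ξ + e)))

/-- The real form of the diagonal recurrence coefficient. -/
def rB (g e ξ : ℝ) : ℝ := p.cs (g + p.gδ + e) - p.rA g e ξ - p.rC g e ξ

/-- The real form of the nodes. -/
def rX (g e x : ℝ) : ℝ := p.cs (g + p.gδ + e + 2 * x)

/-- The half angles sum to `g + gδ + e`, free of `ξ`: this is the phase shared by `A`, `C`, the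
diagonal coefficients and the nodes. Since `e` is a separate variable, the limit is the value at `e
= 0`. -/
lemma rA_eq (g e ξ : ℝ) :
    ((1 - p.qpow g * p.qpow (ξ + e)) * (1 - p.α * p.qpow (ξ + e))
        * (1 - p.α * p.β * p.qpow (ξ + e)) * (1 - p.δ * p.β * p.qpow (ξ + e)))
      / ((1 - p.α * p.β * p.qpow (2 * ξ + e)) * (1 - p.α * p.β * p.qpow (2 * ξ + 2 * e)))
      = p.hpow (g + p.gδ + e) * p.rA g e ξ := by
  simp only [α, β, δ, ← qpow_add]
  rw [ratio_eq, rA]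
  congr 2
  ring

lemma rC_eq (g e ξ : ℝ) :
    (p.qpow e * (1 - p.qpow ξ) * (1 - p.β * p.qpow ξ) * (p.δ - p.α * p.qpow ξ)
        * (p.qpow g - p.α * p.β * p.qpow ξ))
      / ((1 - p.α * p.β * p.qpow (2 * ξ)) * (1 - p.α * p.β * p.qpow (2 * ξ + e)))
      = p.hpow (g + p.gδ + e) * p.rC g e ξ := by
  have e1 : p.δ - p.α * p.qpow ξ = p.qpow p.gδ * (1 - p.qpow (p.gα - p.gδ + ξ)) := by
    rw [mul_sub, ← qpow_add, mul_one, α, δ, ← qpow_add]; congr 2; ring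
  have e2 : p.qpow g - p.α * p.β * p.qpow ξ
      = p.qpow g * (1 - p.qpow (p.gα + p.gβ - g + ξ)) := by
    rw [mul_sub, ← qpow_add, mul_one, α, β, ← qpow_add, ← qpow_add]; congr 2; ring
  rw [e1, e2]
  simp only [α, β, ← qpow_add]
  have key := p.ratio_eq ξ (p.gβ + ξ) (p.gα - p.gδ + ξ) (p.gα + p.gβ - g + ξ)
    (p.gα + p.gβ + 2 * ξ) (p.gα + p.gβ + (2 * ξ + e))
  have e3 : p.hpow (g + p.gδ + e) = p.qpow (e + p.gδ + g)
      * p.hpow (ξ + (p.gβ + ξ) + (p.gα - p.gδ + ξ) + (p.gα + p.gβ - g + ξ)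
        - (p.gα + p.gβ + 2 * ξ) - (p.gα + p.gβ + (2 * ξ + e))) := by
    rw [← hpow_two_mul, ← hpow_add]; congr 1; ring
  rw [rC, e3, mul_assoc (p.qpow (e + p.gδ + g)), ← key, qpow_add p (e + p.gδ) g, qpow_add p e p.gδ]
  ring

lemma recA_base (n j : ℕ) (g : ℝ) :
    recA (p.base n) p.α p.β (p.qpow g) p.δ j
      = p.hpow (g + p.gδ + 1 / n) * p.rA g (1 / n) (j / n) := by
  rw [← rA_eq, recA, base_pow, base_pow, base_pow]
  have e1 : ((j + 1 : ℕ) : ℝ) / n = j / n + 1 / n := by push_cast; ring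
  have e2 : ((2 * j + 1 : ℕ) : ℝ) / n = 2 * (j / n) + 1 / n := by push_cast; ring
  have e3 : ((2 * j + 2 : ℕ) : ℝ) / n = 2 * (j / n) + 2 * (1 / n) := by push_cast; ring
  rw [e1, e2, e3]

lemma recC_base (n j : ℕ) (g : ℝ) :
    recC (p.base n) p.α p.β (p.qpow g) p.δ j
      = p.hpow (g + p.gδ + 1 / n) * p.rC g (1 / n) (j / n) := by
  rw [← rC_eq, recC, base_pow, base_pow, base_pow, base]
  have e2 : ((2 * j + 1 : ℕ) : ℝ) / n = 2 * (j / n) + 1 / n := by push_cast; ring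
  have e3 : ((2 * j : ℕ) : ℝ) / n = 2 * (j / n) := by push_cast; ring
  rw [e2, e3]

lemma rB_base (n j : ℕ) (g : ℝ) :
    1 + p.δ * p.qpow g * p.base n - recA (p.base n) p.α p.β (p.qpow g) p.δ j
        - recC (p.base n) p.α p.β (p.qpow g) p.δ j
      = p.hpow (g + p.gδ + 1 / n) * p.rB g (1 / n) (j / n) := by
  have h := p.one_add_qpow (g + p.gδ + 1 / n)
  rw [recA_base, recC_base, rB, δ, base, ← qpow_add, ← qpow_add, add_comm p.gδ, h]
  push_cast
  ring

lemma nu_base (n y : ℕ) (g : ℝ) :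
    nu (p.base n) (p.qpow g) p.δ y = p.hpow (g + p.gδ + 1 / n) * p.rX g (1 / n) (y / n) := by
  have h := p.qpow_add_qpow (-(y / n)) (g + p.gδ + ((y / n) + 1 / n))
  rw [nu, base_pow, base_pow, δ, ← qpow_neg, ← qpow_add, ← qpow_add]
  have e1 : ((y + 1 : ℕ) : ℝ) / n = y / n + 1 / n := by push_cast; ring
  rw [e1, add_comm p.gδ, h, rX, ← cs_neg]
  congr 2
  · ring
  · congr 2; ring

/-- The ratio of consecutive weights. -/
def rW (g e x : ℝ) : ℝ :=
  (p.sn (p.gα + x) * p.sn (p.gβ + p.gδ + x) * p.sn (g + x) * p.sn (g + p.gδ + x)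
      * p.sn (g + p.gδ + (2 * x + e)))
    / (p.sn x * p.sn (g + p.gδ - p.gα + x) * p.sn (g - p.gβ + x) * p.sn (p.gδ + x)
      * p.sn (g + p.gδ + (2 * x - e)))

/-- Here the half-angle phases of numerator and denominator cancel exactly, the factor `αβq^e`
included, so the weights are real. -/
lemma rW_eq (g e x : ℝ) :
    ((1 - p.α * p.qpow x) * (1 - p.β * p.δ * p.qpow x) * (1 - p.qpow g * p.qpow x)
          * (1 - p.qpow g * p.δ * p.qpow x) * (1 - p.qpow g * p.δ * p.qpow (2 * x + e)))
        / ((1 - p.qpow x) * (1 - p.α⁻¹ * p.qpow g * p.δ * p.qpow x)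
          * (1 - p.β⁻¹ * p.qpow g * p.qpow x)
          * (1 - p.δ * p.qpow x) * (p.α * p.β * p.qpow e)
          * (1 - p.qpow g * p.δ * p.qpow (2 * x - e))) = p.rW g e x := by
  have e1 : p.α⁻¹ * p.qpow g * p.δ * p.qpow x = p.qpow (g + p.gδ - p.gα + x) := by
    rw [α, δ, ← qpow_neg, ← qpow_add, ← qpow_add, ← qpow_add]; congr 1; ring
  have e2 : p.β⁻¹ * p.qpow g * p.qpow x = p.qpow (g - p.gβ + x) := by
    rw [β, ← qpow_neg, ← qpow_add, ← qpow_add]; congr 1; ring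
  rw [e1, e2]
  simp only [α, β, δ, ← qpow_add]
  simp only [one_sub_qpow]
  have hh : p.qpow (p.gα + p.gβ + e) * (p.hpow x * p.hpow (g + p.gδ - p.gα + x)
        * p.hpow (g - p.gβ + x) * p.hpow (p.gδ + x) * p.hpow (g + p.gδ + (2 * x - e)))
      = p.hpow (p.gα + x) * p.hpow (p.gβ + p.gδ + x) * p.hpow (g + x) * p.hpow (g + p.gδ + x)
        * p.hpow (g + p.gδ + (2 * x + e)) := by
    simp only [← hpow_add, ← hpow_two_mul]
    congr 1; ring
  set H := p.hpow (p.gα + x) * p.hpow (p.gβ + p.gδ + x) * p.hpow (g + x) * p.hpow (g + p.gδ + x)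
        * p.hpow (g + p.gδ + (2 * x + e)) with hH
  have hH0 : (-2 * Complex.I) ^ 5 * H ≠ 0 := by
    refine mul_ne_zero (pow_ne_zero _ (by simp)) ?_
    simp only [hH]
    simp [hpow_ne_zero]
  rw [rW]
  push_cast
  conv_rhs => rw [← mul_div_mul_left _ _ hH0]
  congr 1
  · rw [hH]; ring
  · rw [← hh]; ring

lemma weight_base_succ {n M y : ℕ} {g : ℝ}
    (h : Nondegenerate (p.base n) p.α p.β (p.qpow g) p.δ M) (hy : y < M) :
    weight (p.base n) p.α p.β (p.qpow g) p.δ (y + 1)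
      = weight (p.base n) p.α p.β (p.qpow g) p.δ y * p.rW g (1 / n) ((y + 1 : ℕ) / n) := by
  rw [h.weight_succ hy, ← rW_eq]
  simp only [base_pow]
  have e2 : ((2 * y + 1 : ℕ) : ℝ) / n = 2 * (((y + 1 : ℕ) : ℝ) / n) - 1 / n := by push_cast; ring
  have e3 : ((2 * y + 3 : ℕ) : ℝ) / n = 2 * (((y + 1 : ℕ) : ℝ) / n) + 1 / n := by push_cast; ring
  rw [e2, e3, base]

/-- The real form of the weights. -/
def rWeight (g : ℝ) (n y : ℕ) : ℝ :=
  ∏ i ∈ Finset.range y, p.rW g (1 / n) ((i + 1 : ℕ) / n)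

lemma weight_base {n M y : ℕ} {g : ℝ}
    (h : Nondegenerate (p.base n) p.α p.β (p.qpow g) p.δ M) (hy : y ≤ M) :
    weight (p.base n) p.α p.β (p.qpow g) p.δ y = p.rWeight g n y := by
  induction y with
  | zero => simp [h.weight_zero, rWeight]
  | succ y ih =>
    rw [p.weight_base_succ h (by omega), ih (by omega), rWeight, rWeight,
      Finset.prod_range_succ, Complex.ofReal_mul]

/-! ### Signs -/

/-- The length `2 π / gq` of the period of `t ↦ q^t`. -/
def per : ℝ := 2 * Real.pi / p.gq

lemma per_pos (hq : 0 < p.gq) : 0 < p.per := div_pos Real.two_pi_pos hq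

lemma sn_eq_neg_one_zpow_mul (m : ℤ) (t : ℝ) :
    (-1 : ℝ) ^ m * p.sn t = Real.sin (p.gq * t / 2 - m * Real.pi) := by
  rw [Real.sin_sub_int_mul_pi, sn]

lemma gq_mul_per (hq : 0 < p.gq) : p.gq * p.per = 2 * Real.pi := by
  rw [per]; field_simp

lemma sn_sign (hq : 0 < p.gq) {m : ℤ} {t : ℝ} (h1 : p.per * m < t)
    (h2 : t < p.per * (m + 1)) : 0 < (-1 : ℝ) ^ m * p.sn t := by
  rw [sn_eq_neg_one_zpow_mul]
  have h1' := mul_lt_mul_of_pos_left h1 hq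
  have h2' := mul_lt_mul_of_pos_left h2 hq
  rw [← mul_assoc, gq_mul_per p hq] at h1' h2'
  exact Real.sin_pos_of_pos_of_lt_pi (by linarith) (by linarith)

lemma sn_sign_nonneg (hq : 0 < p.gq) {m : ℤ} {t : ℝ} (h1 : p.per * m ≤ t)
    (h2 : t ≤ p.per * (m + 1)) : 0 ≤ (-1 : ℝ) ^ m * p.sn t := by
  rw [sn_eq_neg_one_zpow_mul]
  have h1' := mul_le_mul_of_nonneg_left h1 hq.le
  have h2' := mul_le_mul_of_nonneg_left h2 hq.le
  rw [← mul_assoc, gq_mul_per p hq] at h1' h2'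
  exact Real.sin_nonneg_of_nonneg_of_le_pi (by linarith) (by linarith)

lemma sn_pos (hq : 0 < p.gq) {t : ℝ} (h1 : 0 < t) (h2 : t < p.per) : 0 < p.sn t := by
  have := p.sn_sign hq (m := 0) (t := t) (by simpa using h1) (by simpa using h2)
  simpa using this

lemma sn_nonneg (hq : 0 < p.gq) {t : ℝ} (h1 : 0 ≤ t) (h2 : t ≤ p.per) : 0 ≤ p.sn t := by
  have := p.sn_sign_nonneg hq (m := 0) (t := t) (by simpa using h1) (by simpa using h2)
  simpa using this

end Params

lemma neg_one_zpow_cases (m : ℤ) : (-1 : ℝ) ^ m = 1 ∨ (-1 : ℝ) ^ m = -1 := by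
  rcases Int.even_or_odd m with h | h
  · exact Or.inl h.neg_one_zpow
  · exact Or.inr h.neg_one_zpow

lemma neg_one_zpow_mul_of_odd_sub {l m : ℤ} (h : Odd |l - m|) :
    (-1 : ℝ) ^ l * (-1 : ℝ) ^ m = -1 := by
  rw [← zpow_add₀ (by norm_num)]
  refine Odd.neg_one_zpow ?_
  rw [odd_abs] at h
  have : l + m = l - m + 2 * m := by ring
  rw [this]
  exact h.add_even (even_two_mul m)

/-- The angle restrictions in terms of the period, a closed condition on `g`. -/
structure AngleBounds (p : Params) (j k l m k₂ : ℤ) (g : ℝ) : Prop where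
  lower : -(p.per / 2) ≤ g
  upper : g ≤ -1
  al : p.per * j ≤ p.gα
  ar : p.gα ≤ g + p.per * (j + 1)
  bl : p.per * j ≤ p.gβ
  br : p.gβ ≤ g + p.per * (j + 1)
  abl : p.per * k ≤ p.gα + p.gβ
  abr : p.gα + p.gβ ≤ 2 * g + p.per * (k + 1)
  bdl : p.per * l ≤ p.gβ + p.gδ
  bdr : p.gβ + p.gδ ≤ p.per * (l + 1) + g
  adl : p.per * m ≤ p.gα - p.gδ
  adr : p.gα - p.gδ ≤ p.per * (m + 1) + g
  cdl : p.per * k₂ ≤ g + p.gδ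
  cdr : g + p.gδ ≤ p.per * (k₂ + 1) + 2 * g

lemma Restrictions.angleBounds {p : Params} {j k l m k₂ : ℤ} {g : ℝ}
    (h : Restrictions p j k l m k₂ g) : AngleBounds p j k l m k₂ g := by
  have e : ∀ t : ℝ, p.per * t = 2 * Real.pi * t / p.gq := fun t => by rw [Params.per]; ring
  have e' : p.per / 2 = Real.pi / p.gq := by rw [Params.per]; ring
  refine ⟨by rw [e']; exact h.lower, h.upper, ?_, ?_, ?_, ?_, ?_, ?_, ?_, ?_, ?_, ?_, ?_, ?_⟩ <;>
    rw [e]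
  exacts [ h.alpha_left, h.alpha_right, h.beta_left, h.beta_right,
    h.alpha_beta_left, h.alpha_beta_right, h.beta_delta_left, h.beta_delta_right,
    h.alpha_delta_left, h.alpha_delta_right, h.gamma_delta_left, h.gamma_delta_right]

lemma AngleBounds.of_tendsto {p : Params} {j k l m k₂ : ℤ} {u : ℕ → ℝ} {g : ℝ}
    (h : ∀ᶠ n in atTop, AngleBounds p j k l m k₂ (u n)) (hu : Tendsto u atTop (𝓝 g)) :
    AngleBounds p j k l m k₂ g := by
  have h2 : Tendsto (fun n => 2 * u n) atTop (𝓝 (2 * g)) := hu.const_mul 2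
  constructor
  · exact ge_of_tendsto hu (h.mono fun n hn => hn.lower)
  · exact le_of_tendsto hu (h.mono fun n hn => hn.upper)
  · exact le_of_tendsto' (f := fun _ => p.per * j) (x := atTop (α := ℕ)) tendsto_const_nhds
      fun _ => h.exists.choose_spec.al
  · exact ge_of_tendsto (hu.add_const _) (h.mono fun n hn => hn.ar)
  · exact h.exists.choose_spec.bl
  · exact ge_of_tendsto (hu.add_const _) (h.mono fun n hn => hn.br)
  · exact h.exists.choose_spec.abl
  · exact ge_of_tendsto (h2.add_const _) (h.mono fun n hn => hn.abr)
  · exact h.exists.choose_spec.bdl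
  · exact ge_of_tendsto (hu.const_add _) (h.mono fun n hn => hn.bdr)
  · exact h.exists.choose_spec.adl
  · exact ge_of_tendsto (hu.const_add _) (h.mono fun n hn => hn.adr)
  · exact ge_of_tendsto (hu.add_const _) (h.mono fun n hn => hn.cdl)
  · exact le_of_tendsto_of_tendsto (hu.add_const _) (h2.const_add _) (h.mono fun n hn => hn.cdr)

namespace AngleBounds

variable {p : Params} {j k l m k₂ : ℤ} {g x : ℝ}

/-- Each restriction confines one argument to a single period interval, so the corresponding sine
keeps its sign on the whole range, the sign being the parity of the integer in the restriction. The
same holds for the lemmas that follow. -/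
lemma sn_x (h : AngleBounds p j k l m k₂ g) (hq : 0 < p.gq) (h1 : 0 < x) (h2 : x ≤ -g) :
    0 < p.sn x :=
  p.sn_pos hq h1 (by linarith [h.lower, p.per_pos hq])

lemma sn_a (h : AngleBounds p j k l m k₂ g) (hq : 0 < p.gq) (h1 : 0 < x) (h2 : x < -g) :
    0 < (-1 : ℝ) ^ j * p.sn (p.gα + x) :=
  p.sn_sign hq (by linarith [h.al]) (by linarith [h.ar])

lemma sn_b (h : AngleBounds p j k l m k₂ g) (hq : 0 < p.gq) (h1 : 0 < x) (h2 : x < -g) :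
    0 < (-1 : ℝ) ^ j * p.sn (p.gβ + x) :=
  p.sn_sign hq (by linarith [h.bl]) (by linarith [h.br])

lemma sn_g (h : AngleBounds p j k l m k₂ g) (hq : 0 < p.gq) (h1 : 0 < x) (h2 : x < -g) :
    p.sn (g + x) < 0 := by
  have := p.sn_pos hq (t := -(g + x)) (by linarith) (by linarith [h.lower, p.per_pos hq])
  rw [p.sn_neg] at this
  linarith

lemma sn_ab (h : AngleBounds p j k l m k₂ g) (hq : 0 < p.gq) (h1 : 0 < x) (h2 : x < -(2 * g)) :
    0 < (-1 : ℝ) ^ k * p.sn (p.gα + p.gβ + x) :=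
  p.sn_sign hq (by linarith [h.abl]) (by linarith [h.abr])

lemma sn_bd (h : AngleBounds p j k l m k₂ g) (hq : 0 < p.gq) (h1 : 0 < x) (h2 : x < -g) :
    0 < (-1 : ℝ) ^ l * p.sn (p.gβ + p.gδ + x) :=
  p.sn_sign hq (by linarith [h.bdl]) (by linarith [h.bdr])

lemma sn_ad (h : AngleBounds p j k l m k₂ g) (hq : 0 < p.gq) (h1 : 0 < x) (h2 : x < -g) :
    0 < (-1 : ℝ) ^ m * p.sn (p.gα - p.gδ + x) :=
  p.sn_sign hq (by linarith [h.adl]) (by linarith [h.adr])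

lemma sn_abg (h : AngleBounds p j k l m k₂ g) (hq : 0 < p.gq) (h1 : 0 < x) (h2 : x < -g) :
    0 < (-1 : ℝ) ^ k * p.sn (p.gα + p.gβ - g + x) :=
  p.sn_sign hq (by linarith [h.abl]) (by linarith [h.abr])

lemma sn_gd (h : AngleBounds p j k l m k₂ g) (hq : 0 < p.gq) (h1 : 0 < x) (h2 : x < -(2 * g)) :
    0 < (-1 : ℝ) ^ k₂ * p.sn (g + p.gδ + x) :=
  p.sn_sign hq (by linarith [h.cdl]) (by linarith [h.cdr])

lemma sn_d (h : AngleBounds p j k l m k₂ g) (hq : 0 < p.gq) (h1 : 0 < x) (h2 : x < -g) :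
    0 < (-1 : ℝ) ^ k₂ * p.sn (p.gδ + x) :=
  p.sn_sign hq (by linarith [h.cdl]) (by linarith [h.cdr])

lemma sn_gda (h : AngleBounds p j k l m k₂ g) (hq : 0 < p.gq) (h1 : 0 < x) (h2 : x < -g) :
    (-1 : ℝ) ^ m * p.sn (g + p.gδ - p.gα + x) < 0 := by
  have := p.sn_sign hq (m := m) (t := -(g + p.gδ - p.gα + x)) (by linarith [h.adl])
    (by linarith [h.adr])
  rw [p.sn_neg] at this
  linarith

lemma sn_gb (h : AngleBounds p j k l m k₂ g) (hq : 0 < p.gq) (h1 : 0 < x) (h2 : x < -g) :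
    (-1 : ℝ) ^ j * p.sn (g - p.gβ + x) < 0 := by
  have := p.sn_sign hq (m := j) (t := -(g - p.gβ + x)) (by linarith [h.bl]) (by linarith [h.br])
  rw [p.sn_neg] at this
  linarith

/-- From here the weak inequalities include the endpoints, where some sines may vanish. -/
lemma sn_x' (h : AngleBounds p j k l m k₂ g) (hq : 0 < p.gq) (hx : x ∈ Icc 0 (-g)) :
    0 ≤ p.sn x := by
  have := hx.1; have := hx.2
  exact p.sn_nonneg hq hx.1 (by linarith [h.lower, p.per_pos hq])

lemma sn_a' (h : AngleBounds p j k l m k₂ g) (hq : 0 < p.gq) (hx : x ∈ Icc 0 (-g)) :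
    0 ≤ (-1 : ℝ) ^ j * p.sn (p.gα + x) :=
  p.sn_sign_nonneg hq (by linarith [h.al, hx.1]) (by linarith [h.ar, hx.2])

lemma sn_b' (h : AngleBounds p j k l m k₂ g) (hq : 0 < p.gq) (hx : x ∈ Icc 0 (-g)) :
    0 ≤ (-1 : ℝ) ^ j * p.sn (p.gβ + x) :=
  p.sn_sign_nonneg hq (by linarith [h.bl, hx.1]) (by linarith [h.br, hx.2])

lemma sn_g' (h : AngleBounds p j k l m k₂ g) (hq : 0 < p.gq) (hx : x ∈ Icc 0 (-g)) :
    p.sn (g + x) ≤ 0 := by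
  have := p.sn_nonneg hq (t := -(g + x)) (by linarith [hx.2])
    (by linarith [h.lower, p.per_pos hq, hx.1])
  rw [p.sn_neg] at this
  linarith

lemma sn_ab' (h : AngleBounds p j k l m k₂ g) (hq : 0 < p.gq) (hx : x ∈ Icc 0 (-g)) :
    0 ≤ (-1 : ℝ) ^ k * p.sn (p.gα + p.gβ + x) :=
  p.sn_sign_nonneg hq (by linarith [h.abl, hx.1]) (by linarith [h.abr, hx.1, hx.2])

lemma sn_bd' (h : AngleBounds p j k l m k₂ g) (hq : 0 < p.gq) (hx : x ∈ Icc 0 (-g)) :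
    0 ≤ (-1 : ℝ) ^ l * p.sn (p.gβ + p.gδ + x) :=
  p.sn_sign_nonneg hq (by linarith [h.bdl, hx.1]) (by linarith [h.bdr, hx.2])

lemma sn_ad' (h : AngleBounds p j k l m k₂ g) (hq : 0 < p.gq) (hx : x ∈ Icc 0 (-g)) :
    0 ≤ (-1 : ℝ) ^ m * p.sn (p.gα - p.gδ + x) :=
  p.sn_sign_nonneg hq (by linarith [h.adl, hx.1]) (by linarith [h.adr, hx.2])

lemma sn_abg' (h : AngleBounds p j k l m k₂ g) (hq : 0 < p.gq) (hx : x ∈ Icc 0 (-g)) :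
    0 ≤ (-1 : ℝ) ^ k * p.sn (p.gα + p.gβ - g + x) :=
  p.sn_sign_nonneg hq (by linarith [h.abl, hx.1, hx.2]) (by linarith [h.abr, hx.2])

lemma sn_gd' (h : AngleBounds p j k l m k₂ g) (hq : 0 < p.gq) (hx : x ∈ Icc 0 (-g)) :
    0 ≤ (-1 : ℝ) ^ k₂ * p.sn (g + p.gδ + x) :=
  p.sn_sign_nonneg hq (by linarith [h.cdl, hx.1]) (by linarith [h.cdr, hx.1, hx.2])

lemma sn_d' (h : AngleBounds p j k l m k₂ g) (hq : 0 < p.gq) (hx : x ∈ Icc 0 (-g)) :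
    0 ≤ (-1 : ℝ) ^ k₂ * p.sn (p.gδ + x) :=
  p.sn_sign_nonneg hq (by linarith [h.cdl, hx.1, hx.2]) (by linarith [h.cdr, hx.2])

lemma sn_gda' (h : AngleBounds p j k l m k₂ g) (hq : 0 < p.gq) (hx : x ∈ Icc 0 (-g)) :
    (-1 : ℝ) ^ m * p.sn (g + p.gδ - p.gα + x) ≤ 0 := by
  have := p.sn_sign_nonneg hq (m := m) (t := -(g + p.gδ - p.gα + x)) (by linarith [h.adl, hx.2])
    (by linarith [h.adr, hx.1])
  rw [p.sn_neg] at this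
  linarith

lemma sn_gb' (h : AngleBounds p j k l m k₂ g) (hq : 0 < p.gq) (hx : x ∈ Icc 0 (-g)) :
    (-1 : ℝ) ^ j * p.sn (g - p.gβ + x) ≤ 0 := by
  have := p.sn_sign_nonneg hq (m := j) (t := -(g - p.gβ + x)) (by linarith [h.bl, hx.2])
    (by linarith [h.br, hx.1])
  rw [p.sn_neg] at this
  linarith

lemma rW_pos (h : AngleBounds p j k l m k₂ g) (hq : 0 < p.gq) (hlm : Odd |l - m|) {e : ℝ}
    (he : 0 < e) (h1 : e ≤ x) (h2 : x + e ≤ -g) : 0 < p.rW g e x := by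
  have a1 := h.sn_x hq (x := x) (by linarith) (by linarith)
  have a2 := h.sn_a hq (x := x) (by linarith) (by linarith)
  have a3 := h.sn_bd hq (x := x) (by linarith) (by linarith)
  have a4 := h.sn_g hq (x := x) (by linarith) (by linarith)
  have a5 := h.sn_gd hq (x := x) (by linarith) (by linarith)
  have a6 := h.sn_gd hq (x := 2 * x + e) (by linarith) (by linarith)
  have a7 := h.sn_gda hq (x := x) (by linarith) (by linarith)
  have a8 := h.sn_gb hq (x := x) (by linarith) (by linarith)
  have a9 := h.sn_d hq (x := x) (by linarith) (by linarith)
  have a10 := h.sn_gd hq (x := 2 * x - e) (by linarith) (by linarith)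
  have hs := neg_one_zpow_mul_of_odd_sub hlm
  rw [Params.rW]
  generalize p.sn (p.gα + x) = u2 at *
  generalize p.sn (p.gβ + p.gδ + x) = u3 at *
  generalize p.sn (g + x) = u4 at *
  generalize p.sn (g + p.gδ + x) = u5 at *
  generalize p.sn (g + p.gδ + (2 * x + e)) = u6 at *
  generalize p.sn (g + p.gδ - p.gα + x) = u7 at *
  generalize p.sn (g - p.gβ + x) = u8 at *
  generalize p.sn (p.gδ + x) = u9 at *
  generalize p.sn (g + p.gδ + (2 * x - e)) = u10 at *
  generalize p.sn x = u1 at *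
  have key : ∀ N D c : ℝ, 0 < c * N → 0 < c * D → 0 < N / D := by
    intro N D c hN hD
    rcases lt_or_ge 0 c with hc | hc
    · exact div_pos ((mul_pos_iff_of_pos_left hc).1 hN) ((mul_pos_iff_of_pos_left hc).1 hD)
    · have hN' : N < 0 := by nlinarith
      have hD' : D < 0 := by nlinarith
      exact div_pos_of_neg_of_neg hN' hD'
  -- Numerator and denominator are multiplied by one common sign. The negative factor `sin(gq (g +
  -- x) / 2)` in the numerator is compensated by the odd parity of `l - m`.
  refine key _ _ ((-1 : ℝ) ^ j * (-1 : ℝ) ^ m * (-1 : ℝ) ^ k₂ * (-1 : ℝ) ^ k₂) ?_ ?_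
  · have hm : (-1 : ℝ) ^ m = -(-1 : ℝ) ^ l := by
      rcases neg_one_zpow_cases l with e1 | e1 <;> rw [e1] at hs ⊢ <;> linarith
    rw [hm]
    have : 0 < ((-1 : ℝ) ^ j * u2) * ((-1 : ℝ) ^ l * u3) * (-u4) * ((-1 : ℝ) ^ k₂ * u5)
        * ((-1 : ℝ) ^ k₂ * u6) := by
      have : 0 < -u4 := by linarith
      positivity
    linarith
  · have : 0 < u1 * (-((-1 : ℝ) ^ m * u7)) * (-((-1 : ℝ) ^ j * u8)) * ((-1 : ℝ) ^ k₂ * u9)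
        * ((-1 : ℝ) ^ k₂ * u10) := by
      have b1 : 0 < -((-1 : ℝ) ^ m * u7) := by linarith
      have b2 : 0 < -((-1 : ℝ) ^ j * u8) := by linarith
      exact mul_pos (mul_pos (mul_pos (mul_pos a1 b1) b2) a9) a10
    linarith

/-- Since `-g = (M + 1)/n`, the points `i/n` lie strictly inside `(0, -g)` for `i ≤ M` and inside
`(0, -2g)` for `i ≤ 2M + 1`, where the relevant sines do not vanish. -/
lemma nondegenerate {n M : ℕ} (hn : 0 < n) (h : AngleBounds p j k l m k₂ (gGamma n M))
    (hq : 0 < p.gq) :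
    Nondegenerate (p.base n) p.α p.β (p.qpow (gGamma n M)) p.δ M := by
  have hn' : (0 : ℝ) < n := by exact_mod_cast hn
  have pos : ∀ i : ℕ, 1 ≤ i → (0 : ℝ) < i / n := fun i hi => by
    have : (0 : ℝ) < i := by exact_mod_cast hi
    positivity
  have lt1 : ∀ i : ℕ, i ≤ M → (i : ℝ) / n < -gGamma n M := fun i hi => by
    rw [gGamma, neg_neg]
    gcongr
    exact_mod_cast Nat.lt_succ_of_le hi
  have lt2 : ∀ i : ℕ, i ≤ 2 * M + 1 → (i : ℝ) / n < -(2 * gGamma n M) := fun i hi => by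
    rw [gGamma, mul_neg, neg_neg, ← mul_div_assoc]
    gcongr
    exact_mod_cast (by omega : i < 2 * (M + 1))
  have nz : ∀ {s t : ℝ}, 0 < s * t → t ≠ 0 := fun h => right_ne_zero_of_mul h.ne'
  refine ⟨p.qpow_ne_zero _, p.qpow_ne_zero _, p.qpow_ne_zero _, ?_, ?_, ?_, ?_, ?_, ?_, ?_, ?_,
    ?_, ?_⟩
  · intro i h1 h2
    rw [p.base_pow]
    exact p.qpow_ne_one (h.sn_x hq (pos i h1) (lt1 i h2).le).ne'
  · intro i h1 h2
    rw [p.base_pow, Params.α, ← p.qpow_add]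
    exact p.qpow_ne_one (nz (h.sn_a hq (pos i h1) (lt1 i h2)))
  · intro i h1 h2
    rw [p.base_pow, Params.β, Params.δ, ← p.qpow_add, ← p.qpow_add]
    exact p.qpow_ne_one (nz (h.sn_bd hq (pos i h1) (lt1 i h2)))
  · intro i h1 h2
    rw [p.base_pow, ← p.qpow_add]
    exact p.qpow_ne_one (h.sn_g hq (pos i h1) (lt1 i h2)).ne
  · rw [p.base_pow, ← p.qpow_add, gGamma]
    have : -((M + 1 : ℝ) / n) + ((M + 1 : ℕ) : ℝ) / n = 0 := by push_cast; ring
    rw [this]; simp [Params.qpow]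
  · intro i h1 h2
    rw [p.base_pow, Params.δ, ← p.qpow_add]
    exact p.qpow_ne_one (nz (h.sn_d hq (pos i h1) (lt1 i h2)))
  · intro i h1 h2
    rw [p.base_pow, Params.α, Params.β, ← p.qpow_add, ← p.qpow_add]
    exact p.qpow_ne_one (nz (h.sn_ab hq (pos i h1) (lt2 i h2)))
  · intro i h1 h2
    rw [p.base_pow, Params.δ, ← p.qpow_add, ← p.qpow_add]
    exact p.qpow_ne_one (nz (h.sn_gd hq (pos i h1) (lt2 i h2)))
  · intro i h1 h2 e
    have hne := p.qpow_ne_one (right_ne_zero_of_mul (h.sn_gda hq (pos i h1) (lt1 i h2)).ne)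
    apply hne
    rw [p.base_pow, Params.δ, Params.α, ← p.qpow_add, ← p.qpow_add] at e
    rw [show gGamma n M + p.gδ - p.gα + (i : ℝ) / n
      = gGamma n M + p.gδ + (i : ℝ) / n - p.gα by ring, p.qpow_sub, e,
      div_self (p.qpow_ne_zero _)]
  · intro i h1 h2 e
    have hne := p.qpow_ne_one (right_ne_zero_of_mul (h.sn_gb hq (pos i h1) (lt1 i h2)).ne)
    apply hne
    rw [p.base_pow, Params.β, ← p.qpow_add] at e
    rw [show gGamma n M - p.gβ + (i : ℝ) / n
      = gGamma n M + (i : ℝ) / n - p.gβ by ring, p.qpow_sub, e,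
      div_self (p.qpow_ne_zero _)]

lemma rWeight_pos {n M y : ℕ} (hn : 0 < n) (h : AngleBounds p j k l m k₂ (gGamma n M))
    (hq : 0 < p.gq) (hlm : Odd |l - m|) (hy : y ≤ M) : 0 < p.rWeight (gGamma n M) n y := by
  have hn' : (0 : ℝ) < n := by exact_mod_cast hn
  refine Finset.prod_pos fun i hi => ?_
  have hi' : i + 1 ≤ M := by rw [Finset.mem_range] at hi; omega
  refine h.rW_pos hq hlm (by positivity) ?_ ?_
  · gcongr; push_cast; linarith [(i.cast_nonneg : (0 : ℝ) ≤ i)]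
  · rw [gGamma, neg_neg, ← add_div]
    gcongr

/-- The orthonormal system of the ensemble of size `n`. -/
lemma exists_jacobiSystem {n M : ℕ} (hn : 0 < n) (hM : M ≠ 0)
    (h : AngleBounds p j k l m k₂ (gGamma n M)) (hq : 0 < p.gq) (hlm : Odd |l - m|) :
    ∃ f : ℕ → Fin (M + 1) → ℝ,
      JacobiSystem M (fun y => p.rX (gGamma n M) (1 / n) (y / n))
        (fun i => p.rB (gGamma n M) (1 / n) (i / n))
        (fun i => p.rA (gGamma n M) (1 / n) (i / n)
          * p.rC (gGamma n M) (1 / n) ((i + 1 : ℕ) / n)) f ∧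
      ∀ {Ω : Type*} [MeasurableSpace Ω] (P : Measure Ω), n ≤ M →
        ∀ Y : Ω → Fin n → Fin (M + 1),
          IsEnsemble P (p.base n) p.α p.β (p.qpow (gGamma n M)) p.δ n M Y →
          HasDetLaw P (fun i : Fin n => f i) Y := by
  have hnd := h.nondegenerate hn hq
  obtain ⟨f, hf1, hf2⟩ := hnd.exists_jacobiSystem hM
    (p.hpow_ne_zero (gGamma n M + p.gδ + 1 / n))
    (x := fun y => p.rX (gGamma n M) (1 / n) (y / n))
    (B := fun i => p.rB (gGamma n M) (1 / n) (i / n))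
    (s := fun i => p.rA (gGamma n M) (1 / n) (i / n)
          * p.rC (gGamma n M) (1 / n) ((i + 1 : ℕ) / n))
    (w := p.rWeight (gGamma n M) n)
    (fun y _ => p.nu_base n y _) (fun i _ => p.rB_base n i _)
    (fun i _ => by rw [p.recA_base, p.recC_base]; push_cast; ring)
    (fun y hy => h.rWeight_pos hn hq hlm hy)
    (fun y hy => p.weight_base hnd hy)
  exact ⟨f, hf1, fun P hnM Y hY => hf2 P n hnM Y hY⟩

end AngleBounds

/-! ### The limiting recurrence coefficients and their duality -/

namespace Params

variable (p : Params)

/-- The parameters of the dual q-Racah polynomials. -/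
def swap : Params := ⟨p.gq, p.gγ, p.gδ, p.gβ, p.gα⟩

lemma swap_qpow (t : ℝ) : p.swap.qpow t = p.qpow t := rfl

lemma swap_α : p.swap.α = p.γ := rfl

lemma swap_β : p.swap.β = p.δ := rfl

lemma swap_γ : p.swap.γ = p.α := rfl

lemma swap_δ : p.swap.δ = p.β := rfl

/-- Real form of `limA`. -/
def tA (ξ : ℝ) : ℝ :=
  -4 * (p.sn (p.gγ + ξ) * p.sn (p.gα + ξ) * p.sn (p.gα + p.gβ + ξ) * p.sn (p.gδ + p.gβ + ξ))
    / (p.sn (p.gα + p.gβ + 2 * ξ) * p.sn (p.gα + p.gβ + 2 * ξ))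

/-- Real form of `limC`. -/
def tC (ξ : ℝ) : ℝ :=
  -4 * (p.sn ξ * p.sn (p.gβ + ξ) * p.sn (p.gα - p.gδ + ξ) * p.sn (p.gα + p.gβ - p.gγ + ξ))
    / (p.sn (p.gα + p.gβ + 2 * ξ) * p.sn (p.gα + p.gβ + 2 * ξ))

/-- Real form of `b`. -/
def tB (ξ : ℝ) : ℝ := p.cs (p.gγ + p.gδ) - p.tA ξ - p.tC ξ

/-- Real form of `mu`. -/
def tX (x : ℝ) : ℝ := p.cs (p.gγ + p.gδ + 2 * x)

lemma rA_zero (ξ : ℝ) : p.rA p.gγ 0 ξ = p.tA ξ := by simp [rA, tA]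

lemma rC_zero (ξ : ℝ) : p.rC p.gγ 0 ξ = p.tC ξ := by simp [rC, tC]

lemma limA_eq (ξ : ℝ) : p.limA ξ = p.hpow (p.gγ + p.gδ) * p.tA ξ := by
  have h := p.rA_eq p.gγ 0 ξ
  simp only [add_zero, mul_zero, rA_zero] at h
  rw [← h, limA, γ, sq]

lemma limC_eq (ξ : ℝ) : p.limC ξ = p.hpow (p.gγ + p.gδ) * p.tC ξ := by
  have h := p.rC_eq p.gγ 0 ξ
  simp only [add_zero, rC_zero] at h
  rw [← h, limC, γ, sq]
  simp [qpow]

lemma b_eq (ξ : ℝ) : p.b ξ = p.hpow (p.gγ + p.gδ) * p.tB ξ := by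
  have h := p.one_add_qpow (p.gγ + p.gδ)
  rw [b, limA_eq, limC_eq, tB, γ, δ, ← qpow_add, add_comm p.gδ, h]
  push_cast; ring

lemma aSq_eq (ξ : ℝ) : p.aSq ξ = p.hpow (p.gγ + p.gδ) ^ 2 * (p.tA ξ * p.tC ξ : ℝ) := by
  rw [aSq, limA_eq, limC_eq]; push_cast; ring

lemma mu_eq (x : ℝ) : p.mu x = p.hpow (p.gγ + p.gδ) * p.tX x := by
  have h := p.qpow_add_qpow (-x) (p.gγ + p.gδ + x)
  rw [mu, γ, δ, ← qpow_add, ← qpow_add, h, tX, ← cs_neg]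
  congr 2
  · ring
  · congr 2; ring

lemma D_eq' (x ξ : ℝ) : p.D x ξ = p.hpow (p.gγ + p.gδ) ^ 2
    * (4 * (p.tA ξ * p.tC ξ) - (p.tX x - p.tB ξ) ^ 2 : ℝ) := by
  rw [D, aSq_eq, mu_eq, b_eq]; push_cast; ring

lemma Dreal_eq (x ξ : ℝ) : p.Dreal x ξ = 4 * (p.tA ξ * p.tC ξ) - (p.tX x - p.tB ξ) ^ 2 := by
  have h : p.γ * p.δ = p.hpow (p.gγ + p.gδ) ^ 2 := by
    rw [γ, δ, ← qpow_add, qpow_eq_hpow_sq]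
  rw [Dreal, D_eq', h, mul_div_cancel_left₀ _ (pow_ne_zero _ (p.hpow_ne_zero _)),
    Complex.ofReal_re]

lemma D_eq (x ξ : ℝ) : p.D x ξ = p.hpow (p.gγ + p.gδ) ^ 2 * p.Dreal x ξ := by
  rw [D_eq', Dreal_eq]

lemma D_eq_zero_iff (x ξ : ℝ) : p.D x ξ = 0 ↔ p.Dreal x ξ = 0 := by
  rw [D_eq, mul_eq_zero, or_iff_right (pow_ne_zero _ (p.hpow_ne_zero _))]
  exact_mod_cast Iff.rfl

lemma yTilde_eq (ξ : ℝ) : p.yTilde ξ = p.swap.tX ξ := by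
  simp only [yTilde, swap, tX, cs]
  congr 2; ring

lemma one_sub_mul_qpow_sq (s ξ : ℝ) : (1 - p.qpow s * p.qpow (2 * ξ)) ^ 2
    = -4 * (p.sn (s + 2 * ξ) : ℂ) ^ 2 * (p.qpow s * p.qpow ξ ^ 2) := by
  have e : p.qpow s * p.qpow ξ ^ 2 = p.hpow (s + 2 * ξ) ^ 2 := by
    rw [← qpow_eq_hpow_sq, qpow_add, two_mul, qpow_add]; ring
  rw [e, ← qpow_add, one_sub_qpow]
  linear_combination (4 * (p.sn (s + 2 * ξ) : ℂ) ^ 2 * p.hpow (s + 2 * ξ) ^ 2) * Complex.I_sq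

/-- The rational identity behind the duality of the limiting curves. -/
lemma duality_identity (a b c d X Z : ℂ) (hX : X ≠ 0) (hZ : Z ≠ 0)
    (h1 : 1 - a * b * Z ^ 2 ≠ 0) (h2 : 1 - c * d * X ^ 2 ≠ 0) :
    (4 * (((1 - c * Z) * (1 - a * Z) * (1 - a * b * Z) * (1 - d * b * Z))
        / (1 - a * b * Z ^ 2) ^ 2
      * (((1 - Z) * (1 - b * Z) * (d - a * Z) * (c - a * b * Z)) / (1 - a * b * Z ^ 2) ^ 2))
      - (X⁻¹ + c * d * X - (1 + d * c
        - ((1 - c * Z) * (1 - a * Z) * (1 - a * b * Z) * (1 - d * b * Z))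
          / (1 - a * b * Z ^ 2) ^ 2
        - ((1 - Z) * (1 - b * Z) * (d - a * Z) * (c - a * b * Z))
          / (1 - a * b * Z ^ 2) ^ 2)) ^ 2) * (X ^ 2 * (1 - a * b * Z ^ 2) ^ 2)
    = (4 * (((1 - a * X) * (1 - c * X) * (1 - c * d * X) * (1 - b * d * X))
        / (1 - c * d * X ^ 2) ^ 2
      * (((1 - X) * (1 - d * X) * (b - c * X) * (a - c * d * X)) / (1 - c * d * X ^ 2) ^ 2))
      - (Z⁻¹ + a * b * Z - (1 + b * a
        - ((1 - a * X) * (1 - c * X) * (1 - c * d * X) * (1 - b * d * X))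
          / (1 - c * d * X ^ 2) ^ 2
        - ((1 - X) * (1 - d * X) * (b - c * X) * (a - c * d * X))
          / (1 - c * d * X ^ 2) ^ 2)) ^ 2) * (Z ^ 2 * (1 - c * d * X ^ 2) ^ 2) := by
  obtain ⟨D1, e1⟩ : ∃ D, D = 1 - a * b * Z ^ 2 := ⟨_, rfl⟩
  obtain ⟨D2, e2⟩ : ∃ D, D = 1 - c * d * X ^ 2 := ⟨_, rfl⟩
  rw [← e1] at h1 ⊢
  rw [← e2] at h2 ⊢
  -- Using `(U + V)² - 4UV = (U - V)²`, the highest power of the denominator occurs only through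
  -- `((U - V)/D)²`.
  have aux : ∀ (U V m m0 D Y : ℂ), D ≠ 0 →
      (4 * (U / D ^ 2 * (V / D ^ 2)) - (m - (m0 - U / D ^ 2 - V / D ^ 2)) ^ 2) * (Y ^ 2 * D ^ 2)
      = -((Y * (m - m0)) ^ 2 * D ^ 2) - 2 * Y * (Y * (m - m0)) * (U + V)
        - Y ^ 2 * ((U - V) / D) ^ 2 := by
    intro U V m m0 D Y hD
    field_simp
    ring
  rw [aux _ _ _ _ _ _ h1, aux _ _ _ _ _ _ h2]
  have f1 : X * (X⁻¹ + c * d * X - (1 + d * c)) = (1 - X) * (1 - c * d * X) := by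
    field_simp; ring
  have f2 : Z * (Z⁻¹ + a * b * Z - (1 + b * a)) = (1 - Z) * (1 - a * b * Z) := by
    field_simp; ring
  -- `U - V` is divisible by `D`. With this and its dual, both sides are polynomials in `X` and `Z`,
  -- and they coincide.
  have g1 : ((1 - c * Z) * (1 - a * Z) * (1 - a * b * Z) * (1 - d * b * Z)
      - (1 - Z) * (1 - b * Z) * (d - a * Z) * (c - a * b * Z)) / D1
      = (1 - c * d) * (1 + a * b * Z ^ 2)
        + (-(a + c + a * b + b * d) + (1 + b) * (c * d) + a * b * d + a * c) * Z := by
    rw [div_eq_iff h1, e1]; ring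
  have g2 : ((1 - a * X) * (1 - c * X) * (1 - c * d * X) * (1 - b * d * X)
      - (1 - X) * (1 - d * X) * (b - c * X) * (a - c * d * X)) / D2
      = (1 - a * b) * (1 + c * d * X ^ 2)
        + (-(c + a + c * d + b * d) + (1 + d) * (a * b) + b * c * d + a * c) * X := by
    rw [div_eq_iff h2, e2]; ring
  rw [f1, f2, g1, g2, e1, e2]
  ring

/-- Duality between the variables `x` and `ξ`. -/
lemma duality {x ξ : ℝ} (h1 : p.sn (p.gα + p.gβ + 2 * ξ) ≠ 0)
    (h2 : p.sn (p.gγ + p.gδ + 2 * x) ≠ 0) :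
    p.sn (p.gα + p.gβ + 2 * ξ) ^ 2 * p.Dreal x ξ
      = p.sn (p.gγ + p.gδ + 2 * x) ^ 2 * p.swap.Dreal ξ x := by
  have q1 := p.one_sub_mul_qpow_sq (p.gα + p.gβ) ξ
  have q2 := p.one_sub_mul_qpow_sq (p.gγ + p.gδ) x
  have z1 : p.qpow (2 * ξ) = p.qpow ξ ^ 2 := by rw [two_mul, qpow_add]; ring
  have z2 : p.qpow (2 * x) = p.qpow x ^ 2 := by rw [two_mul, qpow_add]; ring
  rw [z1, qpow_add] at q1
  rw [z2, qpow_add] at q2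
  have n1 : 1 - p.α * p.β * p.qpow ξ ^ 2 ≠ 0 := by
    intro h
    rw [α, β] at h
    rw [h] at q1
    have : -4 * (p.sn (p.gα + p.gβ + 2 * ξ) : ℂ) ^ 2
        * (p.qpow p.gα * p.qpow p.gβ * p.qpow ξ ^ 2) ≠ 0 := by
      simp [h1, qpow_ne_zero]
    exact this (by rw [← q1]; ring)
  have n2 : 1 - p.γ * p.δ * p.qpow x ^ 2 ≠ 0 := by
    intro h
    rw [γ, δ] at h
    rw [h] at q2
    have : -4 * (p.sn (p.gγ + p.gδ + 2 * x) : ℂ) ^ 2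
        * (p.qpow p.gγ * p.qpow p.gδ * p.qpow x ^ 2) ≠ 0 := by
      simp [h2, qpow_ne_zero]
    exact this (by rw [← q2]; ring)
  have key := duality_identity p.α p.β p.γ p.δ (p.qpow x) (p.qpow ξ) (p.qpow_ne_zero _)
    (p.qpow_ne_zero _) n1 n2
  have d1 : p.D x ξ * (p.qpow x ^ 2 * (1 - p.α * p.β * p.qpow ξ ^ 2) ^ 2)
      = p.swap.D ξ x * (p.qpow ξ ^ 2 * (1 - p.γ * p.δ * p.qpow x ^ 2) ^ 2) := by
    have l : p.D x ξ = 4 * (p.limA ξ * p.limC ξ) - (p.mu x - (1 + p.δ * p.γ - p.limA ξ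
        - p.limC ξ)) ^ 2 := rfl
    have r : p.swap.D ξ x = 4 * (p.swap.limA x * p.swap.limC x) - (p.swap.mu ξ
        - (1 + p.β * p.α - p.swap.limA x - p.swap.limC x)) ^ 2 := by
      rw [D, aSq, b, swap_δ, swap_γ]
    have l1 : p.limA ξ = ((1 - p.γ * p.qpow ξ) * (1 - p.α * p.qpow ξ) * (1 - p.α * p.β * p.qpow ξ)
        * (1 - p.δ * p.β * p.qpow ξ)) / (1 - p.α * p.β * p.qpow ξ ^ 2) ^ 2 := by rw [limA, z1]
    have l2 : p.limC ξ = ((1 - p.qpow ξ) * (1 - p.β * p.qpow ξ) * (p.δ - p.α * p.qpow ξ)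
        * (p.γ - p.α * p.β * p.qpow ξ)) / (1 - p.α * p.β * p.qpow ξ ^ 2) ^ 2 := by rw [limC, z1]
    have r1 : p.swap.limA x = ((1 - p.α * p.qpow x) * (1 - p.γ * p.qpow x)
        * (1 - p.γ * p.δ * p.qpow x) * (1 - p.β * p.δ * p.qpow x))
        / (1 - p.γ * p.δ * p.qpow x ^ 2) ^ 2 := by
      rw [← z2, limA, swap_α, swap_β, swap_γ, swap_δ, swap_qpow, swap_qpow]
    have r2 : p.swap.limC x = ((1 - p.qpow x) * (1 - p.δ * p.qpow x) * (p.β - p.γ * p.qpow x)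
        * (p.α - p.γ * p.δ * p.qpow x)) / (1 - p.γ * p.δ * p.qpow x ^ 2) ^ 2 := by
      rw [← z2, limC, swap_α, swap_β, swap_γ, swap_δ, swap_qpow, swap_qpow]
    have m1 : p.mu x = (p.qpow x)⁻¹ + p.γ * p.δ * p.qpow x := by rw [mu, qpow_neg]
    have m2 : p.swap.mu ξ = (p.qpow ξ)⁻¹ + p.α * p.β * p.qpow ξ := by
      rw [← qpow_neg, mu, swap_γ, swap_δ, swap_qpow, swap_qpow]
    rw [l, r, l1, l2, r1, r2, m1, m2]
    exact key
  have hs : p.swap.hpow (p.gα + p.gβ) ^ 2 = p.qpow p.gα * p.qpow p.gβ := by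
    rw [← qpow_eq_hpow_sq, qpow_add]; rfl
  have hs' : p.hpow (p.gγ + p.gδ) ^ 2 = p.qpow p.gγ * p.qpow p.gδ := by
    rw [← qpow_eq_hpow_sq, qpow_add]
  have sD : p.swap.D ξ x = p.swap.hpow (p.gα + p.gβ) ^ 2 * p.swap.Dreal ξ x := by
    rw [D_eq]; rfl
  rw [D_eq, sD, hs, hs', α, β, γ, δ, q1, q2] at d1
  -- This is the unimodular phase common to both sides, up to the factor `-4`; cancelling it leaves
  -- a real identity.
  have nz : -4 * (p.qpow p.gα * p.qpow p.gβ * (p.qpow p.gγ * p.qpow p.gδ) * p.qpow x ^ 2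
      * p.qpow ξ ^ 2) ≠ 0 := by simp [qpow_ne_zero]
  have d2 : ((p.sn (p.gα + p.gβ + 2 * ξ) ^ 2 * p.Dreal x ξ : ℝ) : ℂ)
      = ((p.sn (p.gγ + p.gδ + 2 * x) ^ 2 * p.swap.Dreal ξ x : ℝ) : ℂ) := by
    apply mul_left_cancel₀ nz
    push_cast
    linear_combination d1
  exact_mod_cast d2

/-- `A` with two of the four pairs of factors interchanged with those of `C`. -/
def tA₁ (ξ : ℝ) : ℝ :=
  -4 * (p.sn ξ * p.sn (p.gβ + ξ) * p.sn (p.gγ + ξ) * p.sn (p.gδ + p.gβ + ξ))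
    / (p.sn (p.gα + p.gβ + 2 * ξ) * p.sn (p.gα + p.gβ + 2 * ξ))

def tC₁ (ξ : ℝ) : ℝ :=
  -4 * (p.sn (p.gα + p.gβ + ξ) * p.sn (p.gα + ξ) * p.sn (p.gα + p.gβ - p.gγ + ξ)
    * p.sn (p.gα - p.gδ + ξ)) / (p.sn (p.gα + p.gβ + 2 * ξ) * p.sn (p.gα + p.gβ + 2 * ξ))

/-- A second splitting of the same product. This pair is used for the band of `μ`, while `tA₁` and
`tC₁`, taken at `swap`, serve the band of `ỹ`. -/
def tA₂ (ξ : ℝ) : ℝ :=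
  -4 * (p.sn ξ * p.sn (p.gα + p.gβ - p.gγ + ξ) * p.sn (p.gα + ξ) * p.sn (p.gδ + p.gβ + ξ))
    / (p.sn (p.gα + p.gβ + 2 * ξ) * p.sn (p.gα + p.gβ + 2 * ξ))

def tC₂ (ξ : ℝ) : ℝ :=
  -4 * (p.sn (p.gα + p.gβ + ξ) * p.sn (p.gγ + ξ) * p.sn (p.gβ + ξ) * p.sn (p.gα - p.gδ + ξ))
    / (p.sn (p.gα + p.gβ + 2 * ξ) * p.sn (p.gα + p.gβ + 2 * ξ))

lemma tA₁_mul_tC₁ (ξ : ℝ) : p.tA₁ ξ * p.tC₁ ξ = p.tA ξ * p.tC ξ := by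
  simp only [tA₁, tC₁, tA, tC]; ring

lemma tA₂_mul_tC₂ (ξ : ℝ) : p.tA₂ ξ * p.tC₂ ξ = p.tA ξ * p.tC ξ := by
  simp only [tA₂, tC₂, tA, tC]; ring

/-- After the phase is restored this is an identity of rational functions of `q^ξ` with constant
value `α + γδ/α`. At the swapped parameters the value is `ỹ(-gγ)`. -/
lemma tB_add_tA₁_add_tC₁ {ξ : ℝ} (h : p.sn (p.gα + p.gβ + 2 * ξ) ≠ 0) :
    p.tB ξ + p.tA₁ ξ + p.tC₁ ξ = p.cs (p.gγ + p.gδ - 2 * p.gα) := by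
  have nD := sub_ne_zero.2 (p.qpow_ne_one h).symm
  have hb : p.hpow (p.gγ + p.gδ) * p.tB ξ = 1 + p.γ * p.δ - p.limA ξ - p.limC ξ := by
    rw [← b_eq, b]; ring
  have ha1 : p.hpow (p.gγ + p.gδ) * p.tA₁ ξ = p.α * ((1 - p.qpow ξ) * (1 - p.β * p.qpow ξ)
      * (1 - p.γ * p.qpow ξ) * (1 - p.δ * p.β * p.qpow ξ))
      / ((1 - p.qpow (p.gα + p.gβ + 2 * ξ)) * (1 - p.qpow (p.gα + p.gβ + 2 * ξ))) := by
    simp only [α, β, γ, δ, ← qpow_add]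
    rw [mul_div_assoc, ratio_eq, tA₁, ← hpow_two_mul, ← mul_assoc (p.hpow _), ← hpow_add]
    congr 2; ring
  have hc1 : p.hpow (p.gγ + p.gδ) * p.tC₁ ξ = p.γ * p.δ / p.α * ((1 - p.α * p.β * p.qpow ξ)
      * (1 - p.α * p.qpow ξ) * (1 - p.α * p.β / p.γ * p.qpow ξ) * (1 - p.α / p.δ * p.qpow ξ))
      / ((1 - p.qpow (p.gα + p.gβ + 2 * ξ)) * (1 - p.qpow (p.gα + p.gβ + 2 * ξ))) := by
    simp only [α, β, γ, δ, ← qpow_add, ← qpow_sub]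
    rw [mul_div_assoc, ratio_eq, tC₁, ← hpow_two_mul, ← mul_assoc (p.hpow _), ← hpow_add]
    congr 2; ring
  have hv : p.hpow (p.gγ + p.gδ) * p.cs (p.gγ + p.gδ - 2 * p.gα) = p.α + p.γ * p.δ / p.α := by
    simp only [α, γ, δ, ← qpow_add, ← qpow_sub]
    rw [qpow_add_qpow, ← cs_neg]
    congr 2
    · ring
    · congr 2; ring
  have e : p.qpow (p.gα + p.gβ + 2 * ξ) = p.α * p.β * p.qpow ξ ^ 2 := by
    rw [α, β, qpow_add, qpow_add, two_mul, qpow_add]; ring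
  have e2 : p.qpow (2 * ξ) = p.qpow ξ ^ 2 := by rw [two_mul, qpow_add]; ring
  rw [e] at nD ha1 hc1
  have key : ((p.tB ξ + p.tA₁ ξ + p.tC₁ ξ : ℝ) : ℂ) = (p.cs (p.gγ + p.gδ - 2 * p.gα) : ℝ) := by
    apply mul_left_cancel₀ (p.hpow_ne_zero (p.gγ + p.gδ))
    push_cast
    rw [mul_add, mul_add, hb, ha1, hc1, hv, limA, limC, e2]
    have na : p.α ≠ 0 := p.qpow_ne_zero _
    have nc : p.γ ≠ 0 := p.qpow_ne_zero _
    have nd : p.δ ≠ 0 := p.qpow_ne_zero _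
    obtain ⟨D, eD⟩ : ∃ D, D = 1 - p.α * p.β * p.qpow ξ ^ 2 := ⟨_, rfl⟩
    rw [← eD] at nD ⊢
    field_simp
    rw [eD]
    ring
  exact_mod_cast key

lemma tB_add_tA₂_add_tC₂ {ξ : ℝ} (h : p.sn (p.gα + p.gβ + 2 * ξ) ≠ 0) :
    p.tB ξ + p.tA₂ ξ + p.tC₂ ξ = p.tX (-p.gγ) := by
  have nD := sub_ne_zero.2 (p.qpow_ne_one h).symm
  have hb : p.hpow (p.gγ + p.gδ) * p.tB ξ = 1 + p.γ * p.δ - p.limA ξ - p.limC ξ := by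
    rw [← b_eq, b]; ring
  have ha1 : p.hpow (p.gγ + p.gδ) * p.tA₂ ξ = p.γ * ((1 - p.qpow ξ)
      * (1 - p.α * p.β / p.γ * p.qpow ξ) * (1 - p.α * p.qpow ξ) * (1 - p.δ * p.β * p.qpow ξ))
      / ((1 - p.qpow (p.gα + p.gβ + 2 * ξ)) * (1 - p.qpow (p.gα + p.gβ + 2 * ξ))) := by
    simp only [α, β, γ, δ, ← qpow_add, ← qpow_sub]
    rw [mul_div_assoc, ratio_eq, tA₂, ← hpow_two_mul, ← mul_assoc (p.hpow _), ← hpow_add]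
    congr 2; ring
  have hc1 : p.hpow (p.gγ + p.gδ) * p.tC₂ ξ = p.δ * ((1 - p.α * p.β * p.qpow ξ)
      * (1 - p.γ * p.qpow ξ) * (1 - p.β * p.qpow ξ) * (1 - p.α / p.δ * p.qpow ξ))
      / ((1 - p.qpow (p.gα + p.gβ + 2 * ξ)) * (1 - p.qpow (p.gα + p.gβ + 2 * ξ))) := by
    simp only [α, β, γ, δ, ← qpow_add, ← qpow_sub]
    rw [mul_div_assoc, ratio_eq, tC₂, ← hpow_two_mul, ← mul_assoc (p.hpow _), ← hpow_add]
    congr 2; ring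
  have hv : p.hpow (p.gγ + p.gδ) * p.tX (-p.gγ) = p.γ + p.δ := by
    rw [γ, δ, qpow_add_qpow, tX, ← cs_neg]
    congr 3; ring
  have e : p.qpow (p.gα + p.gβ + 2 * ξ) = p.α * p.β * p.qpow ξ ^ 2 := by
    rw [α, β, qpow_add, qpow_add, two_mul, qpow_add]; ring
  have e2 : p.qpow (2 * ξ) = p.qpow ξ ^ 2 := by rw [two_mul, qpow_add]; ring
  rw [e] at nD ha1 hc1
  have key : ((p.tB ξ + p.tA₂ ξ + p.tC₂ ξ : ℝ) : ℂ) = (p.tX (-p.gγ) : ℝ) := by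
    apply mul_left_cancel₀ (p.hpow_ne_zero (p.gγ + p.gδ))
    push_cast
    rw [mul_add, mul_add, hb, ha1, hc1, hv, limA, limC, e2]
    have nc : p.γ ≠ 0 := p.qpow_ne_zero _
    have nd : p.δ ≠ 0 := p.qpow_ne_zero _
    obtain ⟨D, eD⟩ : ∃ D, D = 1 - p.α * p.β * p.qpow ξ ^ 2 := ⟨_, rfl⟩
    rw [← eD] at nD ⊢
    field_simp
    rw [eD]
    ring
  exact_mod_cast key

lemma tX_zero (ξ : ℝ) : p.tX 0 = p.tB ξ + p.tA ξ + p.tC ξ := by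
  rw [tX, tB, mul_zero, add_zero]; ring

lemma continuous_tX : Continuous p.tX := by
  unfold tX; exact p.continuous_cs.comp (by fun_prop)

lemma hasDerivAt_tX (x : ℝ) : HasDerivAt p.tX (-(2 * p.gq * p.sn (p.gγ + p.gδ + 2 * x))) x := by
  have h1 : HasDerivAt (fun x : ℝ => p.gq * (p.gγ + p.gδ + 2 * x) / 2) p.gq x := by
    have h := (((hasDerivAt_id x).const_mul 2).const_add (p.gγ + p.gδ)).const_mul p.gq |>.div_const 2
    simpa using h
  have h2 := (h1.cos).const_mul 2
  refine h2.congr_deriv ?_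
  rw [sn]; ring

lemma deriv_mu (x : ℝ) : deriv p.mu x
    = p.hpow (p.gγ + p.gδ) * ((-(2 * p.gq * p.sn (p.gγ + p.gδ + 2 * x)) : ℝ) : ℂ) := by
  have h : p.mu = fun x => p.hpow (p.gγ + p.gδ) * (p.tX x : ℂ) := funext p.mu_eq
  rw [h]
  exact ((p.hasDerivAt_tX x).ofReal_comp.const_mul _).deriv

lemma norm_deriv_mu (hq : 0 < p.gq) (x : ℝ) :
    ‖deriv p.mu x‖ = 2 * p.gq * |p.sn (p.gγ + p.gδ + 2 * x)| := by
  rw [deriv_mu, norm_mul, norm_hpow, one_mul, Complex.norm_real, Real.norm_eq_abs, abs_neg, abs_mul,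
    abs_of_pos (by positivity : 0 < 2 * p.gq)]

lemma deriv_mu_ne_zero_iff (hq : 0 < p.gq) (x : ℝ) :
    deriv p.mu x ≠ 0 ↔ p.sn (p.gγ + p.gδ + 2 * x) ≠ 0 := by
  rw [deriv_mu, mul_ne_zero_iff, and_iff_right (p.hpow_ne_zero _), Complex.ofReal_ne_zero, neg_ne_zero,
    mul_ne_zero_iff, and_iff_right (by positivity : 2 * p.gq ≠ 0)]

lemma cs_anti (hq : 0 < p.gq) {m : ℤ} {s t : ℝ} (h1 : p.per * m ≤ s) (h : s < t)
    (h2 : t ≤ p.per * (m + 1)) : (-1 : ℝ) ^ m * p.cs t < (-1 : ℝ) ^ m * p.cs s := by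
  have e : ∀ t, (-1 : ℝ) ^ m * p.cs t = 2 * Real.cos (p.gq * t / 2 - m * Real.pi) := by
    intro t
    rw [Real.cos_sub_int_mul_pi, cs]; ring
  have h1' := mul_le_mul_of_nonneg_left h1 hq.le
  have h2' := mul_le_mul_of_nonneg_left h2 hq.le
  have h' := mul_lt_mul_of_pos_left h hq
  rw [← mul_assoc, gq_mul_per p hq] at h1' h2'
  rw [e, e]
  have := Real.strictAntiOn_cos (a := p.gq * s / 2 - m * Real.pi)
    (b := p.gq * t / 2 - m * Real.pi) ⟨by linarith, by linarith⟩ ⟨by linarith, by linarith⟩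
    (by linarith)
  linarith

end Params

/-- Location of `b ± 2 √(A C)`, given two representations of it. -/
lemma band_mem {σ A C A' C' b top bot : ℝ} (hσ : σ = 1 ∨ σ = -1) (hA : 0 ≤ σ * A) (hC : 0 ≤ σ * C)
    (hA' : σ * A' ≤ 0) (hC' : σ * C' ≤ 0) (htop : top = b + A + C) (hbot : b + A' + C' = bot)
    (hmul : A' * C' = A * C) :
    0 ≤ A * C ∧ σ * bot ≤ σ * b - 2 * Real.sqrt (A * C)
      ∧ σ * b + 2 * Real.sqrt (A * C) ≤ σ * top := by
  have hσ2 : σ * σ = 1 := by rcases hσ with h | h <;> rw [h] <;> norm_num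
  have amgm : ∀ u v : ℝ, 0 ≤ u → 0 ≤ v → 2 * Real.sqrt (u * v) ≤ u + v := by
    intro u v hu hv
    rw [Real.sqrt_mul hu]
    nlinarith [sq_nonneg (Real.sqrt u - Real.sqrt v), Real.sq_sqrt hu, Real.sq_sqrt hv]
  have e1 : A * C = (σ * A) * (σ * C) := by linear_combination -(A * C) * hσ2
  have e2 : A * C = (-(σ * A')) * (-(σ * C')) := by
    rw [← hmul]; linear_combination -(A' * C') * hσ2
  refine ⟨by rw [e1]; exact mul_nonneg hA hC, ?_, ?_⟩
  · have := amgm _ _ (by linarith : 0 ≤ -(σ * A')) (by linarith : 0 ≤ -(σ * C'))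
    rw [← e2] at this
    rw [← hbot]; linarith
  · have := amgm _ _ hA hC
    rw [← e1] at this
    rw [htop]; linarith

/-! ### The limiting curves and their intersections -/

/-- The angle restrictions satisfied by the limiting parameters. -/
structure LimitBounds (p : Params) (j k l m k₂ : ℤ) : Prop extends
    AngleBounds p j k l m k₂ p.gγ where
  gq_pos : 0 < p.gq
  odd : Odd |l - m|
  abl_lt : p.per * k < p.gα + p.gβ
  abr_lt : p.gα + p.gβ < 2 * p.gγ + p.per * (k + 1)

lemma sign_mul {s₁ s₂ s₃ s₄ u₁ u₂ u₃ u₄ σ d : ℝ} (h₁ : 0 ≤ s₁ * u₁) (h₂ : 0 ≤ s₂ * u₂)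
    (h₃ : 0 ≤ s₃ * u₃) (h₄ : 0 ≤ s₄ * u₄) (hσ : s₁ * s₂ * s₃ * s₄ = -σ) :
    0 ≤ σ * (-4 * (u₁ * u₂ * u₃ * u₄) / (d * d)) := by
  have e : σ * (-4 * (u₁ * u₂ * u₃ * u₄) / (d * d))
      = 4 * ((s₁ * u₁) * (s₂ * u₂) * (s₃ * u₃) * (s₄ * u₄)) / (d * d) := by
    have : σ = -(s₁ * s₂ * s₃ * s₄) := by rw [hσ, neg_neg]
    rw [this]; ring
  rw [e]
  exact div_nonneg (by positivity) (mul_self_nonneg d)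

namespace LimitBounds

variable {p : Params} {j k l m k₂ : ℤ}

lemma g_neg (h : LimitBounds p j k l m k₂) : p.gγ < 0 := by linarith [h.upper]

/-- Combining the bounds leaves `k - 2j ∈ {0, 1}`, `k - l - m ∈ {0, 1}`, `l - k₂ - j ∈ {0, 1}` and
`j - k₂ - m ∈ {0, 1}`. The odd parity of `l - m`, hence of `l + m`, selects the stated value. -/
lemma l_eq (h : LimitBounds p j k l m k₂) : l = k₂ + k - j := by
  have hp := p.per_pos h.gq_pos
  have hg := h.g_neg
  have cast_lt : ∀ a b : ℤ, p.per * a < p.per * b → a < b := fun a b hab => by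
    exact_mod_cast lt_of_mul_lt_mul_left hab hp.le
  have i1 : 2 * j < k + 1 := cast_lt _ _ (by push_cast; linarith [h.al, h.bl, h.abr])
  have i2 : k < 2 * j + 2 := cast_lt _ _ (by push_cast; linarith [h.ar, h.br, h.abl])
  have i3 : l + m < k + 1 := cast_lt _ _ (by push_cast; linarith [h.bdl, h.adl, h.abr])
  have i4 : k < l + m + 2 := cast_lt _ _ (by push_cast; linarith [h.bdr, h.adr, h.abl])
  have i5 : k₂ + j < l + 1 := cast_lt _ _ (by push_cast; linarith [h.cdl, h.bl, h.bdr])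
  have i6 : l < k₂ + j + 2 := cast_lt _ _ (by push_cast; linarith [h.cdr, h.br, h.bdl])
  have i7 : j - k₂ - 1 < m + 1 := cast_lt _ _ (by push_cast; linarith [h.al, h.cdr, h.adr])
  have i8 : m < j + 1 - k₂ := cast_lt _ _ (by push_cast; linarith [h.ar, h.cdl, h.adl])
  have ho := h.odd
  rw [odd_abs] at ho
  obtain ⟨r, hr⟩ := ho
  omega

lemma sign_l (h : LimitBounds p j k l m k₂) :
    (-1 : ℝ) ^ l = (-1 : ℝ) ^ k₂ * (-1 : ℝ) ^ k * (-1 : ℝ) ^ j := by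
  rw [h.l_eq, sub_eq_add_neg, zpow_add₀ (by norm_num), zpow_add₀ (by norm_num), zpow_neg]
  rcases neg_one_zpow_cases j with e | e <;> rw [e] <;> norm_num

lemma sign_m (h : LimitBounds p j k l m k₂) :
    (-1 : ℝ) ^ m = -((-1 : ℝ) ^ k₂ * (-1 : ℝ) ^ k * (-1 : ℝ) ^ j) := by
  have h1 := neg_one_zpow_mul_of_odd_sub h.odd
  rw [← h.sign_l]
  rcases neg_one_zpow_cases l with e | e <;> rw [e] at h1 ⊢ <;> linarith

/-- The strict inequalities in `LimitBounds` make the denominators nonzero on the closed interval,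
endpoints included. -/
lemma sn_ab_two (h : LimitBounds p j k l m k₂) {ξ : ℝ} (hξ : ξ ∈ Icc 0 (-p.gγ)) :
    0 < (-1 : ℝ) ^ k * p.sn (p.gα + p.gβ + 2 * ξ) :=
  p.sn_sign h.gq_pos (by linarith [h.abl_lt, hξ.1]) (by linarith [h.abr_lt, hξ.2])

lemma sn_ab_two_ne (h : LimitBounds p j k l m k₂) {ξ : ℝ} (hξ : ξ ∈ Icc 0 (-p.gγ)) :
    p.sn (p.gα + p.gβ + 2 * ξ) ≠ 0 := right_ne_zero_of_mul (h.sn_ab_two hξ).ne'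

lemma sn_gd_two (h : LimitBounds p j k l m k₂) {x : ℝ} (hx : x ∈ Ioo 0 (-p.gγ)) :
    0 < (-1 : ℝ) ^ k₂ * p.sn (p.gγ + p.gδ + 2 * x) :=
  h.sn_gd h.gq_pos (by linarith [hx.1]) (by linarith [hx.2])

lemma sn_gd_two_ne (h : LimitBounds p j k l m k₂) {x : ℝ} (hx : x ∈ Ioo 0 (-p.gγ)) :
    p.sn (p.gγ + p.gδ + 2 * x) ≠ 0 := right_ne_zero_of_mul (h.sn_gd_two hx).ne'

lemma tX_anti (h : LimitBounds p j k l m k₂) {x y : ℝ} (hx : x ∈ Icc 0 (-p.gγ))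
    (hy : y ∈ Icc 0 (-p.gγ)) (hxy : x < y) :
    (-1 : ℝ) ^ k₂ * p.tX y < (-1 : ℝ) ^ k₂ * p.tX x :=
  p.cs_anti h.gq_pos (by linarith [h.cdl, hx.1]) (by linarith) (by linarith [h.cdr, hy.2])

lemma yTilde_anti (h : LimitBounds p j k l m k₂) {x y : ℝ} (hx : x ∈ Icc 0 (-p.gγ))
    (hy : y ∈ Icc 0 (-p.gγ)) (hxy : x < y) :
    (-1 : ℝ) ^ k * p.swap.tX y < (-1 : ℝ) ^ k * p.swap.tX x :=
  p.cs_anti (s := p.gα + p.gβ + 2 * x) (t := p.gα + p.gβ + 2 * y) h.gq_pos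
    (by linarith [h.abl, hx.1]) (by linarith) (by linarith [h.abr, hy.2])

/-- The support of the limiting spectral measure at level `ξ` lies in the range of the nodes. -/
lemma band_mu (h : LimitBounds p j k l m k₂) {ξ : ℝ} (hξ : ξ ∈ Icc 0 (-p.gγ)) :
    0 ≤ p.tA ξ * p.tC ξ
      ∧ (-1 : ℝ) ^ k₂ * p.tX (-p.gγ)
        ≤ (-1 : ℝ) ^ k₂ * p.tB ξ - 2 * Real.sqrt (p.tA ξ * p.tC ξ)
      ∧ (-1 : ℝ) ^ k₂ * p.tB ξ + 2 * Real.sqrt (p.tA ξ * p.tC ξ)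
        ≤ (-1 : ℝ) ^ k₂ * p.tX 0 := by
  have hq := h.gq_pos
  have a1 := h.sn_x' hq hξ
  have a2 := h.sn_a' hq hξ
  have a3 := h.sn_b' hq hξ
  have a4 := h.sn_g' hq hξ
  have a5 := h.sn_ab' hq hξ
  have a6 := h.sn_bd' hq hξ
  have a7 := h.sn_ad' hq hξ
  have a8 := h.sn_abg' hq hξ
  rw [add_comm p.gβ p.gδ] at a6
  have a1' : 0 ≤ 1 * p.sn ξ := by linarith
  have a4' : 0 ≤ (-1) * p.sn (p.gγ + ξ) := by linarith
  have sl := h.sign_l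
  have sm := h.sign_m
  -- `tA`, `tC` carry the sign `(-1)^k₂` and give the bound at `x = 0`; `tA₂`, `tC₂` carry the
  -- opposite sign and give the bound at `x = -gγ`.
  refine band_mem (neg_one_zpow_cases k₂) (A' := p.tA₂ ξ) (C' := p.tC₂ ξ)
    (sign_mul a4' a2 a5 a6 ?_) (sign_mul a1' a3 a7 a8 ?_)
    ?_ ?_ (p.tX_zero ξ) (p.tB_add_tA₂_add_tC₂ (h.sn_ab_two_ne hξ)) (p.tA₂_mul_tC₂ ξ)
  · rw [sl]
    rcases neg_one_zpow_cases j with e1 | e1 <;> rcases neg_one_zpow_cases k with e2 | e2 <;>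
      rw [e1, e2] <;> ring
  · rw [sm]
    rcases neg_one_zpow_cases j with e1 | e1 <;> rcases neg_one_zpow_cases k with e2 | e2 <;>
      rw [e1, e2] <;> ring
  · have := sign_mul (σ := -(-1 : ℝ) ^ k₂) (d := p.sn (p.gα + p.gβ + 2 * ξ)) a1' a8 a2 a6 (by
      rw [sl]
      rcases neg_one_zpow_cases j with e1 | e1 <;> rcases neg_one_zpow_cases k with e2 | e2 <;>
      rw [e1, e2] <;> ring)
    rw [Params.tA₂]; linarith
  · have := sign_mul (σ := -(-1 : ℝ) ^ k₂) (d := p.sn (p.gα + p.gβ + 2 * ξ)) a5 a4' a3 a7 (by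
      rw [sm]
      rcases neg_one_zpow_cases j with e1 | e1 <;> rcases neg_one_zpow_cases k with e2 | e2 <;>
      rw [e1, e2] <;> ring)
    rw [Params.tC₂]; linarith

/-- The dual statement to `band_mu`. -/
lemma band_y (h : LimitBounds p j k l m k₂) {x : ℝ} (hx : x ∈ Icc 0 (-p.gγ))
    (hne : p.sn (p.gγ + p.gδ + 2 * x) ≠ 0) :
    0 ≤ p.swap.tA x * p.swap.tC x
      ∧ (-1 : ℝ) ^ k * p.swap.tX (-p.gγ)
        ≤ (-1 : ℝ) ^ k * p.swap.tB x - 2 * Real.sqrt (p.swap.tA x * p.swap.tC x)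
      ∧ (-1 : ℝ) ^ k * p.swap.tB x + 2 * Real.sqrt (p.swap.tA x * p.swap.tC x)
        ≤ (-1 : ℝ) ^ k * p.swap.tX 0 := by
  have hq := h.gq_pos
  have a1 := h.sn_x' hq hx
  have a2 := h.sn_a' hq hx
  have a4 := h.sn_g' hq hx
  have a6 := h.sn_bd' hq hx
  have a5 := h.sn_gd' hq hx
  have a7 := h.sn_gda' hq hx
  have a8 := h.sn_gb' hq hx
  have a9 := h.sn_d' hq hx
  have a1' : 0 ≤ 1 * p.sn x := by linarith
  have a4' : 0 ≤ (-1) * p.sn (p.gγ + x) := by linarith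
  have a7' : 0 ≤ (-(-1 : ℝ) ^ m) * p.sn (p.gγ + p.gδ - p.gα + x) := by linarith
  have a8' : 0 ≤ (-(-1 : ℝ) ^ j) * p.sn (p.gγ - p.gβ + x) := by linarith
  have sl := h.sign_l
  have sm := h.sign_m
  refine band_mem (neg_one_zpow_cases k) (A' := p.swap.tA₁ x) (C' := p.swap.tC₁ x)
    (sign_mul a2 a4' a5 a6 ?_) (sign_mul a1' a9 a8' a7' ?_)
    ?_ ?_ (p.swap.tX_zero x) ?_ (p.swap.tA₁_mul_tC₁ x)
  · rw [sl]
    rcases neg_one_zpow_cases j with e1 | e1 <;> rcases neg_one_zpow_cases k₂ with e2 | e2 <;>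
      rw [e1, e2] <;> ring
  · rw [sm]
    rcases neg_one_zpow_cases j with e1 | e1 <;> rcases neg_one_zpow_cases k₂ with e2 | e2 <;>
      rw [e1, e2] <;> ring
  · have := sign_mul (σ := -(-1 : ℝ) ^ k) (d := p.sn (p.gγ + p.gδ + 2 * x)) a1' a9 a2 a6 (by
      rw [sl]
      rcases neg_one_zpow_cases j with e1 | e1 <;> rcases neg_one_zpow_cases k₂ with e2 | e2 <;>
      rw [e1, e2] <;> ring)
    have e : p.swap.tA₁ x = -4 * (p.sn x * p.sn (p.gδ + x) * p.sn (p.gα + x)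
      * p.sn (p.gβ + p.gδ + x)) / (p.sn (p.gγ + p.gδ + 2 * x) * p.sn (p.gγ + p.gδ + 2 * x)) := rfl
    rw [e]; linarith
  · have := sign_mul (σ := -(-1 : ℝ) ^ k) (d := p.sn (p.gγ + p.gδ + 2 * x)) a5 a4' a7' a8' (by
      rw [sm]
      rcases neg_one_zpow_cases j with e1 | e1 <;> rcases neg_one_zpow_cases k₂ with e2 | e2 <;>
      rw [e1, e2] <;> ring)
    have e : p.swap.tC₁ x = -4 * (p.sn (p.gγ + p.gδ + x) * p.sn (p.gγ + x)
      * p.sn (p.gγ + p.gδ - p.gα + x) * p.sn (p.gγ - p.gβ + x))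
      / (p.sn (p.gγ + p.gδ + 2 * x) * p.sn (p.gγ + p.gδ + 2 * x)) := rfl
    rw [e]; linarith
  · have e := p.swap.tB_add_tA₁_add_tC₁ (ξ := x) hne
    have e2 : p.swap.tX (-p.gγ) = p.cs (p.gα + p.gβ + 2 * -p.gγ) := rfl
    have e3 : p.swap.cs (p.swap.gγ + p.swap.gδ - 2 * p.swap.gα) = p.cs (p.gα + p.gβ - 2 * p.gγ) :=
      rfl
    rw [e, e2, e3]
    congr 1; ring

lemma tA_mul_tC_pos (h : LimitBounds p j k l m k₂) {ξ : ℝ} (hξ : ξ ∈ Ioo 0 (-p.gγ)) :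
    0 < p.tA ξ * p.tC ξ := by
  have hq := h.gq_pos
  refine lt_of_le_of_ne (h.band_mu (Ioo_subset_Icc_self hξ)).1 (Ne.symm ?_)
  have d := h.sn_ab_two_ne (Ioo_subset_Icc_self hξ)
  have a1 := h.sn_x hq hξ.1 hξ.2.le
  have a2 := right_ne_zero_of_mul (h.sn_a hq hξ.1 hξ.2).ne'
  have a3 := right_ne_zero_of_mul (h.sn_b hq hξ.1 hξ.2).ne'
  have a4 := h.sn_g hq hξ.1 hξ.2
  have a5 := right_ne_zero_of_mul (h.sn_ab hq hξ.1 (by linarith [hξ.2, h.g_neg])).ne'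
  have a6 := right_ne_zero_of_mul (h.sn_bd hq hξ.1 hξ.2).ne'
  have a7 := right_ne_zero_of_mul (h.sn_ad hq hξ.1 hξ.2).ne'
  have a8 := right_ne_zero_of_mul (h.sn_abg hq hξ.1 hξ.2).ne'
  rw [add_comm p.gβ p.gδ] at a6
  simp [Params.tA, Params.tC, d, a1.ne', a2, a3, a4.ne, a5, a6, a7, a8]

lemma swap_tA_mul_tC_pos (h : LimitBounds p j k l m k₂) {x : ℝ} (hx : x ∈ Ioo 0 (-p.gγ)) :
    0 < p.swap.tA x * p.swap.tC x := by
  have hq := h.gq_pos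
  have d := h.sn_gd_two_ne hx
  refine lt_of_le_of_ne (h.band_y (Ioo_subset_Icc_self hx) d).1 (Ne.symm ?_)
  have a1 := (h.sn_x hq hx.1 hx.2.le).ne'
  have a2 := right_ne_zero_of_mul (h.sn_a hq hx.1 hx.2).ne'
  have a4 := (h.sn_g hq hx.1 hx.2).ne
  have a5 := right_ne_zero_of_mul (h.sn_gd hq hx.1 (by linarith [hx.2, h.g_neg])).ne'
  have a6 := right_ne_zero_of_mul (h.sn_bd hq hx.1 hx.2).ne'
  have a7 := right_ne_zero_of_mul (h.sn_gda hq hx.1 hx.2).ne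
  have a8 := right_ne_zero_of_mul (h.sn_gb hq hx.1 hx.2).ne
  have a9 := right_ne_zero_of_mul (h.sn_d hq hx.1 hx.2).ne'
  have e1 : p.swap.tA x = -4 * (p.sn (p.gα + x) * p.sn (p.gγ + x) * p.sn (p.gγ + p.gδ + x)
    * p.sn (p.gβ + p.gδ + x)) / (p.sn (p.gγ + p.gδ + 2 * x) * p.sn (p.gγ + p.gδ + 2 * x)) := rfl
  have e2 : p.swap.tC x = -4 * (p.sn x * p.sn (p.gδ + x) * p.sn (p.gγ - p.gβ + x)
    * p.sn (p.gγ + p.gδ - p.gα + x))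
    / (p.sn (p.gγ + p.gδ + 2 * x) * p.sn (p.gγ + p.gδ + 2 * x)) := rfl
  rw [e1, e2]
  simp [d, a1, a2, a4, a5, a6, a7, a8, a9]

/-- By `band_y` both edges of the dual band are values of `ỹ` on the interval, and the intermediate
value theorem applies. With the sign `(-1)^k` the function `ỹ` decreases, so the upper edge belongs
to the smaller root. -/
lemma exists_roots (h : LimitBounds p j k l m k₂) {x : ℝ} (hx : x ∈ Icc 0 (-p.gγ))
    (hne : p.sn (p.gγ + p.gδ + 2 * x) ≠ 0) :
    ∃ ξm ∈ Icc 0 (-p.gγ), ∃ ξp ∈ Icc 0 (-p.gγ), ξm ≤ ξp ∧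
      (-1 : ℝ) ^ k * p.swap.tX ξm
        = (-1 : ℝ) ^ k * p.swap.tB x + 2 * Real.sqrt (p.swap.tA x * p.swap.tC x) ∧
      (-1 : ℝ) ^ k * p.swap.tX ξp
        = (-1 : ℝ) ^ k * p.swap.tB x - 2 * Real.sqrt (p.swap.tA x * p.swap.tC x) := by
  obtain ⟨h1, h2, h3⟩ := h.band_y hx hne
  have hs := Real.sqrt_nonneg (p.swap.tA x * p.swap.tC x)
  have hg := h.g_neg
  have ivt := intermediate_value_Icc' (a := 0) (b := -p.gγ) (by linarith)
    (f := fun ξ => (-1 : ℝ) ^ k * p.swap.tX ξ) (continuous_const.mul p.swap.continuous_tX).continuousOn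
  obtain ⟨ξm, hm, em⟩ := ivt ⟨by linarith, h3⟩
  obtain ⟨ξp, hp, ep⟩ := ivt ⟨h2, by linarith⟩
  refine ⟨ξm, hm, ξp, hp, ?_, em, ep⟩
  by_contra! hlt
  have := h.yTilde_anti hp hm hlt
  simp only at em ep
  linarith

/-- The discriminant in terms of the dual variable. -/
lemma Dreal_mul (h : LimitBounds p j k l m k₂) {x ξ : ℝ} (hne : p.sn (p.gγ + p.gδ + 2 * x) ≠ 0)
    (hξ : ξ ∈ Icc 0 (-p.gγ)) :
    p.sn (p.gα + p.gβ + 2 * ξ) ^ 2 * p.Dreal x ξ = p.sn (p.gγ + p.gδ + 2 * x) ^ 2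
      * (4 * (p.swap.tA x * p.swap.tC x) - (p.swap.tX ξ - p.swap.tB x) ^ 2) := by
  rw [p.duality (h.sn_ab_two_ne hξ) hne, Params.Dreal_eq p.swap]

/-- By duality `D` is a nonvanishing factor times a quadratic in `ỹ(ξ)` whose zeros are the two band
edges, and `ỹ` is injective. -/
lemma D_eq_zero_iff (h : LimitBounds p j k l m k₂) {x ξ ξm ξp : ℝ} (hx : x ∈ Icc 0 (-p.gγ))
    (hne : p.sn (p.gγ + p.gδ + 2 * x) ≠ 0) (hξ : ξ ∈ Icc 0 (-p.gγ)) (hm : ξm ∈ Icc 0 (-p.gγ))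
    (hp : ξp ∈ Icc 0 (-p.gγ))
    (em : (-1 : ℝ) ^ k * p.swap.tX ξm
        = (-1 : ℝ) ^ k * p.swap.tB x + 2 * Real.sqrt (p.swap.tA x * p.swap.tC x))
    (ep : (-1 : ℝ) ^ k * p.swap.tX ξp
        = (-1 : ℝ) ^ k * p.swap.tB x - 2 * Real.sqrt (p.swap.tA x * p.swap.tC x)) :
    p.D x ξ = 0 ↔ ξ = ξm ∨ ξ = ξp := by
  have hinj : ∀ {u v : ℝ}, u ∈ Icc 0 (-p.gγ) → v ∈ Icc 0 (-p.gγ) →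
      (-1 : ℝ) ^ k * p.swap.tX u = (-1 : ℝ) ^ k * p.swap.tX v → u = v := by
    intro u v hu hv e
    rcases lt_trichotomy u v with hl | hl | hl
    · exact absurd e (h.yTilde_anti hu hv hl).ne'
    · exact hl
    · exact absurd e (h.yTilde_anti hv hu hl).ne
  have hsq := Real.sq_sqrt (h.band_y hx hne).1
  set r := Real.sqrt (p.swap.tA x * p.swap.tC x) with hr
  have hσ : (-1 : ℝ) ^ k * (-1 : ℝ) ^ k = 1 := by
    rcases neg_one_zpow_cases k with e | e <;> rw [e] <;> norm_num
  have hk0 : (-1 : ℝ) ^ k ≠ 0 := left_ne_zero_of_mul_eq_one hσ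
  have key := h.Dreal_mul hne hξ
  have d1 := h.sn_ab_two_ne hξ
  have e1 : 4 * (p.swap.tA x * p.swap.tC x) - (p.swap.tX ξ - p.swap.tB x) ^ 2
      = -(((-1 : ℝ) ^ k * p.swap.tX ξ - ((-1 : ℝ) ^ k * p.swap.tB x + 2 * r))
        * ((-1 : ℝ) ^ k * p.swap.tX ξ - ((-1 : ℝ) ^ k * p.swap.tB x - 2 * r))) := by
    rw [← hsq]
    linear_combination ((p.swap.tX ξ - p.swap.tB x) ^ 2) * hσ
  rw [← em, ← ep] at e1
  rw [p.D_eq_zero_iff]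
  constructor
  · intro h0
    rw [h0, mul_zero, e1] at key
    have h2 : ((-1 : ℝ) ^ k * p.swap.tX ξ - (-1 : ℝ) ^ k * p.swap.tX ξm)
        * ((-1 : ℝ) ^ k * p.swap.tX ξ - (-1 : ℝ) ^ k * p.swap.tX ξp) = 0 := by
      rcases mul_eq_zero.1 key.symm with h3 | h3
      · exact absurd h3 (pow_ne_zero _ hne)
      · linarith
    rcases mul_eq_zero.1 h2 with h3 | h3
    · exact Or.inl (hinj hξ hm (sub_eq_zero.1 h3))
    · exact Or.inr (hinj hξ hp (sub_eq_zero.1 h3))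
  · intro h0
    have h2 : p.sn (p.gα + p.gβ + 2 * ξ) ^ 2 * p.Dreal x ξ = 0 := by
      rw [key, e1]
      rcases h0 with rfl | rfl <;> simp
    exact (mul_eq_zero.1 h2).resolve_left (pow_ne_zero _ d1)

end LimitBounds

/-! ### The limiting density -/

/-- The angle `φ` with `T = c + 2 r cos φ`. -/
lemma hasDerivAt_arccos_angle {T : ℝ → ℝ} {T' c r t : ℝ} (hr : 0 < r) (hT : HasDerivAt T T' t)
    (hpos : 0 < 4 * r ^ 2 - (T t - c) ^ 2) :
    HasDerivAt (fun t => Real.arccos ((T t - c) / (2 * r)))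
      (-T' / Real.sqrt (4 * r ^ 2 - (T t - c) ^ 2)) t := by
  have hlt : ((T t - c) / (2 * r)) ^ 2 < 1 := by
    rw [div_pow, div_lt_one (by positivity)]; nlinarith
  have hlt' := abs_lt.1 ((sq_lt_one_iff_abs_lt_one _).1 hlt)
  have h := (Real.hasDerivAt_arccos hlt'.1.ne' hlt'.2.ne).comp t
    ((hT.sub_const c).div_const (2 * r))
  refine h.congr_deriv ?_
  have e : Real.sqrt (1 - ((T t - c) / (2 * r)) ^ 2)
      = Real.sqrt (4 * r ^ 2 - (T t - c) ^ 2) / (2 * r) := by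
    rw [show 1 - ((T t - c) / (2 * r)) ^ 2 = (4 * r ^ 2 - (T t - c) ^ 2) / (2 * r) ^ 2 by
      field_simp; ring, Real.sqrt_div' _ (by positivity), Real.sqrt_sq (by positivity)]
  rw [e]
  have := (Real.sqrt_pos.2 hpos).ne'
  field_simp

lemma cos_arccos_angle {T c r : ℝ} (hr : 0 < r) (hpos : 0 ≤ 4 * r ^ 2 - (T - c) ^ 2) :
    c + 2 * r * Real.cos (Real.arccos ((T - c) / (2 * r))) = T := by
  have hle : ((T - c) / (2 * r)) ^ 2 ≤ 1 := by
    rw [div_pow, div_le_one (by positivity)]; nlinarith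
  have hle' := abs_le.1 ((sq_le_one_iff_abs_le_one _).1 hle)
  rw [Real.cos_arccos hle'.1 hle'.2]
  field_simp
  ring

/-! ### Substitution of the arcsine angle -/

section angle

variable {T T' : ℝ → ℝ} {c r : ℝ} {S : Set ℝ}

lemma injOn_arccos_angle (hr : 0 < r) (hinj : InjOn T S)
    (hpos : ∀ t ∈ S, 0 < 4 * r ^ 2 - (T t - c) ^ 2) :
    InjOn (fun t => Real.arccos ((T t - c) / (2 * r))) S := by
  intro t ht u hu e
  refine hinj ht hu ?_
  rw [← cos_arccos_angle hr (hpos t ht).le, ← cos_arccos_angle hr (hpos u hu).le]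
  simp only at e
  rw [e]

/-- The substitution `T = c + 2r cos φ` turns the arcsine density into Lebesgue measure in `φ`. -/
lemma integral_arccos_angle (hr : 0 < r) (hS : MeasurableSet S)
    (hT : ∀ t ∈ S, HasDerivAt T (T' t) t) (hinj : InjOn T S)
    (hpos : ∀ t ∈ S, 0 < 4 * r ^ 2 - (T t - c) ^ 2) (h : ℝ → ℝ) :
    ∫ t in S, h (T t) * (|T' t| / Real.sqrt (4 * r ^ 2 - (T t - c) ^ 2))
      = ∫ φ in (fun t => Real.arccos ((T t - c) / (2 * r))) '' S, h (c + 2 * r * Real.cos φ) := by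
  rw [integral_image_eq_integral_abs_deriv_smul hS
    (fun t ht => (hasDerivAt_arccos_angle hr (hT t ht) (hpos t ht)).hasDerivWithinAt)
    (injOn_arccos_angle hr hinj hpos)]
  refine setIntegral_congr_fun hS fun t ht => ?_
  simp only [smul_eq_mul]
  rw [cos_arccos_angle hr (hpos t ht).le, abs_div, abs_neg, abs_of_nonneg (Real.sqrt_nonneg _),
    mul_comm]

lemma integrableOn_arccos_angle (hr : 0 < r) (hS : MeasurableSet S)
    (hT : ∀ t ∈ S, HasDerivAt T (T' t) t) (hinj : InjOn T S)
    (hpos : ∀ t ∈ S, 0 < 4 * r ^ 2 - (T t - c) ^ 2) :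
    IntegrableOn (fun t => |T' t| / Real.sqrt (4 * r ^ 2 - (T t - c) ^ 2)) S := by
  have h := (integrableOn_image_iff_integrableOn_abs_deriv_smul hS
    (fun t ht => (hasDerivAt_arccos_angle hr (hT t ht) (hpos t ht)).hasDerivWithinAt)
    (injOn_arccos_angle hr hinj hpos) (fun _ => (1 : ℝ))).1 (by
      refine integrableOn_const ?_
      refine ((measure_mono ?_).trans_lt (measure_Icc_lt_top (a := (0 : ℝ)) (b := Real.pi))).ne
      rintro _ ⟨t, _, rfl⟩
      exact ⟨Real.arccos_nonneg _, Real.arccos_le_pi _⟩)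
  refine h.congr_fun (fun t ht => ?_) hS
  simp only [smul_eq_mul, mul_one]
  rw [abs_div, abs_neg, abs_of_nonneg (Real.sqrt_nonneg _)]

end angle

namespace Params

variable (p : Params)

lemma measurable_tA : Measurable p.tA := by
  have := p.continuous_sn
  unfold tA
  exact (by fun_prop : Continuous fun ξ => -4 * (p.sn (p.gγ + ξ) * p.sn (p.gα + ξ)
    * p.sn (p.gα + p.gβ + ξ) * p.sn (p.gδ + p.gβ + ξ))).measurable.div
    (by fun_prop : Continuous fun ξ => p.sn (p.gα + p.gβ + 2 * ξ)
      * p.sn (p.gα + p.gβ + 2 * ξ)).measurable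

lemma measurable_tC : Measurable p.tC := by
  have := p.continuous_sn
  unfold tC
  exact (by fun_prop : Continuous fun ξ => -4 * (p.sn ξ * p.sn (p.gβ + ξ)
    * p.sn (p.gα - p.gδ + ξ) * p.sn (p.gα + p.gβ - p.gγ + ξ))).measurable.div
    (by fun_prop : Continuous fun ξ => p.sn (p.gα + p.gβ + 2 * ξ)
      * p.sn (p.gα + p.gβ + 2 * ξ)).measurable

lemma measurable_tB : Measurable p.tB :=
  (measurable_const.sub p.measurable_tA).sub p.measurable_tC

lemma measurable_Dreal : Measurable fun z : ℝ × ℝ => p.Dreal z.1 z.2 := by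
  have hA := p.measurable_tA
  have hC := p.measurable_tC
  have hB := p.measurable_tB
  have hX := p.continuous_tX.measurable
  simp only [Dreal_eq]
  fun_prop

/-- The density in terms of the recurrence coefficients. -/
def density (x : ℝ) : ℝ :=
  ‖deriv p.mu x‖ / Real.pi * ∫ ξ in Ioo (0 : ℝ) 1, 1 / Real.sqrt (p.Dreal x ξ)

/-- Points with negative discriminant contribute nothing, since the real square root of a negative
number is `0` and `1 / 0 = 0`. -/
lemma setIntegral_Dreal_nonneg (x : ℝ) :
    ∫ ξ in {ξ : ℝ | ξ ∈ Ioo 0 1 ∧ 0 ≤ p.Dreal x ξ}, 1 / Real.sqrt (p.Dreal x ξ)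
      = ∫ ξ in Ioo (0 : ℝ) 1, 1 / Real.sqrt (p.Dreal x ξ) := by
  symm
  refine setIntegral_eq_of_subset_of_forall_sdiff_eq_zero measurableSet_Ioo (fun ξ h => h.1) ?_
  rintro ξ ⟨h1, h2⟩
  have : p.Dreal x ξ ≤ 0 := by
    by_contra! h
    exact h2 ⟨h1, h.le⟩
  rw [Real.sqrt_eq_zero_of_nonpos this, div_zero]

end Params

namespace LimitBounds

variable {p : Params} {j k l m k₂ : ℤ}

lemma injOn_tX (h : LimitBounds p j k l m k₂) : InjOn p.tX (Icc 0 (-p.gγ)) := by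
  intro u hu v hv e
  rcases lt_trichotomy u v with hl | hl | hl
  · exact absurd (by rw [e]) (h.tX_anti hu hv hl).ne
  · exact hl
  · exact absurd (by rw [e]) (h.tX_anti hv hu hl).ne

lemma weight_eq (h : LimitBounds p j k l m k₂) {ξ : ℝ} (hξ : ξ ∈ Ioo 0 (-p.gγ)) (x : ℝ) :
    ‖deriv p.mu x‖ / Real.sqrt (p.Dreal x ξ)
      = |-(2 * p.gq * p.sn (p.gγ + p.gδ + 2 * x))|
        / Real.sqrt (4 * Real.sqrt (p.tA ξ * p.tC ξ) ^ 2 - (p.tX x - p.tB ξ) ^ 2) := by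
  rw [p.norm_deriv_mu h.gq_pos, p.Dreal_eq, Real.sq_sqrt (h.tA_mul_tC_pos hξ).le, abs_neg, abs_mul,
    abs_of_pos (by linarith [h.gq_pos] : 0 < 2 * p.gq)]

lemma Dreal_eq_sqrt (h : LimitBounds p j k l m k₂) {ξ : ℝ} (hξ : ξ ∈ Ioo 0 (-p.gγ)) (x : ℝ) :
    p.Dreal x ξ = 4 * Real.sqrt (p.tA ξ * p.tC ξ) ^ 2 - (p.tX x - p.tB ξ) ^ 2 := by
  rw [p.Dreal_eq, Real.sq_sqrt (h.tA_mul_tC_pos hξ).le]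

lemma measurableSet_Dreal_pos (ξ : ℝ) :
    MeasurableSet {x | x ∈ Ioo 0 (-p.gγ) ∧ 0 < p.Dreal x ξ} :=
  measurableSet_Ioo.inter (measurableSet_lt measurable_const
    (p.measurable_Dreal.comp (measurable_id.prodMk measurable_const)))

/-- Because the whole band lies in the range of `tX`, every angle in `(0, π)` is attained: no mass
of the arcsine law is lost in the variable `x`. -/
lemma image_angle (h : LimitBounds p j k l m k₂) {ξ : ℝ} (hξ : ξ ∈ Ioo 0 (-p.gγ)) :
    (fun x => Real.arccos ((p.tX x - p.tB ξ) / (2 * Real.sqrt (p.tA ξ * p.tC ξ))))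
      '' {x | x ∈ Ioo 0 (-p.gγ) ∧ 0 < p.Dreal x ξ} = Ioo 0 Real.pi := by
  obtain ⟨_, hb1, hb2⟩ := h.band_mu (Ioo_subset_Icc_self hξ)
  have hr := Real.sqrt_pos.2 (h.tA_mul_tC_pos hξ)
  simp only [h.Dreal_eq_sqrt hξ]
  generalize Real.sqrt (p.tA ξ * p.tC ξ) = r at hb1 hb2 hr ⊢
  apply Subset.antisymm
  · rintro _ ⟨x, ⟨_, hx⟩, rfl⟩
    have hlt : ((p.tX x - p.tB ξ) / (2 * r)) ^ 2 < 1 := by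
      rw [div_pow, div_lt_one (by positivity)]; nlinarith
    have hlt' := abs_lt.1 ((sq_lt_one_iff_abs_lt_one _).1 hlt)
    refine ⟨Real.arccos_pos.2 hlt'.2, lt_of_le_of_ne (Real.arccos_le_pi _) ?_⟩
    rw [Ne, Real.arccos_eq_pi]
    linarith [hlt'.1]
  · intro φ hφ
    have hc1 : Real.cos φ < 1 := by
      rw [← Real.cos_zero]
      exact Real.strictAntiOn_cos ⟨le_rfl, Real.pi_pos.le⟩ ⟨hφ.1.le, hφ.2.le⟩ hφ.1
    have hc2 : -1 < Real.cos φ := by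
      rw [← Real.cos_pi]
      exact Real.strictAntiOn_cos ⟨hφ.1.le, hφ.2.le⟩ ⟨Real.pi_pos.le, le_rfl⟩ hφ.2
    have b1 : 2 * r * Real.cos φ < 2 * r := by nlinarith
    have b2 : -(2 * r) < 2 * r * Real.cos φ := by nlinarith
    have hσ : (-1 : ℝ) ^ k₂ * (-1 : ℝ) ^ k₂ = 1 := by
      rcases neg_one_zpow_cases k₂ with e | e <;> rw [e] <;> norm_num
    obtain ⟨x, hx, ex⟩ := intermediate_value_Ioo' (a := 0) (b := -p.gγ) (by linarith [h.g_neg])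
      (f := fun x => (-1 : ℝ) ^ k₂ * p.tX x)
      (continuous_const.mul p.continuous_tX).continuousOn
      (show (-1 : ℝ) ^ k₂ * (p.tB ξ + 2 * r * Real.cos φ) ∈ _ by
        rcases neg_one_zpow_cases k₂ with e | e <;> rw [e] at hb1 hb2 ⊢ <;>
          constructor <;> linarith)
    have ex' : p.tX x = p.tB ξ + 2 * r * Real.cos φ :=
      mul_left_cancel₀ (left_ne_zero_of_mul_eq_one hσ) ex
    have e2 : p.tX x - p.tB ξ = 2 * r * Real.cos φ := by rw [ex']; ring
    refine ⟨x, ⟨hx, ?_⟩, ?_⟩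
    · rw [e2]
      have : 0 < (1 - Real.cos φ) * (1 + Real.cos φ) := mul_pos (by linarith) (by linarith)
      nlinarith [sq_nonneg r, mul_pos (mul_pos hr hr) this]
    · simp only
      rw [e2, mul_div_cancel_left₀ _ (by positivity), Real.arccos_cos hφ.1.le hφ.2.le]

/-- The arcsine law at level `ξ`, transported to the variable `x`. -/
lemma integral_weight (h : LimitBounds p j k l m k₂) {ξ : ℝ} (hξ : ξ ∈ Ioo 0 (-p.gγ)) (u : ℝ → ℝ) :
    ∫ x in Ioo 0 (-p.gγ), u (p.tX x) * (‖deriv p.mu x‖ / Real.sqrt (p.Dreal x ξ))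
      = ∫ φ in Ioo 0 Real.pi, u (p.tB ξ + 2 * Real.sqrt (p.tA ξ * p.tC ξ) * Real.cos φ) := by
  have hr := Real.sqrt_pos.2 (h.tA_mul_tC_pos hξ)
  rw [← h.image_angle hξ, ← integral_arccos_angle hr (measurableSet_Dreal_pos ξ)
    (fun t _ => p.hasDerivAt_tX t) (h.injOn_tX.mono fun x hx => Ioo_subset_Icc_self hx.1)
    (fun x hx => by rw [← h.Dreal_eq_sqrt hξ]; exact hx.2)]
  simp only [h.weight_eq hξ]
  refine setIntegral_eq_of_subset_of_forall_sdiff_eq_zero measurableSet_Ioo (fun x h => h.1) ?_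
  rintro x ⟨h1, h2⟩
  have : p.Dreal x ξ ≤ 0 := by
    by_contra! h
    exact h2 ⟨h1, h⟩
  rw [← h.Dreal_eq_sqrt hξ, Real.sqrt_eq_zero_of_nonpos this, div_zero, mul_zero]

lemma integrableOn_weight (h : LimitBounds p j k l m k₂) {ξ : ℝ} (hξ : ξ ∈ Ioo 0 (-p.gγ)) :
    IntegrableOn (fun x => ‖deriv p.mu x‖ / Real.sqrt (p.Dreal x ξ)) (Ioo 0 (-p.gγ)) := by
  have hr := Real.sqrt_pos.2 (h.tA_mul_tC_pos hξ)
  have h1 := integrableOn_arccos_angle hr (measurableSet_Dreal_pos ξ)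
    (fun t _ => p.hasDerivAt_tX t) (h.injOn_tX.mono fun x hx => Ioo_subset_Icc_self hx.1)
    (fun x hx => by rw [← h.Dreal_eq_sqrt hξ]; exact hx.2)
  simp only [← h.weight_eq hξ] at h1
  refine h1.of_forall_sdiff_eq_zero measurableSet_Ioo ?_
  rintro x ⟨h2, h3⟩
  have : p.Dreal x ξ ≤ 0 := by
    by_contra! h
    exact h3 ⟨h2, h⟩
  rw [Real.sqrt_eq_zero_of_nonpos this, div_zero]

/-- The weight is nonnegative and, for each `ξ`, integrates to `π` in `x`; Tonelli then gives joint
integrability. -/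
lemma integrable_weight_prod (h : LimitBounds p j k l m k₂) :
    Integrable (fun z : ℝ × ℝ => ‖deriv p.mu z.1‖ / Real.sqrt (p.Dreal z.1 z.2))
      ((volume.restrict (Ioo 0 (-p.gγ))).prod (volume.restrict (Ioo 0 1))) := by
  have hsub : Ioo (0 : ℝ) 1 ⊆ Ioo 0 (-p.gγ) := Ioo_subset_Ioo_right (by linarith [h.upper])
  have hm : Measurable fun z : ℝ × ℝ => ‖deriv p.mu z.1‖ / Real.sqrt (p.Dreal z.1 z.2) := by
    simp only [p.norm_deriv_mu h.gq_pos]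
    have h1 := p.continuous_sn.measurable
    have h2 := p.measurable_Dreal
    fun_prop
  refine (integrable_prod_iff' hm.aestronglyMeasurable).2 ⟨?_, ?_⟩
  · filter_upwards [ae_restrict_mem measurableSet_Ioo] with ξ hξ
    exact h.integrableOn_weight (hsub hξ)
  · refine (integrableOn_const (μ := volume) (s := Ioo (0 : ℝ) 1) (C := Real.pi)
      (by simp)).congr_fun (fun ξ hξ => ?_) measurableSet_Ioo
    have h1 := h.integral_weight (hsub hξ) (fun _ => 1)
    simp only [one_mul] at h1
    simp only
    rw [show (fun x => ‖‖deriv p.mu x‖ / Real.sqrt (p.Dreal x ξ)‖)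
      = fun x => ‖deriv p.mu x‖ / Real.sqrt (p.Dreal x ξ) from funext fun x =>
        Real.norm_of_nonneg (by positivity), h1]
    simp [Real.pi_pos.le]

lemma density_eq (x : ℝ) : p.density x
    = 1 / Real.pi * ∫ ξ in Ioo (0 : ℝ) 1, ‖deriv p.mu x‖ / Real.sqrt (p.Dreal x ξ) := by
  rw [Params.density, div_mul_eq_mul_div, one_div, inv_mul_eq_div, ← integral_const_mul]
  simp only [mul_one_div]

lemma integrableOn_density (h : LimitBounds p j k l m k₂) :
    IntegrableOn p.density (Ioo 0 (-p.gγ)) := by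
  rw [show p.density = fun x => 1 / Real.pi * ∫ ξ in Ioo (0 : ℝ) 1,
    ‖deriv p.mu x‖ / Real.sqrt (p.Dreal x ξ) from funext density_eq]
  exact (h.integrable_weight_prod.integral_prod_left).const_mul _

/-- The average of the arcsine laws has the limiting density. -/
lemma integral_density (h : LimitBounds p j k l m k₂) {u : ℝ → ℝ} (hu : Continuous u) :
    ∫ ξ in (0 : ℝ)..1, 1 / Real.pi * ∫ φ in (0 : ℝ)..Real.pi,
        u (p.tB ξ + 2 * Real.sqrt (p.tA ξ * p.tC ξ) * Real.cos φ)
      = ∫ x in Ioo 0 (-p.gγ), u (p.tX x) * p.density x := by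
  have hsub : Ioo (0 : ℝ) 1 ⊆ Ioo 0 (-p.gγ) := Ioo_subset_Ioo_right (by linarith [h.upper])
  have hint : Integrable (fun z : ℝ × ℝ => u (p.tX z.1)
      * (‖deriv p.mu z.1‖ / Real.sqrt (p.Dreal z.1 z.2)))
      ((volume.restrict (Ioo 0 (-p.gγ))).prod (volume.restrict (Ioo 0 1))) := by
    obtain ⟨C, hC⟩ := (isCompact_Icc (a := (-2 : ℝ)) (b := 2)).exists_bound_of_continuousOn
      hu.continuousOn
    refine h.integrable_weight_prod.bdd_mul (c := C)
      (hu.comp (p.continuous_tX.comp continuous_fst)).aestronglyMeasurable ?_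
    refine ae_of_all _ fun z => hC _ ?_
    rw [Params.tX, Params.cs]
    constructor <;> linarith [Real.neg_one_le_cos (p.gq * (p.gγ + p.gδ + 2 * z.1) / 2),
      Real.cos_le_one (p.gq * (p.gγ + p.gδ + 2 * z.1) / 2)]
  have hswap := integral_integral_swap (f := fun x ξ => u (p.tX x)
    * (‖deriv p.mu x‖ / Real.sqrt (p.Dreal x ξ))) hint
  rw [intervalIntegral.integral_of_le zero_le_one, integral_Ioc_eq_integral_Ioo]
  calc _ = 1 / Real.pi * ∫ ξ in Ioo (0 : ℝ) 1, ∫ x in Ioo 0 (-p.gγ), u (p.tX x)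
        * (‖deriv p.mu x‖ / Real.sqrt (p.Dreal x ξ)) := by
        rw [← integral_const_mul]
        refine setIntegral_congr_fun measurableSet_Ioo fun ξ hξ => ?_
        rw [h.integral_weight (hsub hξ), intervalIntegral.integral_of_le Real.pi_pos.le,
          integral_Ioc_eq_integral_Ioo]
    _ = _ := by
        rw [← hswap, ← integral_const_mul]
        refine integral_congr_ae (ae_of_all _ fun x => ?_)
        simp only
        rw [integral_const_mul, density_eq]
        ring

end LimitBounds

/-! ### The density as an angle -/

namespace LimitBounds

variable {p : Params} {j k l m k₂ : ℤ}

lemma yTilde_antitone (h : LimitBounds p j k l m k₂) {u v : ℝ} (hu : u ∈ Icc 0 (-p.gγ))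
    (hv : v ∈ Icc 0 (-p.gγ)) (huv : u ≤ v) :
    (-1 : ℝ) ^ k * p.swap.tX v ≤ (-1 : ℝ) ^ k * p.swap.tX u := by
  rcases huv.lt_or_eq with hl | rfl
  · exact (h.yTilde_anti hu hv hl).le
  · exact le_rfl

/-- The density `‖μ'(x)‖ / √D` in terms of the dual variable. -/
lemma weight_eq_dual (h : LimitBounds p j k l m k₂) {x ξ : ℝ} (hx : x ∈ Ioo 0 (-p.gγ))
    (hξ : ξ ∈ Icc 0 (-p.gγ)) :
    ‖deriv p.mu x‖ / Real.sqrt (p.Dreal x ξ)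
      = -((-1 : ℝ) ^ k * -(2 * p.gq * p.sn (p.gα + p.gβ + 2 * ξ)))
        / Real.sqrt (4 * Real.sqrt (p.swap.tA x * p.swap.tC x) ^ 2
          - ((-1 : ℝ) ^ k * p.swap.tX ξ - (-1 : ℝ) ^ k * p.swap.tB x) ^ 2) := by
  have hne := h.sn_gd_two_ne hx
  have hq := h.gq_pos
  have ha := h.sn_ab_two hξ
  have hσ : (-1 : ℝ) ^ k * (-1 : ℝ) ^ k = 1 := by
    rcases neg_one_zpow_cases k with e | e <;> rw [e] <;> norm_num
  have e1 : 4 * Real.sqrt (p.swap.tA x * p.swap.tC x) ^ 2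
      - ((-1 : ℝ) ^ k * p.swap.tX ξ - (-1 : ℝ) ^ k * p.swap.tB x) ^ 2
      = 4 * (p.swap.tA x * p.swap.tC x) - (p.swap.tX ξ - p.swap.tB x) ^ 2 := by
    rw [Real.sq_sqrt (h.swap_tA_mul_tC_pos hx).le]
    linear_combination (-(p.swap.tX ξ - p.swap.tB x) ^ 2) * hσ
  have key := congrArg Real.sqrt (h.Dreal_mul hne hξ)
  rw [Real.sqrt_mul (sq_nonneg _), Real.sqrt_mul (sq_nonneg _), Real.sqrt_sq_eq_abs,
    Real.sqrt_sq_eq_abs] at key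
  have e2 : -((-1 : ℝ) ^ k * -(2 * p.gq * p.sn (p.gα + p.gβ + 2 * ξ)))
      = 2 * p.gq * |p.sn (p.gα + p.gβ + 2 * ξ)| := by
    rcases neg_one_zpow_cases k with e | e <;> rw [e] at ha ⊢
    · rw [abs_of_pos (by linarith)]; ring
    · rw [abs_of_neg (by linarith)]; ring
  rw [e1, e2, p.norm_deriv_mu hq]
  have ha' := abs_pos.2 (h.sn_ab_two_ne hξ)
  have hs' := abs_pos.2 hne
  by_cases h0 : Real.sqrt (p.Dreal x ξ) = 0
  · rw [h0, mul_zero, zero_eq_mul, or_iff_right hs'.ne'] at key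
    rw [h0, key, div_zero, div_zero]
  · have h1 : Real.sqrt (4 * (p.swap.tA x * p.swap.tC x) - (p.swap.tX ξ - p.swap.tB x) ^ 2) ≠ 0 := by
      intro h1
      rw [h1, mul_zero, mul_eq_zero, or_iff_right ha'.ne'] at key
      exact h0 key
    rw [div_eq_div_iff h0 h1]
    linear_combination (-2 * p.gq) * key

section roots

variable {x ξm ξp : ℝ}

lemma roots_lt (h : LimitBounds p j k l m k₂) (hx : x ∈ Ioo 0 (-p.gγ)) (hle : ξm ≤ ξp)
    (em : (-1 : ℝ) ^ k * p.swap.tX ξm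
        = (-1 : ℝ) ^ k * p.swap.tB x + 2 * Real.sqrt (p.swap.tA x * p.swap.tC x))
    (ep : (-1 : ℝ) ^ k * p.swap.tX ξp
        = (-1 : ℝ) ^ k * p.swap.tB x - 2 * Real.sqrt (p.swap.tA x * p.swap.tC x)) : ξm < ξp := by
  refine lt_of_le_of_ne hle fun e => ?_
  have hr := Real.sqrt_pos.2 (h.swap_tA_mul_tC_pos hx)
  rw [e, ep] at em
  linarith

/-- Outside the roots `ỹ(ξ)` leaves the dual band, so the discriminant is nonpositive and the
quotient takes the default value `0`. -/
lemma weight_eq_zero (h : LimitBounds p j k l m k₂) (hx : x ∈ Ioo 0 (-p.gγ))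
    (hm : ξm ∈ Icc 0 (-p.gγ)) (hp : ξp ∈ Icc 0 (-p.gγ))
    (em : (-1 : ℝ) ^ k * p.swap.tX ξm
        = (-1 : ℝ) ^ k * p.swap.tB x + 2 * Real.sqrt (p.swap.tA x * p.swap.tC x))
    (ep : (-1 : ℝ) ^ k * p.swap.tX ξp
        = (-1 : ℝ) ^ k * p.swap.tB x - 2 * Real.sqrt (p.swap.tA x * p.swap.tC x))
    {ξ : ℝ} (hξ : ξ ∈ Icc 0 (-p.gγ)) (hout : ξ ≤ ξm ∨ ξp ≤ ξ) :
    ‖deriv p.mu x‖ / Real.sqrt (p.Dreal x ξ) = 0 := by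
  have hr := Real.sqrt_pos.2 (h.swap_tA_mul_tC_pos hx)
  rw [h.weight_eq_dual hx hξ]
  rw [Real.sqrt_eq_zero_of_nonpos, div_zero]
  rcases hout with h1 | h1
  · have := h.yTilde_antitone hξ hm h1
    nlinarith
  · have := h.yTilde_antitone hp hξ h1
    nlinarith

/-- In the dual form the integrand is the derivative of the arcsine angle in `ỹ(ξ)`, an angle that
is `0` at `ξm`. The endpoint singularities are integrable because the derivative is nonnegative and
the angle is continuous up to the ends. -/
lemma integral_weight_roots (h : LimitBounds p j k l m k₂) (hx : x ∈ Ioo 0 (-p.gγ))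
    (hm : ξm ∈ Icc 0 (-p.gγ)) (hp : ξp ∈ Icc 0 (-p.gγ))
    (em : (-1 : ℝ) ^ k * p.swap.tX ξm
        = (-1 : ℝ) ^ k * p.swap.tB x + 2 * Real.sqrt (p.swap.tA x * p.swap.tC x))
    (ep : (-1 : ℝ) ^ k * p.swap.tX ξp
        = (-1 : ℝ) ^ k * p.swap.tB x - 2 * Real.sqrt (p.swap.tA x * p.swap.tC x))
    {e : ℝ} (he : ξm ≤ e) (hep : e ≤ ξp) :
    ∫ ξ in Ioo ξm e, ‖deriv p.mu x‖ / Real.sqrt (p.Dreal x ξ)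
      = Real.arccos (((-1 : ℝ) ^ k * p.swap.tX e - (-1 : ℝ) ^ k * p.swap.tB x)
        / (2 * Real.sqrt (p.swap.tA x * p.swap.tC x))) := by
  have hr := Real.sqrt_pos.2 (h.swap_tA_mul_tC_pos hx)
  have hI : ∀ {ξ}, ξ ∈ Ioo ξm e → ξ ∈ Icc 0 (-p.gγ) := fun hξ =>
    ⟨hm.1.trans hξ.1.le, (hξ.2.le.trans hep).trans hp.2⟩
  rw [setIntegral_congr_fun measurableSet_Ioo fun ξ hξ => h.weight_eq_dual hx (hI hξ),
    ← integral_Ioc_eq_integral_Ioo, ← intervalIntegral.integral_of_le he]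
  have hder : ∀ ξ ∈ Ioo ξm e, HasDerivAt (fun ξ => Real.arccos (((-1 : ℝ) ^ k * p.swap.tX ξ
      - (-1 : ℝ) ^ k * p.swap.tB x) / (2 * Real.sqrt (p.swap.tA x * p.swap.tC x))))
      (-((-1 : ℝ) ^ k * -(2 * p.gq * p.sn (p.gα + p.gβ + 2 * ξ)))
        / Real.sqrt (4 * Real.sqrt (p.swap.tA x * p.swap.tC x) ^ 2
          - ((-1 : ℝ) ^ k * p.swap.tX ξ - (-1 : ℝ) ^ k * p.swap.tB x) ^ 2)) ξ := by
    intro ξ hξ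
    refine hasDerivAt_arccos_angle (T := fun ξ => (-1 : ℝ) ^ k * p.swap.tX ξ) hr
      ((p.swap.hasDerivAt_tX ξ).const_mul _) ?_
    have h1 := h.yTilde_anti hm (hI hξ) hξ.1
    have h2 := h.yTilde_anti (hI hξ) hp (hξ.2.trans_le hep)
    rw [em] at h1
    rw [ep] at h2
    generalize Real.sqrt (p.swap.tA x * p.swap.tC x) = r at *
    have := mul_pos (sub_pos.2 h1) (sub_pos.2 h2)
    nlinarith
  have hcont : ContinuousOn (fun ξ => Real.arccos (((-1 : ℝ) ^ k * p.swap.tX ξ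
      - (-1 : ℝ) ^ k * p.swap.tB x) / (2 * Real.sqrt (p.swap.tA x * p.swap.tC x)))) (Icc ξm e) := by
    have := p.swap.continuous_tX
    exact (Real.continuous_arccos.comp (((continuous_const.mul this).sub continuous_const).div_const
      _)).continuousOn
  rw [intervalIntegral.integral_eq_sub_of_hasDerivAt_of_le he hcont hder]
  · have e1 : ((-1 : ℝ) ^ k * p.swap.tX ξm - (-1 : ℝ) ^ k * p.swap.tB x)
        / (2 * Real.sqrt (p.swap.tA x * p.swap.tC x)) = 1 := by
      rw [em, add_sub_cancel_left, div_self (by positivity)]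
    rw [e1, Real.arccos_one, sub_zero]
  · rw [intervalIntegrable_iff_integrableOn_Ioc_of_le he]
    refine intervalIntegral.integrableOn_deriv_of_nonneg hcont hder fun ξ hξ => ?_
    have := h.sn_ab_two (hI hξ)
    have hq := h.gq_pos
    refine div_nonneg ?_ (Real.sqrt_nonneg _)
    have : 0 ≤ 2 * p.gq * ((-1 : ℝ) ^ k * p.sn (p.gα + p.gβ + 2 * ξ)) := by positivity
    linarith

/-- The explicit form of the density. -/
lemma rho_eq_density (h : LimitBounds p j k l m k₂) (hx : x ∈ Ioo 0 (-p.gγ))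
    (hm : ξm ∈ Icc 0 (-p.gγ)) (hp : ξp ∈ Icc 0 (-p.gγ)) (hle : ξm ≤ ξp)
    (em : (-1 : ℝ) ^ k * p.swap.tX ξm
        = (-1 : ℝ) ^ k * p.swap.tB x + 2 * Real.sqrt (p.swap.tA x * p.swap.tC x))
    (ep : (-1 : ℝ) ^ k * p.swap.tX ξp
        = (-1 : ℝ) ^ k * p.swap.tB x - 2 * Real.sqrt (p.swap.tA x * p.swap.tC x)) :
    p.rho k ξm ξp = p.density x := by
  have hr := Real.sqrt_pos.2 (h.swap_tA_mul_tC_pos hx)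
  have hI : ∀ {ξ : ℝ}, ξ ∈ Ioo (0 : ℝ) 1 → ξ ∈ Icc 0 (-p.gγ) := fun hξ =>
    ⟨hξ.1.le, by linarith [hξ.2, h.upper]⟩
  have hpi := Real.pi_pos
  rw [density_eq]
  -- The integral over `(0, 1)` is effectively over `ξm < ξ < min(ξp, 1)`; `e` is that upper end.
  have hrestr : ∀ e, (e = ξp ∨ e = 1) → e ≤ 1 →
      ∫ ξ in Ioo (0 : ℝ) 1, ‖deriv p.mu x‖ / Real.sqrt (p.Dreal x ξ)
        = ∫ ξ in Ioo ξm e, ‖deriv p.mu x‖ / Real.sqrt (p.Dreal x ξ) := by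
    intro e he he1
    refine setIntegral_eq_of_subset_of_forall_sdiff_eq_zero measurableSet_Ioo
      (Ioo_subset_Ioo hm.1 he1) ?_
    rintro ξ ⟨h1, h2⟩
    refine h.weight_eq_zero hx hm hp em ep (hI h1) ?_
    by_contra! hc
    refine h2 ⟨hc.1, ?_⟩
    rcases he with rfl | rfl
    · exact hc.2
    · exact h1.2
  rw [Params.rho]
  split_ifs with h1 h2
  · rw [hrestr ξp (Or.inl rfl) h1, h.integral_weight_roots hx hm hp em ep hle le_rfl, ep,
      sub_sub_cancel_left, neg_div, div_self (by positivity), Real.arccos_neg_one]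
    field_simp
  · push Not at h1
    rw [hrestr 1 (Or.inr rfl) le_rfl, h.integral_weight_roots hx hm hp em ep h2.le h1.le]
    simp only [Params.yTilde_eq]
    congr 2
    · have hσ : (-1 : ℝ) ^ k * (-1 : ℝ) ^ k = 1 := by
        rcases neg_one_zpow_cases k with e | e <;> rw [e] <;> norm_num
      -- The two values of `ỹ` are the band edges: their mean is the dual `tB x`, and their distance
      -- is four times the root of the dual product.
      have e1 : |p.swap.tX ξm - p.swap.tX ξp| = 2 * (2 * Real.sqrt (p.swap.tA x * p.swap.tC x)) := by
        have e2 : (-1 : ℝ) ^ k * (p.swap.tX ξm - p.swap.tX ξp)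
            = 2 * (2 * Real.sqrt (p.swap.tA x * p.swap.tC x)) := by linarith
        rw [← abs_of_pos (by positivity : 0 < 2 * (2 * Real.sqrt (p.swap.tA x * p.swap.tC x))),
          ← e2, abs_mul, abs_neg_one_zpow, one_mul]
      rw [e1, show (-1 : ℝ) ^ k * (2 * p.swap.tX 1 - p.swap.tX ξm - p.swap.tX ξp)
        = 2 * ((-1 : ℝ) ^ k * p.swap.tX 1 - (-1 : ℝ) ^ k * p.swap.tB x) by linarith,
        mul_div_mul_left _ _ (by norm_num)]
  · push Not at h2
    have h0 : ∫ ξ in Ioo (0 : ℝ) 1, ‖deriv p.mu x‖ / Real.sqrt (p.Dreal x ξ) = 0 :=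
      setIntegral_eq_zero_of_forall_eq_zero fun ξ hξ =>
        h.weight_eq_zero hx hm hp em ep (hI hξ) (Or.inl (hξ.2.le.trans h2))
    rw [h0, mul_zero]

end roots

end LimitBounds

/-! ### From moments to test functions -/

/-- The largest function below `f` on `[a, b]` with Lipschitz constant `K`. -/
def lowerEnvelope (f : ℝ → ℝ) (a b K x : ℝ) : ℝ := ⨅ u : Icc a b, (f u + K * |x - u|)

section envelope

variable {f : ℝ → ℝ} {a b c K x : ℝ}

lemma lowerEnvelope_aux (hf : ∀ u ∈ Icc a b, |f u| ≤ c) (hK : 0 ≤ K) (x : ℝ) (u : Icc a b) :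
    -c ≤ f u + K * |x - u| := by
  have h1 := neg_le_of_abs_le (hf u u.2)
  have h2 : 0 ≤ K * |x - u| := by positivity
  linarith

lemma bddBelow_lowerEnvelope (hf : ∀ u ∈ Icc a b, |f u| ≤ c) (hK : 0 ≤ K) (x : ℝ) :
    BddBelow (range fun u : Icc a b => f u + K * |x - u|) := by
  refine ⟨-c, ?_⟩
  rintro _ ⟨u, rfl⟩
  exact lowerEnvelope_aux hf hK x u

lemma lowerEnvelope_le (hf : ∀ u ∈ Icc a b, |f u| ≤ c) (hK : 0 ≤ K) (hx : x ∈ Icc a b) :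
    lowerEnvelope f a b K x ≤ f x := by
  have h := ciInf_le (bddBelow_lowerEnvelope hf hK x) ⟨x, hx⟩
  rw [lowerEnvelope]
  refine h.trans (le_of_eq ?_)
  simp

lemma neg_le_lowerEnvelope (hab : a ≤ b) (hf : ∀ u ∈ Icc a b, |f u| ≤ c) (hK : 0 ≤ K) (x : ℝ) :
    -c ≤ lowerEnvelope f a b K x :=
  haveI : Nonempty (Icc a b) := ⟨⟨a, le_rfl, hab⟩⟩
  le_ciInf fun u => lowerEnvelope_aux hf hK x u

lemma abs_lowerEnvelope_le (hab : a ≤ b) (hf : ∀ u ∈ Icc a b, |f u| ≤ c) (hK : 0 ≤ K)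
    (hx : x ∈ Icc a b) : |lowerEnvelope f a b K x| ≤ c :=
  abs_le.2 ⟨neg_le_lowerEnvelope hab hf hK x,
    (lowerEnvelope_le hf hK hx).trans (le_of_abs_le (hf x hx))⟩

lemma lowerEnvelope_lipschitz (hab : a ≤ b) (hf : ∀ u ∈ Icc a b, |f u| ≤ c) (hK : 0 ≤ K)
    (x y : ℝ) : |lowerEnvelope f a b K x - lowerEnvelope f a b K y| ≤ K * |x - y| := by
  have : Nonempty (Icc a b) := ⟨⟨a, le_rfl, hab⟩⟩
  have key : ∀ x y : ℝ, lowerEnvelope f a b K x - K * |x - y| ≤ lowerEnvelope f a b K y := by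
    intro x y
    refine le_ciInf fun u => ?_
    have h1 := ciInf_le (bddBelow_lowerEnvelope hf hK x) u
    have h2 : |x - u| ≤ |x - y| + |y - u| := abs_sub_le _ _ _
    have h3 := mul_le_mul_of_nonneg_left h2 hK
    rw [lowerEnvelope]
    linarith
  have h1 := key x y
  have h2 := key y x
  rw [abs_sub_comm y x] at h2
  exact abs_le.2 ⟨by linarith, by linarith⟩

lemma continuous_lowerEnvelope (hab : a ≤ b) (hf : ∀ u ∈ Icc a b, |f u| ≤ c) (hK : 0 ≤ K) :
    Continuous (lowerEnvelope f a b K) :=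
  (LipschitzWith.of_dist_le_mul (K := ⟨K, hK⟩) fun x y => by
    rw [Real.dist_eq, Real.dist_eq]; exact lowerEnvelope_lipschitz hab hf hK x y).continuous

/-- Once `N d ≥ 2c`, a point at distance at least `d` from `x` pays a penalty exceeding the
oscillation of `f`, so only points where `f` is close to `f x` compete. -/
lemma tendsto_lowerEnvelope (hab : a ≤ b) (hf : ∀ u ∈ Icc a b, |f u| ≤ c) (hx : x ∈ Icc a b)
    (hc : ContinuousAt f x) :
    Tendsto (fun N : ℕ => lowerEnvelope f a b N x) atTop (𝓝 (f x)) := by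
  have : Nonempty (Icc a b) := ⟨⟨a, le_rfl, hab⟩⟩
  refine Metric.tendsto_nhds.2 fun e he => ?_
  obtain ⟨d, hd, hd'⟩ := Metric.continuousAt_iff.1 hc (e / 2) (by positivity)
  filter_upwards [eventually_ge_atTop ⌈2 * c / d⌉₊] with N hN
  have hN' : 2 * c ≤ N * d := (div_le_iff₀ hd).1 ((Nat.le_ceil _).trans (by exact_mod_cast hN))
  have h1 := lowerEnvelope_le hf N.cast_nonneg hx
  have h2 : f x - e / 2 ≤ lowerEnvelope f a b N x := by
    refine le_ciInf fun u => ?_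
    by_cases hu : |u - x| < d
    · have h3 := hd' (x := u) (by rwa [Real.dist_eq])
      rw [Real.dist_eq] at h3
      have h4 := (abs_lt.1 h3).1
      have h5 : 0 ≤ (N : ℝ) * |x - u| := by positivity
      linarith
    · push Not at hu
      rw [abs_sub_comm] at hu
      have h3 := mul_le_mul_of_nonneg_left hu N.cast_nonneg (α := ℝ)
      have h4 := le_of_abs_le (hf x hx)
      have h5 := neg_le_of_abs_le (hf u u.2)
      linarith
  rw [Real.dist_eq, abs_lt]
  constructor <;> linarith

end envelope

/-! ### Passage from moments to Riemann integrable functions -/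

section moments

variable {X : ℕ → Type*} [∀ n, Fintype (X n)] {W x z : (n : ℕ) → X n → ℝ}

lemma abs_sum_mul_sub_le {ι : Type*} [Fintype ι] {W u v : ι → ℝ} {e : ℝ} (h0 : ∀ y, 0 ≤ W y)
    (h1 : ∑ y, W y = 1) (huv : ∀ y, |u y - v y| ≤ e) :
    |∑ y, W y * u y - ∑ y, W y * v y| ≤ e := by
  rw [← Finset.sum_sub_distrib]
  calc |∑ y, (W y * u y - W y * v y)| ≤ ∑ y, |W y * u y - W y * v y| :=
        Finset.abs_sum_le_sum_abs _ _
    _ ≤ ∑ y, W y * e := by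
        refine Finset.sum_le_sum fun y _ => ?_
        rw [← mul_sub, abs_mul, abs_of_nonneg (h0 y)]
        exact mul_le_mul_of_nonneg_left (huv y) (h0 y)
    _ = e := by rw [← Finset.sum_mul, h1, one_mul]

/-- Convergence of moments implies convergence for continuous test functions. -/
lemma tendsto_sum_continuous_of_moments {a b : ℝ} {S : Set ℝ} {T ρ : ℝ → ℝ}
    (hS : MeasurableSet S)
    (hW : ∀ᶠ n in atTop, (∀ y, 0 ≤ W n y) ∧ ∑ y, W n y = 1 ∧ ∀ y, x n y ∈ Icc a b)
    (hρ : IntegrableOn ρ S) (hT : Continuous T) (hTmem : ∀ s ∈ S, T s ∈ Icc a b)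
    (hm : ∀ m : ℕ, Tendsto (fun n => ∑ y, W n y * x n y ^ m) atTop
      (𝓝 (∫ s in S, T s ^ m * ρ s))) {G : ℝ → ℝ} (hG : Continuous G) :
    Tendsto (fun n => ∑ y, W n y * G (x n y)) atTop (𝓝 (∫ s in S, G (T s) * ρ s)) := by
  have hint : ∀ {H : ℝ → ℝ}, Continuous H → IntegrableOn (fun s => H (T s) * ρ s) S := by
    intro H hH
    obtain ⟨C, hC⟩ := (isCompact_Icc (a := a) (b := b)).exists_bound_of_continuousOn
      hH.continuousOn
    refine Integrable.bdd_mul (c := C) hρ (hH.comp hT).aestronglyMeasurable ?_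
    filter_upwards [ae_restrict_mem hS] with s hs
    exact hC _ (hTmem s hs)
  have hpoly : ∀ q : Polynomial ℝ, Tendsto (fun n => ∑ y, W n y * q.eval (x n y)) atTop
      (𝓝 (∫ s in S, q.eval (T s) * ρ s)) := by
    intro q
    have e1 : ∀ n, ∑ y, W n y * q.eval (x n y)
        = ∑ i ∈ Finset.range (q.natDegree + 1), q.coeff i * ∑ y, W n y * x n y ^ i := by
      intro n
      simp only [Polynomial.eval_eq_sum_range, Finset.mul_sum]
      rw [Finset.sum_comm]
      refine Finset.sum_congr rfl fun i _ => Finset.sum_congr rfl fun y _ => ?_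
      ring
    have e2 : ∫ s in S, q.eval (T s) * ρ s
        = ∑ i ∈ Finset.range (q.natDegree + 1), q.coeff i * ∫ s in S, T s ^ i * ρ s := by
      simp only [← integral_const_mul]
      rw [← integral_finsetSum]
      · refine integral_congr_ae (ae_of_all _ fun s => ?_)
        simp only [Polynomial.eval_eq_sum_range, Finset.sum_mul]
        refine Finset.sum_congr rfl fun i _ => ?_
        ring
      · intro i _
        exact (hint (continuous_pow i)).const_mul _
    simp only [e1, e2]
    exact tendsto_finsetSum _ fun i _ => (hm i).const_mul _
  refine Metric.tendsto_nhds.2 fun e he => ?_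
  set C : ℝ := ∫ s in S, |ρ s| with hC
  have hC0 : 0 ≤ C := integral_nonneg fun s => abs_nonneg _
  -- The error is paid once under the probability weights and once under `|ρ|`, hence `C + 1`.
  obtain ⟨q, hq⟩ := exists_polynomial_near_of_continuousOn a b G hG.continuousOn
    (e / (2 * (C + 1))) (by positivity)
  set d := e / (2 * (C + 1)) with hd
  have hd0 : 0 < d := by positivity
  have hdC : d * (C + 1) = e / 2 := by rw [hd]; field_simp
  have hbound : |(∫ s in S, q.eval (T s) * ρ s) - ∫ s in S, G (T s) * ρ s| ≤ d * C := by
    rw [← integral_sub (hint q.continuous) (hint hG), hC, ← integral_const_mul, ← Real.norm_eq_abs]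
    refine norm_integral_le_of_norm_le (hρ.abs.const_mul d) ?_
    filter_upwards [ae_restrict_mem hS] with s hs
    rw [← sub_mul, norm_mul, Real.norm_eq_abs, Real.norm_eq_abs]
    exact mul_le_mul_of_nonneg_right (hq _ (hTmem s hs)).le (abs_nonneg _)
  filter_upwards [hW, Metric.tendsto_nhds.1 (hpoly q) (e / 2) (by positivity)] with n hn h2
  have h1 := abs_sum_mul_sub_le hn.1 hn.2.1 (u := fun y => G (x n y))
    (v := fun y => q.eval (x n y)) (e := d) fun y => by
      rw [abs_sub_comm]; exact (hq _ (hn.2.2 y)).le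
  rw [Real.dist_eq] at h2 ⊢
  have h3 := abs_sub_le (∑ y, W n y * G (x n y)) (∑ y, W n y * q.eval (x n y))
    (∫ s in S, G (T s) * ρ s)
  have h4 := abs_sub_le (∑ y, W n y * q.eval (x n y)) (∫ s in S, q.eval (T s) * ρ s)
    (∫ s in S, G (T s) * ρ s)
  nlinarith

/-- Convergence for Lipschitz test functions implies convergence for Riemann integrable ones. -/
lemma tendsto_sum_of_lipschitz {a b R c : ℝ} {ρ f : ℝ → ℝ} (hbR : b ≤ R) (haR : a ≤ R)
    (hW : ∀ᶠ n in atTop, (∀ y, 0 ≤ W n y) ∧ ∀ y, z n y ∈ Icc a R)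
    (hρ : IntegrableOn ρ (Ioo a b))
    (hlip : ∀ G : ℝ → ℝ, Continuous G → (∃ K : ℝ, ∀ s t, |G s - G t| ≤ K * |s - t|) →
      Tendsto (fun n => ∑ y, W n y * G (z n y)) atTop (𝓝 (∫ s in Ioo a b, G s * ρ s)))
    (hf : ∀ s ∈ Icc a R, |f s| ≤ c) (hfc : ∀ᵐ s ∂(volume.restrict (Ioo a b)), ContinuousAt f s) :
    Tendsto (fun n => ∑ y, W n y * f (z n y)) atTop (𝓝 (∫ s in Ioo a b, f s * ρ s)) := by
  have hsub : Ioo a b ⊆ Icc a R := fun s hs => ⟨hs.1.le, hs.2.le.trans hbR⟩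
  -- A lower bound suffices: applied to `-f` it gives the upper one. The envelopes converge only at
  -- continuity points of `f`, almost all by `hfc`.
  have lower : ∀ f : ℝ → ℝ, (∀ s ∈ Icc a R, |f s| ≤ c) →
      (∀ᵐ s ∂(volume.restrict (Ioo a b)), ContinuousAt f s) → ∀ e > 0,
      ∀ᶠ n in atTop, (∫ s in Ioo a b, f s * ρ s) - e < ∑ y, W n y * f (z n y) := by
    intro f hf hfc e he
    have h1 : Tendsto (fun N : ℕ => ∫ s in Ioo a b, lowerEnvelope f a R N s * ρ s) atTop
        (𝓝 (∫ s in Ioo a b, f s * ρ s)) := by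
      refine tendsto_integral_of_dominated_convergence (fun s => c * |ρ s|) (fun N => ?_)
        (hρ.abs.const_mul c) (fun N => ?_) ?_
      · exact (continuous_lowerEnvelope haR hf N.cast_nonneg).aestronglyMeasurable.mul
          hρ.aestronglyMeasurable
      · filter_upwards [ae_restrict_mem measurableSet_Ioo] with s hs
        rw [norm_mul, Real.norm_eq_abs, Real.norm_eq_abs]
        exact mul_le_mul_of_nonneg_right
          (abs_lowerEnvelope_le haR hf N.cast_nonneg (hsub hs)) (abs_nonneg _)
      · filter_upwards [hfc, ae_restrict_mem measurableSet_Ioo] with s hs hs'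
        exact (tendsto_lowerEnvelope haR hf (hsub hs') hs).mul_const _
    obtain ⟨N, hN⟩ := (h1.eventually_const_lt (sub_lt_self _ he)).exists
    have h2 := hlip _ (continuous_lowerEnvelope haR hf N.cast_nonneg)
      ⟨N, lowerEnvelope_lipschitz haR hf N.cast_nonneg⟩
    filter_upwards [h2.eventually_const_lt hN, hW] with n hn hWn
    refine hn.trans_le (Finset.sum_le_sum fun y _ => ?_)
    exact mul_le_mul_of_nonneg_left (lowerEnvelope_le hf N.cast_nonneg (hWn.2 y)) (hWn.1 y)
  refine Metric.tendsto_nhds.2 fun e he => ?_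
  filter_upwards [lower f hf hfc e he, lower (fun s => -f s) (fun s hs => by
    rw [abs_neg]; exact hf s hs) (hfc.mono fun s hs => hs.neg) e he] with n h1 h2
  simp only [neg_mul, mul_neg, integral_neg, Finset.sum_neg_distrib] at h2
  rw [Real.dist_eq, abs_lt]
  constructor <;> linarith

end moments

/-! ### Inverting the nodes -/

namespace Params

variable (p : Params)

/-- The inverse of `x ↦ 2 cos (gq ((gγ + gδ)/2 + x))` on an interval of monotonicity. -/
def invX (k : ℤ) (v : ℝ) : ℝ :=
  (Real.arccos ((-1 : ℝ) ^ k * v / 2) + k * Real.pi) / p.gq - (p.gγ + p.gδ) / 2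

lemma continuous_invX (k : ℤ) : Continuous (p.invX k) := by
  unfold invX
  have := Real.continuous_arccos
  fun_prop

lemma invX_cs (hq : 0 < p.gq) {k : ℤ} {t : ℝ} (h1 : p.per * k ≤ t) (h2 : t ≤ p.per * (k + 1)) :
    p.invX k (p.cs t) = (t - (p.gγ + p.gδ)) / 2 := by
  have e : (-1 : ℝ) ^ k * p.cs t / 2 = Real.cos (p.gq * t / 2 - k * Real.pi) := by
    rw [Real.cos_sub_int_mul_pi, cs]; ring
  have h1' := mul_le_mul_of_nonneg_left h1 hq.le
  have h2' := mul_le_mul_of_nonneg_left h2 hq.le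
  rw [← mul_assoc, gq_mul_per p hq] at h1' h2'
  rw [invX, e, Real.arccos_cos (by linarith) (by linarith)]
  field_simp
  ring

lemma cs_mem_Icc (t : ℝ) : p.cs t ∈ Icc (-2 : ℝ) 2 := by
  rw [cs]
  constructor <;> linarith [Real.neg_one_le_cos (p.gq * t / 2), Real.cos_le_one (p.gq * t / 2)]

end Params

lemma LimitBounds.invX_tX {p : Params} {j k l m k₂ : ℤ} (h : LimitBounds p j k l m k₂) {x : ℝ}
    (hx : x ∈ Icc 0 (-p.gγ)) : p.invX k₂ (p.tX x) = x := by
  rw [Params.tX, p.invX_cs h.gq_pos (by linarith [h.cdl, hx.1]) (by linarith [h.cdr, hx.2])]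
  ring

/-- The inverse is built from the limiting `gγ` whereas the node uses `g_{γ_n}` and the extra `1/n`;
the error is a shift independent of `y`, vanishing as `n → ∞`. -/
lemma AngleBounds.invX_rX {p : Params} {j k l m k₂ : ℤ} {n M : ℕ} (hn : 0 < n)
    (h : AngleBounds p j k l m k₂ (gGamma n M)) (hq : 0 < p.gq) {y : ℕ} (hy : y ≤ M) :
    p.invX k₂ (p.rX (gGamma n M) (1 / n) (y / n))
      = y / n + (gGamma n M - p.gγ + 1 / n) / 2 := by
  have hn' : (0 : ℝ) < n := by exact_mod_cast hn
  have hM : gGamma n M = -(M / n) - 1 / n := by rw [gGamma]; ring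
  have h1 : (y : ℝ) / n ≤ M / n := by gcongr
  have h2 : (0 : ℝ) ≤ y / n := by positivity
  have h3 : (0 : ℝ) ≤ 1 / n := by positivity
  have c1 := h.cdl
  have c2 := h.cdr
  rw [Params.rX, p.invX_cs hq (by linarith) (by linarith)]
  ring

/-! ### The scaling limit -/

namespace LimitBounds

variable {p : Params} {j k l m k₂ : ℤ}

section limits

variable {u e t : ℕ → ℝ} {ξ : ℝ}

/-- Continuity can fail only at a zero of the limiting denominator, excluded on the closed interval
by `sn_ab_two_ne`. -/
lemma tendsto_rA (h : LimitBounds p j k l m k₂) (hξ : ξ ∈ Icc 0 (-p.gγ))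
    (hu : Tendsto u atTop (𝓝 p.gγ)) (he : Tendsto e atTop (𝓝 0)) (ht : Tendsto t atTop (𝓝 ξ)) :
    Tendsto (fun n => p.rA (u n) (e n) (t n)) atTop (𝓝 (p.tA ξ)) := by
  have hc := p.continuous_sn
  have key : ContinuousAt (fun z : ℝ × ℝ × ℝ => p.rA z.1 z.2.1 z.2.2) (p.gγ, 0, ξ) := by
    unfold Params.rA
    refine ContinuousAt.div (by fun_prop) (by fun_prop) ?_
    simpa using h.sn_ab_two_ne hξ
  have h2 := key.tendsto.comp (hu.prodMk_nhds (he.prodMk_nhds ht))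
  simp only [p.rA_zero] at h2
  exact h2

lemma tendsto_rC (h : LimitBounds p j k l m k₂) (hξ : ξ ∈ Icc 0 (-p.gγ))
    (hu : Tendsto u atTop (𝓝 p.gγ)) (he : Tendsto e atTop (𝓝 0)) (ht : Tendsto t atTop (𝓝 ξ)) :
    Tendsto (fun n => p.rC (u n) (e n) (t n)) atTop (𝓝 (p.tC ξ)) := by
  have hc := p.continuous_sn
  have key : ContinuousAt (fun z : ℝ × ℝ × ℝ => p.rC z.1 z.2.1 z.2.2) (p.gγ, 0, ξ) := by
    unfold Params.rC
    refine ContinuousAt.div (by fun_prop) (by fun_prop) ?_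
    simpa using h.sn_ab_two_ne hξ
  have h2 := key.tendsto.comp (hu.prodMk_nhds (he.prodMk_nhds ht))
  simp only [p.rC_zero] at h2
  exact h2

lemma tendsto_rB (h : LimitBounds p j k l m k₂) (hξ : ξ ∈ Icc 0 (-p.gγ))
    (hu : Tendsto u atTop (𝓝 p.gγ)) (he : Tendsto e atTop (𝓝 0)) (ht : Tendsto t atTop (𝓝 ξ)) :
    Tendsto (fun n => p.rB (u n) (e n) (t n)) atTop (𝓝 (p.tB ξ)) := by
  have h1 : Tendsto (fun n => p.cs (u n + p.gδ + e n)) atTop (𝓝 (p.cs (p.gγ + p.gδ))) := by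
    have := (p.continuous_cs.tendsto (p.gγ + p.gδ + 0)).comp ((hu.add_const p.gδ).add he)
    rw [add_zero] at this
    exact this
  exact (h1.sub (h.tendsto_rA hξ hu he ht)).sub (h.tendsto_rC hξ hu he ht)

end limits

lemma tendsto_hpow {u : ℕ → ℝ} (hu : Tendsto u atTop (𝓝 p.gγ)) :
    Tendsto (fun n : ℕ => p.hpow (u n + p.gδ + 1 / n)) atTop (𝓝 (p.hpow (p.gγ + p.gδ))) := by
  have hc : Continuous p.hpow := by unfold Params.hpow; fun_prop
  have := (hc.tendsto (p.gγ + p.gδ + 0)).comp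
    ((hu.add_const p.gδ).add tendsto_one_div_atTop_nhds_zero_nat)
  rw [add_zero] at this
  exact this

lemma tendsto_add_one_div {i : ℕ → ℕ} {ξ : ℝ}
    (hi : Tendsto (fun n : ℕ => (i n : ℝ) / n) atTop (𝓝 ξ)) :
    Tendsto (fun n : ℕ => ((i n + 1 : ℕ) : ℝ) / n) atTop (𝓝 ξ) :=
  tendsto_div_of_eventually_eq_add (d := 1) (Eventually.of_forall fun n => by push_cast; rfl) hi

lemma tendsto_recurrence (h : LimitBounds p j k l m k₂) {u : ℕ → ℝ}
    (hu : Tendsto u atTop (𝓝 p.gγ)) {ξ : ℝ} (hξ : ξ ∈ Icc 0 (-p.gγ)) {i : ℕ → ℕ}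
    (hi : Tendsto (fun n : ℕ => (i n : ℝ) / n) atTop (𝓝 ξ)) :
    Tendsto (fun n : ℕ => recA (p.base n) p.α p.β (p.qpow (u n)) p.δ (i n)
        * recC (p.base n) p.α p.β (p.qpow (u n)) p.δ (i n + 1)) atTop (𝓝 (p.aSq ξ)) ∧
      Tendsto (fun n : ℕ => 1 + p.δ * p.qpow (u n) * p.base n
        - recA (p.base n) p.α p.β (p.qpow (u n)) p.δ (i n)
        - recC (p.base n) p.α p.β (p.qpow (u n)) p.δ (i n)) atTop (𝓝 (p.b ξ)) := by
  have he := tendsto_one_div_atTop_nhds_zero_nat (𝕜 := ℝ)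
  have hp := tendsto_hpow (p := p) hu
  have hA := ((Complex.continuous_ofReal.tendsto _).comp (h.tendsto_rA hξ hu he hi))
  have hC := ((Complex.continuous_ofReal.tendsto _).comp
    (h.tendsto_rC hξ hu he (tendsto_add_one_div hi)))
  have hB := ((Complex.continuous_ofReal.tendsto _).comp (h.tendsto_rB hξ hu he hi))
  constructor
  · rw [Params.aSq, p.limA_eq, p.limC_eq]
    simp only [p.recA_base, p.recC_base]
    exact (hp.mul hA).mul (hp.mul hC)
  · rw [p.b_eq]
    simp only [p.rB_base]
    exact hp.mul hB

/-- The law of large numbers for the rescaled ensembles. -/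
lemma ae_tendsto (h : LimitBounds p j k l m k₂) {Ω : Type*} [MeasurableSpace Ω] (P : Measure Ω)
    [IsProbabilityMeasure P] {M : ℕ → ℕ} (hM : ∀ᶠ n : ℕ in atTop, n ≤ M n)
    (hb : ∀ᶠ n : ℕ in atTop, AngleBounds p j k l m k₂ (gGamma n (M n)))
    (hlim : Tendsto (fun n : ℕ => gGamma n (M n)) atTop (𝓝 p.gγ))
    {Y : (n : ℕ) → Ω → Fin n → Fin (M n + 1)}
    (hY : ∀ᶠ n : ℕ in atTop,
      IsEnsemble P (p.base n) p.α p.β (p.qpow (gGamma n (M n))) p.δ n (M n) (Y n))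
    {f : ℝ → ℝ} (hf : ∀ R : ℝ, ∃ c : ℝ, ∀ x ∈ Icc 0 R, |f x| ≤ c)
    (hfc : ∀ᵐ x ∂(volume.restrict (Ioo 0 (-p.gγ))), ContinuousAt f x) :
    ∀ᵐ ω ∂P, Tendsto
      (fun n : ℕ => (1 / n : ℝ) * ∑ i : Fin n, f (((Y n ω i : ℕ) : ℝ) / n))
      atTop (𝓝 (∫ x in Ioo 0 (-p.gγ), f x * p.density x)) := by
  have hq := h.gq_pos
  have hg := h.g_neg
  have he := tendsto_one_div_atTop_nhds_zero_nat (𝕜 := ℝ)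
  have hsys : ∀ n : ℕ, ∃ F : ℕ → Fin (M n + 1) → ℝ,
      (0 < n → n ≤ M n → AngleBounds p j k l m k₂ (gGamma n (M n)) →
      JacobiSystem (M n) (fun y => p.rX (gGamma n (M n)) (1 / n) (y / n))
        (fun i => p.rB (gGamma n (M n)) (1 / n) (i / n))
        (fun i => p.rA (gGamma n (M n)) (1 / n) (i / n)
          * p.rC (gGamma n (M n)) (1 / n) ((i + 1 : ℕ) / n)) F ∧
      (IsEnsemble P (p.base n) p.α p.β (p.qpow (gGamma n (M n))) p.δ n (M n) (Y n) →
        HasDetLaw P (fun i : Fin n => F i) (Y n))) := by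
    intro n
    by_cases hn : 0 < n ∧ n ≤ M n ∧ AngleBounds p j k l m k₂ (gGamma n (M n))
    · obtain ⟨F, hF1, hF2⟩ := hn.2.2.exists_jacobiSystem hn.1 (by omega) hq h.odd
      exact ⟨F, fun _ h2 _ => ⟨hF1, hF2 P h2 (Y n)⟩⟩
    -- A dummy value for the `n` at which the bounds fail, so that the system can be chosen for
    -- every `n`.
    · exact ⟨fun _ _ => 0, fun h1 h2 h3 => absurd ⟨h1, h2, h3⟩ hn⟩
  choose F hF using hsys
  have hev : ∀ᶠ n : ℕ in atTop, 0 < n ∧ n ≤ M n ∧ AngleBounds p j k l m k₂ (gGamma n (M n)) :=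
    (eventually_gt_atTop 0).and (hM.and hb)
  have hscaled : ScaledJacobi M (fun n y => p.rX (gGamma n (M n)) (1 / n) (y / n))
      (fun n i => p.rB (gGamma n (M n)) (1 / n) (i / n))
      (fun n i => p.rA (gGamma n (M n)) (1 / n) (i / n)
        * p.rC (gGamma n (M n)) (1 / n) ((i + 1 : ℕ) / n)) F
      (fun ξ => Real.sqrt (p.tA ξ * p.tC ξ)) p.tB := by
    have hI : ∀ {ξ : ℝ}, ξ ∈ Ioo (0 : ℝ) 1 → ξ ∈ Icc 0 (-p.gγ) := fun hξ =>
      ⟨hξ.1.le, by linarith [hξ.2, h.upper]⟩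
    refine ⟨hev.mono fun n hn => (hF n hn.1 hn.2.1 hn.2.2).1, hM, fun ξ hξ i hi => ?_,
      fun ξ hξ i hi => h.tendsto_rB (hI hξ) hlim he hi⟩
    exact (Real.continuous_sqrt.tendsto _).comp ((h.tendsto_rA (hI hξ) hlim he hi).mul
      (h.tendsto_rC (hI hξ) hlim he (tendsto_add_one_div hi)))
  have hsum : ∀ (n : ℕ) (G : Fin (M n + 1) → ℝ),
      (1 / n : ℝ) * ∑ i : Fin n, ∑ y, F n i y * F n i y * G y
        = ∑ y, ((1 / n : ℝ) * ∑ i : Fin n, F n i y * F n i y) * G y := by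
    intro n G
    rw [Finset.sum_comm, Finset.mul_sum]
    refine Finset.sum_congr rfl fun y _ => ?_
    rw [← Finset.sum_mul, mul_assoc]
  -- Up to the factor `1/n` this is the one-point function; `W n` is the mean empirical
  -- distribution.
  set W : (n : ℕ) → Fin (M n + 1) → ℝ := fun n y => (1 / n : ℝ) * ∑ i : Fin n, F n i y * F n i y
    with hWdef
  have hW0 : ∀ n y, 0 ≤ W n y := fun n y =>
    mul_nonneg (by positivity) (Finset.sum_nonneg fun i _ => mul_self_nonneg _)
  have horth : ∀ᶠ n : ℕ in atTop, ∀ i i' : Fin n,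
      ∑ y, F n i y * F n i' y = if i = i' then 1 else 0 := by
    filter_upwards [hev] with n hn i i'
    have := (hF n hn.1 hn.2.1 hn.2.2).1.orthonormal i i' (by omega) (by omega)
    rw [this]
    simp only [Fin.ext_iff]
  have hW1 : ∀ᶠ n : ℕ in atTop, ∑ y, W n y = 1 := by
    filter_upwards [horth, hev] with n hn hn'
    have h1 := hsum n fun _ => 1
    simp only [mul_one] at h1
    rw [hWdef, ← h1, Finset.sum_congr rfl fun i _ => by rw [hn i i, if_pos rfl]]
    have : (n : ℝ) ≠ 0 := by exact_mod_cast hn'.1.ne'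
    simp [this]
  have hmom : ∀ r : ℕ, Tendsto (fun n : ℕ => ∑ y : Fin (M n + 1),
      W n y * p.rX (gGamma n (M n)) (1 / n) (y / n) ^ r) atTop
      (𝓝 (∫ x in Ioo 0 (-p.gγ), p.tX x ^ r * p.density x)) := by
    intro r
    rw [← h.integral_density (continuous_pow r)]
    have h1 := hscaled.tendsto_trace (r := 2) (Eventually.of_forall fun n y _ =>
      abs_le.2 (p.cs_mem_Icc _)) r
    simp only [cosMoment, Int.cast_zero, zero_mul, Real.cos_zero, mul_one] at h1
    refine h1.congr fun n => ?_
    rw [hsum]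
  have hcont := fun (G : ℝ → ℝ) (hG : Continuous G) => tendsto_sum_continuous_of_moments
    (W := W) (x := fun n y => p.rX (gGamma n (M n)) (1 / n) (y / n)) (a := -2) (b := 2)
    measurableSet_Ioo (hW1.mono fun n hn => ⟨hW0 n, hn, fun y => p.cs_mem_Icc _⟩)
    h.integrableOn_density p.continuous_tX (fun s _ => p.cs_mem_Icc _) hmom hG
  have hlip : ∀ G : ℝ → ℝ, Continuous G → (∃ K : ℝ, ∀ s t, |G s - G t| ≤ K * |s - t|) →
      Tendsto (fun n : ℕ => ∑ y : Fin (M n + 1), W n y * G (y / n)) atTop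
        (𝓝 (∫ s in Ioo 0 (-p.gγ), G s * p.density s)) := by
    rintro G hG ⟨K, hK⟩
    have h1 := hcont (fun v => G (p.invX k₂ v)) (hG.comp (p.continuous_invX k₂))
    rw [setIntegral_congr_fun measurableSet_Ioo fun s hs => by
      simp only [h.invX_tX (Ioo_subset_Icc_self hs)]; rfl] at h1
    have hε : Tendsto (fun n : ℕ => K * |(gGamma n (M n) - p.gγ + 1 / n) / 2|) atTop (𝓝 0) := by
      have := ((((hlim.sub_const p.gγ).add he).div_const 2).abs).const_mul K
      simpa using this
    have h2 : Tendsto (fun n : ℕ => ∑ y : Fin (M n + 1), W n y * G (y / n)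
        - ∑ y : Fin (M n + 1),
          W n y * G (p.invX k₂ (p.rX (gGamma n (M n)) (1 / n) (y / n)))) atTop (𝓝 0) := by
      refine squeeze_zero_norm' ?_ hε
      filter_upwards [hev, hW1] with n hn hn1
      refine abs_sum_mul_sub_le (hW0 n) hn1 fun y => ?_
      rw [hn.2.2.invX_rX hn.1 hq (by omega)]
      refine (hK _ _).trans (le_of_eq ?_)
      rw [sub_add_cancel_left, abs_neg]
    have h3 := h1.add h2
    rw [add_zero] at h3
    exact h3.congr fun n => by ring
  -- For finite `n` the points `y/n` may exceed `-gγ`, so `f` is bounded on a slightly longer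
  -- interval.
  obtain ⟨c, hc⟩ := hf (-p.gγ + 1)
  have hz : ∀ᶠ n : ℕ in atTop, ∀ y : Fin (M n + 1), ((y : ℕ) : ℝ) / n ∈ Icc 0 (-p.gγ + 1) := by
    filter_upwards [hlim.eventually_const_lt (sub_one_lt p.gγ), hev] with n hn hn' y
    have h1 : ((y : ℕ) : ℝ) / n ≤ (M n + 1 : ℝ) / n := by
      gcongr
      exact_mod_cast y.2.le
    refine ⟨by positivity, ?_⟩
    rw [gGamma] at hn
    linarith
  refine ae_tendsto_of_hasDetLaw (f := fun n i => F n i) (c := c)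
    (g := fun n y => f (((y : ℕ) : ℝ) / n)) ?_ ?_
  · filter_upwards [hev, hY, horth, hz] with n hn hYn hon hzn
    exact ⟨(hF n hn.1 hn.2.1 hn.2.2).2 hYn, hYn.1, hon, fun y => hc _ (hzn y)⟩
  · simp only [hsum]
    exact tendsto_sum_of_lipschitz (W := W) (z := fun n y => ((y : ℕ) : ℝ) / n)
      (R := -p.gγ + 1) (by linarith) (by linarith) (hz.mono fun n hn => ⟨hW0 n, hn⟩)
      h.integrableOn_density hlip hc hfc

end LimitBounds

/-- The angle restrictions pass to the limit and determine the integer `k₁`. -/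
lemma limitBounds_of_restrictions {p : Params} {M : ℕ → ℕ} {j k l m k₁ k₂ : ℤ} (hq0 : 0 < p.gq)
    (hγ1 : p.gγ < 0) (hlm : Odd |l - m|)
    (hb : ∀ᶠ n : ℕ in atTop, AngleBounds p j k l m k₂ (gGamma n (M n)))
    (hlim : Tendsto (fun n : ℕ => gGamma n (M n)) atTop (𝓝 p.gγ))
    (hk₁ : 2 * k₁ * Real.pi / p.gq < p.gα + p.gβ)
    (hk₁' : p.gα + p.gβ < 2 * Real.pi * (k₁ + 1) / p.gq + 2 * p.gγ) :
    k = k₁ ∧ LimitBounds p j k l m k₂ := by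
  have h := AngleBounds.of_tendsto hb hlim
  have hp := p.per_pos hq0
  have e1 : 2 * k₁ * Real.pi / p.gq = p.per * k₁ := by rw [Params.per]; ring
  have e2 : 2 * Real.pi * (k₁ + 1) / p.gq = p.per * (k₁ + 1) := by rw [Params.per]; ring
  rw [e1] at hk₁
  rw [e2] at hk₁'
  have cast_lt : ∀ a b : ℤ, p.per * a < p.per * b → a < b := fun a b hab => by
    exact_mod_cast lt_of_mul_lt_mul_left hab hp.le
  have i1 : k < k₁ + 1 := cast_lt _ _ (by push_cast; linarith [h.abl])
  have i2 : k₁ < k + 1 := cast_lt _ _ (by push_cast; linarith [h.abr])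
  obtain rfl : k = k₁ := by omega
  exact ⟨rfl, h, hq0, hlm, hk₁, by linarith⟩

end QRacah
end

/-! ### The main theorem -/

theorem theorem3p2 {Ω : Type*} [MeasurableSpace Ω] (P : Measure Ω) [IsProbabilityMeasure P]
    (p : QRacah.Params) (M : ℕ → ℕ) (j k l m k₁ k₂ : ℤ)
    (hq0 : 0 < p.gq) (hqπ : p.gq < Real.pi)
    (hγ0 : -(Real.pi / p.gq) < p.gγ) (hγ1 : p.gγ < 0)
    (hlm : Odd |l - m|)
    (hM : ∀ᶠ n : ℕ in atTop, n ≤ M n)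
    (hres : ∀ᶠ n : ℕ in atTop, QRacah.Restrictions p j k l m k₂ (QRacah.gGamma n (M n)))
    (hlim : Tendsto (fun n : ℕ => QRacah.gGamma n (M n)) atTop (𝓝 p.gγ))
    (hk₁ : 2 * k₁ * Real.pi / p.gq < p.gα + p.gβ)
    (hk₁' : p.gα + p.gβ < 2 * Real.pi * (k₁ + 1) / p.gq + 2 * p.gγ)
    (Y : (n : ℕ) → Ω → Fin n → Fin (M n + 1))
    (hY : ∀ᶠ n : ℕ in atTop,
      QRacah.IsEnsemble P (p.base n) p.α p.β (p.gammaN n (M n)) p.δ n (M n) (Y n)) :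
    -- `a(ξ)²` and `b(ξ)` are the limits of the recurrence coefficients
    (∀ ξ ∈ Icc 0 (-p.gγ), ∀ i : ℕ → ℕ,
      Tendsto (fun n : ℕ => (i n : ℝ) / n) atTop (𝓝 ξ) →
        Tendsto (fun n : ℕ =>
          QRacah.recA (p.base n) p.α p.β (p.gammaN n (M n)) p.δ (i n)
            * QRacah.recC (p.base n) p.α p.β (p.gammaN n (M n)) p.δ (i n + 1))
          atTop (𝓝 (p.aSq ξ)) ∧
        Tendsto (fun n : ℕ =>
          1 + p.δ * p.gammaN n (M n) * p.base n
            - QRacah.recA (p.base n) p.α p.β (p.gammaN n (M n)) p.δ (i n)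
            - QRacah.recC (p.base n) p.α p.β (p.gammaN n (M n)) p.δ (i n))
          atTop (𝓝 (p.b ξ))) ∧
    ∃ ξm ξp : ℝ → ℝ,
      -- the two solutions
      (∀ x ∈ Icc 0 (-p.gγ), deriv p.mu x ≠ 0 →
        ξm x ∈ Icc 0 (-p.gγ) ∧ ξp x ∈ Icc 0 (-p.gγ) ∧ ξm x ≤ ξp x ∧
        ∀ ξ ∈ Icc 0 (-p.gγ), p.D x ξ = 0 ↔ ξ = ξm x ∨ ξ = ξp x) ∧
      -- inside the interval the non-degeneracy holds and the solutions are distinct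
      (∀ x ∈ Ioo 0 (-p.gγ), deriv p.mu x ≠ 0 ∧ ξm x < ξp x) ∧
      -- the density is the one given by the recurrence coefficients
      (∀ x ∈ Ioo 0 (-p.gγ),
        p.rho k₁ (ξm x) (ξp x)
          = ‖deriv p.mu x‖ / Real.pi
            * ∫ ξ in {ξ : ℝ | ξ ∈ Ioo 0 1 ∧ 0 ≤ p.Dreal x ξ}, 1 / Real.sqrt (p.Dreal x ξ)) ∧
      -- law of large numbers for Riemann integrable test functions
      ∀ f : ℝ → ℝ, (∀ R : ℝ, ∃ c : ℝ, ∀ x ∈ Icc 0 R, |f x| ≤ c) →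
        (∀ᵐ x ∂(volume.restrict (Icc 0 (-p.gγ))), ContinuousAt f x) →
        ∀ᵐ ω ∂P, Tendsto
          (fun n : ℕ => (1 / n : ℝ) * ∑ i : Fin n, f (((Y n ω i : ℕ) : ℝ) / n))
          atTop (𝓝 (∫ x in (0 : ℝ)..(-p.gγ), f x * p.rho k₁ (ξm x) (ξp x))) := by
  have hb := hres.mono fun n hn => hn.angleBounds
  obtain ⟨rfl, h⟩ := QRacah.limitBounds_of_restrictions hq0 hγ1 hlm hb hlim hk₁ hk₁'
  have hroots : ∀ x : ℝ, ∃ ξm ξp : ℝ, x ∈ Icc 0 (-p.gγ) → p.sn (p.gγ + p.gδ + 2 * x) ≠ 0 →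
      ξm ∈ Icc 0 (-p.gγ) ∧ ξp ∈ Icc 0 (-p.gγ) ∧ ξm ≤ ξp ∧
      (-1 : ℝ) ^ k * p.swap.tX ξm
        = (-1 : ℝ) ^ k * p.swap.tB x + 2 * Real.sqrt (p.swap.tA x * p.swap.tC x) ∧
      (-1 : ℝ) ^ k * p.swap.tX ξp
        = (-1 : ℝ) ^ k * p.swap.tB x - 2 * Real.sqrt (p.swap.tA x * p.swap.tC x) := by
    intro x
    by_cases hx : x ∈ Icc 0 (-p.gγ) ∧ p.sn (p.gγ + p.gδ + 2 * x) ≠ 0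
    · obtain ⟨ξm, hm, ξp, hp, hr⟩ := h.exists_roots hx.1 hx.2
      exact ⟨ξm, ξp, fun _ _ => ⟨hm, hp, hr⟩⟩
    -- Where `μ'` vanishes, or off the interval, nothing is claimed and the choice is arbitrary.
    · exact ⟨0, 0, fun h1 h2 => absurd ⟨h1, h2⟩ hx⟩
  choose ξm ξp hξ using hroots
  have hrho : ∀ x ∈ Ioo 0 (-p.gγ), p.rho k (ξm x) (ξp x) = p.density x := by
    intro x hx
    obtain ⟨hm, hp, hle, em, ep⟩ := hξ x (Ioo_subset_Icc_self hx) (h.sn_gd_two_ne hx)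
    exact h.rho_eq_density hx hm hp hle em ep
  refine ⟨fun ξ hmem i hi => h.tendsto_recurrence hlim hmem hi, ξm, ξp, fun x hx hne => ?_,
    fun x hx => ?_, fun x hx => ?_, fun f hf hfc => ?_⟩
  · rw [p.deriv_mu_ne_zero_iff hq0] at hne
    obtain ⟨hm, hp, hle, em, ep⟩ := hξ x hx hne
    exact ⟨hm, hp, hle, fun ξ hmem => h.D_eq_zero_iff hx hne hmem hm hp em ep⟩
  · have hne := h.sn_gd_two_ne hx
    obtain ⟨_, _, hle, em, ep⟩ := hξ x (Ioo_subset_Icc_self hx) hne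
    exact ⟨(p.deriv_mu_ne_zero_iff hq0 x).2 hne, h.roots_lt hx hle em ep⟩
  · rw [hrho x hx, p.setIntegral_Dreal_nonneg]
    rfl
  · rw [intervalIntegral.integral_of_le (by linarith), integral_Ioc_eq_integral_Ioo,
      setIntegral_congr_fun measurableSet_Ioo fun x hx => by rw [hrho x hx]]
    exact h.ae_tendsto P hM hb hlim hY hf
      (ae_restrict_of_ae_restrict_of_subset Ioo_subset_Icc_self hfc)
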